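/- Let $R=\mathbb C[x,y,z]$ and let $G=\{1,a,b,c\}$ be the Klein four-group, $c=ab$, acting on $R$ by algebra automorphisms with $a\cdot(x,y,z)=(-x,y,-z)$ and $b\cdot(x,y,z)=(-x,-y,z)$. Let $\alpha:G\times G\to\mathbb C^\times$ be a two-cocycle, and let $A=R\#_\alpha G=\bigoplus_{\sigma\in G}R\overline\sigma$ be the crossed product, with multiplication $(p\overline\sigma)(q\overline\tau)=p(\sigma\cdot q)\,\alpha(\sigma,\tau)\,\overline{\sigma\tau}$. Call $\alpha$ trivial if it is a coboundary, and nontrivial otherwise. (If $\alpha$ is not normalized, the unit of $A$ is $\alpha(1,1)^{-1}\overline 1$, and $R$ is identified with $R\overline 1$ through $p\mapsto p\,\alpha(1,1)^{-1}\overline 1$.) For an algebra $B$ with a homomorphism to an algebra $M$, $HH^n(B,M)$ denotes the cohomology of the Hochschild complex $\mathrm{Hom}_{\mathbb C}(B^{\otimes n},M)$, and $HH^n(B)=HH^n(B,B)$. Let $f,g,h$ be the operators on $A$ given by $u\mapsto xu-ux$, $yu-uy$, $zu-uz$, and let $$0\to A\xrightarrow{\ \delta_1^*\ }A^3\xrightarrow{\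 \delta_2^*\ }A^3\xrightarrow{\ \delta_3^*\ }A\to0,$$ $$\delta_1^*u=(fu,gu,hu),\quad \delta_2^*(u,v,w)=(-hu+fw,\,-hv+gw,\,-gu+fv),\quad \delta_3^*(u,v,w)=-gu+fv+hw,$$ be the Koszul complex with coefficients in $A$. A Hochschild cochain $\varphi$ on $R$ with values in $A$ gives the Koszul cochain $\kappa\varphi$ equal to $\varphi$ in degree $0$, $(\varphi(x),\varphi(y),\varphi(z))$ in degree $1$, $(\varphi(x,z)-\varphi(z,x),\ \varphi(y,z)-\varphi(z,y),\ \varphi(x,y)-\varphi(y,x))$ in degree $2$, and $\sum_{\pi\in S_3}\mathrm{sgn}(\pi)\,\varphi(x_{\pi(1)},x_{\pi(2)},x_{\pi(3)})$, with $(x_1,x_2,x_3)=(x,y,z)$, in degree $3$; a Hochschild cochain of $A$ is first restricted to $R$. Below, $HH^n=W$, for a subspace $W$ of the degree-$n$ Koszul cochains, means: there is a linear isomorphism $HH^n\to W$ that sends the class of each cocycle $\varphi$ to an element congruent to $\kappa\varphi$ modulo $\mathrm{Im}\,\delta_n^*$ (with $\mathrm{Im}\,\delta_0^*=0$). Then,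 for trivial and for nontrivial $\alpha$: * $HH^0(R,A)=A^R=R$ and $HH^0(R)=R$, where $A^R=\{u\in A\mid up=pu \text{ for all } p\in R\}$; and $HH^n(R,A)=0$ for $n>3$. * (i) $HH^1(R,A)=R^3$; also $\varphi\mapsto(\varphi(x),\varphi(y),\varphi(z))$ induces an isomorphism $HH^1(R)\cong R^3$. * (ii) $HH^2(R,A)=\{(p_1+q_1\overline a,\ p_2+q_2\overline c,\ p_3+q_3\overline b)\mid p_i\in R,\ q_1\in\mathbb C[y],\ q_2\in\mathbb C[x],\ q_3\in\mathbb C[z]\}$. * (iii) $HH^3(R,A)=R\oplus\mathbb C[y]\overline a\oplus\mathbb C[z]\overline b\oplus\mathbb C[x]\overline c$. In each degree $0\le n\le3$ the stated subspace is a complement of $\mathrm{Im}\,\delta_n^*$ in $\mathrm{Ker}\,\delta_{n+1}^*$ (with $\delta_4^*=0$). Moreover * $HH^0(A)=\mathbb C[x^2,y^2,z^2,xyz]=Z(A)$, the center of $A$, and $HH^n(A)=0$ for $n>3$. * (iv) Put $S=\mathbb C[x^2,y^2,z^2]$. Then $HH^1(A)=\{(p_1,p_2,p_3)\mid p_1\in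 xS+yzS,\ p_2\in yS+xzS,\ p_3\in zS+xyS\}$. * (v) $HH^2(A)=\{(p_1+q_1\overline a,\ p_2+q_2\overline c,\ p_3+q_3\overline b)\}$ with $p_1\in yS+xzS$, $p_2\in xS+yzS$, $p_3\in zS+xyS$, where $q_1\in y\mathbb C[y^2]$, $q_2\in x\mathbb C[x^2]$, $q_3\in z\mathbb C[z^2]$ if $\alpha$ is trivial, and $q_1\in\mathbb C[y^2]$, $q_2\in\mathbb C[x^2]$, $q_3\in\mathbb C[z^2]$ if $\alpha$ is nontrivial. * (vi) $HH^3(A)=\{p_1+p_2\overline a+p_3\overline b+p_4\overline c\}$ with $p_1\in\mathbb C[x^2,y^2,z^2,xyz]$, where $p_2\in\mathbb C[y^2]$, $p_3\in\mathbb C[z^2]$, $p_4\in\mathbb C[x^2]$ if $\alpha$ is trivial, and $p_2\in y\mathbb C[y^2]$, $p_3\in z\mathbb C[z^2]$, $p_4\in x\mathbb C[x^2]$ if $\alpha$ is nontrivial. -/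

import Mathlib

noncomputable section

namespace KleinOrbifold

/-! ## Hochschild cohomology -/

section Hochschild

variable {k B A : Type*} [CommRing k] [Ring B] [Algebra k B] [Ring A] [Algebra k A]

/-- Hochschild `n`-cochains of the `k`-algebra `B` with values in `A`:
`Hom_k(B^{⊗ n}, A)`, written as multilinear maps. -/
abbrev HCochain (k B A : Type*) [CommRing k] [Ring B] [Algebra k B] [Ring A] [Algebra k A]
    (n : ℕ) : Type _ :=
  MultilinearMap k (fun _ : Fin n => B) A

/-- Changing one entry of a tuple by `v` changes exactly one entry of the tuple obtained by
multiplying two neighbours, and that entry depends linearly on `v`. -/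
theorem contractNth_update {n : ℕ} (j : Fin n) (b : Fin (n + 1) → B) (i : Fin (n + 1)) :
    ∃ (m : Fin n) (L : B →ₗ[k] B), ∀ v : B,
      Fin.contractNth j.castSucc (· * ·) (Function.update b i v) =
        Function.update (Fin.contractNth j.castSucc (· * ·) b) m (L v) := by
  rcases lt_trichotomy (i : ℕ) (j : ℕ) with h | h | h
  · refine ⟨⟨i, by omega⟩, LinearMap.id, fun v => ?_⟩
    funext l
    simp only [Fin.contractNth, Function.update_apply, Fin.ext_iff, Fin.val_castSucc, Fin.val_succ,
      LinearMap.id_apply]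
    split_ifs <;> first | rfl | omega
  · refine ⟨j, LinearMap.mulRight k (b j.succ), fun v => ?_⟩
    funext l
    simp only [Fin.contractNth, Function.update_apply, Fin.ext_iff, Fin.val_castSucc, Fin.val_succ,
      LinearMap.mulRight_apply]
    split_ifs <;> first | rfl | omega | skip
    obtain rfl : l = j := Fin.ext (by omega)
    rfl
  · by_cases h' : (i : ℕ) = j + 1
    · refine ⟨j, LinearMap.mulLeft k (b j.castSucc), fun v => ?_⟩
      funext l
      simp only [Fin.contractNth, Function.update_apply, Fin.ext_iff, Fin.val_castSucc,
        Fin.val_succ, LinearMap.mulLeft_apply]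
      split_ifs <;> first | rfl | omega | skip
      obtain rfl : l = j := Fin.ext (by omega)
      rfl
    · refine ⟨⟨i - 1, by omega⟩, LinearMap.id, fun v => ?_⟩
      funext l
      simp only [Fin.contractNth, Function.update_apply, Fin.ext_iff, Fin.val_castSucc,
        Fin.val_succ, LinearMap.id_apply]
      split_ifs <;> first | rfl | omega

/-- The cochain `(b_0, …, b_n) ↦ f(b_0, …, b_j b_{j+1}, …, b_n)`. -/
def HCochain.contract {n : ℕ} (j : Fin n) (f : HCochain k B A n) : HCochain k B A (n + 1) :=
  MultilinearMap.mk' (fun b => f (Fin.contractNth j.castSucc (· * ·) b))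
    (by
      intro b i v w
      obtain ⟨m, L, h⟩ := contractNth_update (k := k) j b i
      simp only [h, map_add, MultilinearMap.map_update_add])
    (by
      intro b i c v
      obtain ⟨m, L, h⟩ := contractNth_update (k := k) j b i
      simp only [h, map_smul, MultilinearMap.map_update_smul])

/-- The cochain `(b_0, …, b_n) ↦ φ(b_0) f(b_1, …, b_n)`. -/
def HCochain.left (φ : B →ₐ[k] A) {n : ℕ} (f : HCochain k B A n) : HCochain k B A (n + 1) :=
  MultilinearMap.mk' (fun b => φ (b 0) * f (Fin.tail b))
    (by
      intro b i v w
      refine Fin.cases ?_ (fun i => ?_) i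
      · simp [add_mul]
      · simp [(Fin.succ_ne_zero i).symm, mul_add])
    (by
      intro b i c v
      refine Fin.cases ?_ (fun i => ?_) i
      · simp
      · simp [(Fin.succ_ne_zero i).symm])

/-- The cochain `(b_0, …, b_n) ↦ f(b_0, …, b_{n-1}) φ(b_n)`. -/
def HCochain.right (φ : B →ₐ[k] A) {n : ℕ} (f : HCochain k B A n) : HCochain k B A (n + 1) :=
  MultilinearMap.mk' (fun b => f (Fin.init b) * φ (b (Fin.last n)))
    (by
      intro b i v w
      refine Fin.lastCases ?_ (fun i => ?_) i
      · simp [mul_add]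
      · simp [(Fin.castSucc_ne_last i).symm, add_mul])
    (by
      intro b i c v
      refine Fin.lastCases ?_ (fun i => ?_) i
      · simp
      · simp [(Fin.castSucc_ne_last i).symm])

/-- The Hochschild differential, for `A` regarded as a `B`-bimodule through the algebra
homomorphism `φ : B → A`:
`(δf)(b_0,…,b_n) = φ(b_0) f(b_1,…,b_n) + ∑_{j<n} (-1)^{j+1} f(…, b_j b_{j+1}, …)
  + (-1)^{n+1} f(b_0,…,b_{n-1}) φ(b_n)`. -/
def hochschildD (φ : B →ₐ[k] A) (n : ℕ) : HCochain k B A n →ₗ[k] HCochain k B A (n + 1) where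
  toFun f := HCochain.left φ f + ∑ j : Fin n, (-1 : k) ^ ((j : ℕ) + 1) • HCochain.contract j f +
    (-1 : k) ^ (n + 1) • HCochain.right φ f
  map_add' f g := by
    ext b
    simp [HCochain.left, HCochain.right, HCochain.contract, mul_add, add_mul,
      Finset.sum_add_distrib]
    abel
  map_smul' c f := by
    ext b
    simp [HCochain.left, HCochain.right, HCochain.contract, smul_add, Finset.smul_sum,
      smul_comm c]

/-- Hochschild cocycles. -/
def hCocycles (φ : B →ₐ[k] A) (n : ℕ) : Submodule k (HCochain k B A n) :=
  LinearMap.ker (hochschildD φ n)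

/-- Hochschild coboundaries. -/
def hCoboundaries (φ : B →ₐ[k] A) : (n : ℕ) → Submodule k (HCochain k B A n)
  | 0 => ⊥
  | n + 1 => LinearMap.range (hochschildD φ n)

/-- Shortcut to Mathlib's quotient of modules, for subspaces of cochain spaces. -/
instance (n : ℕ) (p : Submodule k (HCochain k B A n)) : HasQuotient p (Submodule k p) :=
  Submodule.hasQuotient (R := k) (M := p)

/-- `HH^n(B, A)`, where `A` is a `B`-bimodule through `φ : B → A`: cocycles modulo coboundaries.
For `φ = id` this is `HH^n(A)`. -/
abbrev HH (φ : B →ₐ[k] A) (n : ℕ) : Type _ :=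
  hCocycles φ n ⧸ (hCoboundaries φ n).submoduleOf (hCocycles φ n)

/-- The class of a cocycle. -/
abbrev HH.mk (φ : B →ₐ[k] A) {n : ℕ} (f : hCocycles φ n) : HH φ n :=
  Submodule.Quotient.mk f

/-- Restriction of cochains of `A` along `φ : B → A`. -/
def HCochain.res (φ : B →ₐ[k] A) {n : ℕ} (f : HCochain k A A n) : HCochain k B A n :=
  f.compLinearMap (fun _ => φ.toLinearMap)

/-- A comparison `κ`, defined on cochains with values in a cochain space `K`, identifies `HH^n`
with the subspace `W` of `K`, modulo the subspace `I` of coboundaries in `K`: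
the cocycle `f` corresponds to the element of `W` that is congruent to `κ f` modulo `I`. -/
def RepresentedBy (φ : B →ₐ[k] A) (n : ℕ) {K : Type*} [AddCommGroup K] [Module k K]
    (κ : HCochain k B A n → K) (I W : Submodule k K) : Prop :=
  ∃ e : HH φ n ≃ₗ[k] W, ∀ f : hCocycles φ n, κ f.1 - (e (HH.mk φ f) : K) ∈ I

end Hochschild

/-! ## Crossed products -/

section CrossedProduct

/-- A two-cocycle on `G` with values in `kˣ` (with trivial action). -/
structure TwoCocycle (G k : Type*) [Group G] [CommRing k] where
  toFun : G → G → kˣ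
  cocycle : ∀ ρ σ τ, toFun σ τ * toFun ρ (σ * τ) = toFun ρ σ * toFun (ρ * σ) τ

instance {G k : Type*} [Group G] [CommRing k] :
    CoeFun (TwoCocycle G k) (fun _ => G → G → kˣ) :=
  ⟨TwoCocycle.toFun⟩

/-- The cocycle is trivial in `H²(G, kˣ)`, that is, it is a coboundary. -/
def TwoCocycle.IsTrivial {G k : Type*} [Group G] [CommRing k] (α : TwoCocycle G k) : Prop :=
  ∃ β : G → kˣ, ∀ σ τ, α σ τ = β σ * β τ * (β (σ * τ))⁻¹

variable {k G R : Type*} [CommRing k] [Group G] [CommRing R] [Algebra k R]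

/-- The crossed product `R #_α G`: the free `R`-module on symbols `σ̄`, `σ ∈ G`. -/
def CrossedProduct (_act : G →* (R ≃ₐ[k] R)) (_α : TwoCocycle G k) : Type _ := G →₀ R

namespace CrossedProduct

variable (act : G →* (R ≃ₐ[k] R)) (α : TwoCocycle G k)

instance : AddCommGroup (CrossedProduct act α) := inferInstanceAs (AddCommGroup (G →₀ R))

instance : Module k (CrossedProduct act α) := inferInstanceAs (Module k (G →₀ R))

/-- `p ↦ p σ̄`. -/
def single (σ : G) : R →ₗ[k] CrossedProduct act α := (Finsupp.lsingle σ : R →ₗ[k] (G →₀ R))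

variable {act α} in
theorem hom_ext {N : Type*} [AddCommGroup N] [Module k N]
    {f g : CrossedProduct act α →ₗ[k] N}
    (h : ∀ σ p, f (single act α σ p) = g (single act α σ p)) : f = g :=
  Finsupp.lhom_ext (M := R) (R := k) (φ := f) (ψ := g) h

/-- For fixed `p` and `σ`, the map `v ↦ (p σ̄) v`. -/
def mulAux (σ : G) (p : R) : CrossedProduct act α →ₗ[k] CrossedProduct act α :=
  (Finsupp.lsum k fun τ : G =>
    (single act α (σ * τ)).comp ((α σ τ : k) • (LinearMap.mulLeft k p).comp (act σ).toLinearMap) :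
    (G →₀ R) →ₗ[k] CrossedProduct act α)

theorem mulAux_single (σ τ : G) (p q : R) :
    mulAux act α σ p (single act α τ q) =
      single act α (σ * τ) ((α σ τ : k) • (p * act σ q)) := by
  refine (Finsupp.lsum_single k _ τ q).trans ?_
  rfl

/-- The bilinear multiplication with `(p σ̄)(q τ̄) = p (σ·q) α(σ,τ) στ̄`. -/
def mulLin : CrossedProduct act α →ₗ[k] CrossedProduct act α →ₗ[k] CrossedProduct act α :=
  (Finsupp.lsum k fun σ : G =>
    ({ toFun := mulAux act α σ
       map_add' := by
        intro p p'
        refine hom_ext fun τ q => ?_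
        rw [LinearMap.add_apply, mulAux_single, mulAux_single, mulAux_single, ← map_add, add_mul,
          smul_add]
       map_smul' := by
        intro c p
        refine hom_ext fun τ q => ?_
        rw [LinearMap.smul_apply, mulAux_single, mulAux_single, ← map_smul, RingHom.id_apply,
          smul_mul_assoc, smul_comm] } :
      R →ₗ[k] CrossedProduct act α →ₗ[k] CrossedProduct act α) :
    (G →₀ R) →ₗ[k] CrossedProduct act α →ₗ[k] CrossedProduct act α)

theorem mulLin_single (σ τ : G) (p q : R) :
    mulLin act α (single act α σ p) (single act α τ q) =
      single act α (σ * τ) ((α σ τ : k) • (p * act σ q)) := by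
  refine Eq.trans ?_ (mulAux_single act α σ τ p q)
  exact LinearMap.congr_fun (Finsupp.lsum_single k _ σ p) _

instance : Mul (CrossedProduct act α) := ⟨fun u v => mulLin act α u v⟩

/-- The unit element is `α(1,1)⁻¹ 1̄`; it is `1̄` when `α` is normalized. -/
instance : One (CrossedProduct act α) :=
  ⟨single act α 1 (algebraMap k R ((α 1 1)⁻¹ : kˣ))⟩

theorem mul_eq (u v : CrossedProduct act α) : u * v = mulLin act α u v := rfl

theorem one_eq :
    (1 : CrossedProduct act α) = single act α 1 (algebraMap k R ((α 1 1)⁻¹ : kˣ)) := rfl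

theorem single_mul_single (σ τ : G) (p q : R) :
    single act α σ p * single act α τ q =
      single act α (σ * τ) ((α σ τ : k) • (p * act σ q)) :=
  mulLin_single act α σ τ p q

theorem cocycle_one_left (τ : G) : α 1 τ = α 1 1 := by
  have h := α.cocycle 1 1 τ
  simp only [one_mul] at h
  exact mul_right_cancel h

theorem cocycle_one_right (σ : G) : α σ 1 = α 1 1 := by
  have h := α.cocycle σ 1 1
  simp only [mul_one] at h
  exact (mul_right_cancel h).symm

theorem one_mul_aux (v : CrossedProduct act α) : 1 * v = v := by
  have : mulLin act α 1 = LinearMap.id := by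
    refine hom_ext fun τ q => ?_
    rw [one_eq, mulLin_single, cocycle_one_left, ← Algebra.smul_def, smul_smul]
    simp
  exact LinearMap.congr_fun this v

theorem mul_one_aux (v : CrossedProduct act α) : v * 1 = v := by
  have : (mulLin act α).flip 1 = LinearMap.id := by
    refine hom_ext fun τ q => ?_
    rw [LinearMap.flip_apply, one_eq, mulLin_single, cocycle_one_right, AlgEquiv.commutes, mul_comm,
      ← Algebra.smul_def, smul_smul]
    simp
  exact LinearMap.congr_fun this v

theorem mul_assoc_aux (u v w : CrossedProduct act α) : u * v * w = u * (v * w) := by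
  have : (mulLin act α).compr₂ (mulLin act α) =
      ((LinearMap.lcomp k _ (mulLin act α)).comp
        ((LinearMap.llcomp k _ _ _).comp (mulLin act α))) := by
    refine hom_ext fun σ p => hom_ext fun τ q => hom_ext fun υ r => ?_
    have h := congrArg (Units.val) (α.cocycle σ τ υ)
    push_cast at h
    simp only [LinearMap.compr₂_apply, LinearMap.comp_apply, LinearMap.lcomp_apply,
      LinearMap.llcomp_apply]
    rw [mulLin_single, mulLin_single, mulLin_single, mulLin_single, mul_assoc σ τ υ]
    congr 1
    rw [map_mul, map_smul, map_mul, AlgEquiv.mul_apply, smul_mul_assoc, mul_smul_comm, smul_smul,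
      smul_smul, mul_assoc p, mul_comm ((α (σ * τ) υ : k)), ← h, mul_comm]
  exact LinearMap.congr_fun (LinearMap.congr_fun (LinearMap.congr_fun this u) v) w

instance : Ring (CrossedProduct act α) :=
  { (inferInstance : AddCommGroup (CrossedProduct act α)) with
    mul := fun u v => u * v
    one := 1
    left_distrib := fun u v w => map_add (mulLin act α u) v w
    right_distrib := fun u v w => LinearMap.map_add₂ (mulLin act α) u v w
    zero_mul := fun u => LinearMap.map_zero₂ (mulLin act α) u
    mul_zero := fun u => map_zero (mulLin act α u)
    mul_assoc := mul_assoc_aux act α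
    one_mul := one_mul_aux act α
    mul_one := mul_one_aux act α }

instance : Algebra k (CrossedProduct act α) :=
  Algebra.ofModule (fun c u v => LinearMap.map_smul₂ (mulLin act α) c u v)
    (fun c u v => map_smul (mulLin act α u) c v)

/-- `R` as a subalgebra of `R #_α G`. It is `p ↦ p 1̄` when `α` is normalized. -/
def incl : R →ₐ[k] CrossedProduct act α :=
  AlgHom.ofLinearMap ((single act α 1).comp (((α 1 1)⁻¹ : kˣ) • LinearMap.id))
    (by
      rw [one_eq, LinearMap.comp_apply]
      congr 1
      simp [Algebra.algebraMap_eq_smul_one, Units.smul_def])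
    (by
      intro p q
      simp only [LinearMap.comp_apply, LinearMap.smul_apply, LinearMap.id_apply,
        single_mul_single, mul_one, map_one, AlgEquiv.one_apply, Units.smul_def, smul_mul_assoc,
        mul_smul_comm, smul_smul]
      simp)

/-- For a subspace `P` of `R`, the subspace `P σ̄ = {p σ̄ | p ∈ P}` of `R #_α G`. -/
def sector (σ : G) (P : Submodule k R) : Submodule k (CrossedProduct act α) :=
  P.map (single act α σ)

end CrossedProduct

end CrossedProduct

/-! ## The Klein four-group acting on `ℂ[x, y, z]` -/

/-- The polynomial ring `ℂ[x, y, z]`. -/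
abbrev PolyXYZ : Type := MvPolynomial (Fin 3) ℂ

abbrev x : PolyXYZ := MvPolynomial.X 0
abbrev y : PolyXYZ := MvPolynomial.X 1
abbrev z : PolyXYZ := MvPolynomial.X 2

/-- The Klein four-group `{1, a, b, c}`; its elements `a`, `b`, `c = ab` are called `ga`, `gb`, `gc`. -/
abbrev Klein : Type := Multiplicative (ZMod 2) × Multiplicative (ZMod 2)

abbrev ga : Klein := (Multiplicative.ofAdd 1, 1)
abbrev gb : Klein := (1, Multiplicative.ofAdd 1)
abbrev gc : Klein := ga * gb

/-- The nontrivial character of `ℤ/2`. -/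
def sgn : Multiplicative (ZMod 2) →* ℂ where
  toFun s := if s = 1 then 1 else -1
  map_one' := by simp
  map_mul' s t := by
    have key : ∀ s t : Multiplicative (ZMod 2),
        (s * t = 1 ↔ (s = 1 ↔ t = 1)) := by decide
    by_cases hs : s = 1 <;> by_cases ht : t = 1 <;> simp [key, hs, ht]

/-- The scalars by which `σ` acts on `x`, `y`, `z`:
`a ↦ (-1, 1, -1)`, `b ↦ (-1, -1, 1)`, `c ↦ (1, -1, -1)`. -/
def weight (σ : Klein) : Fin 3 → ℂ := ![sgn σ.1 * sgn σ.2, sgn σ.2, sgn σ.1]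

/-- The action on `ℂ[x,y,z]`, as a homomorphism to the monoid of algebra endomorphisms. -/
def kleinEnd : Klein →* (PolyXYZ →ₐ[ℂ] PolyXYZ) where
  toFun σ := MvPolynomial.aeval fun i => MvPolynomial.C (weight σ i) * MvPolynomial.X i
  map_one' := by
    ext i : 1
    fin_cases i <;> simp [weight]
  map_mul' σ τ := by
    refine MvPolynomial.algHom_ext fun i => ?_
    have h : weight (σ * τ) i = weight σ i * weight τ i := by
      fin_cases i <;> simp [weight, mul_mul_mul_comm]
    simp only [MvPolynomial.aeval_X, AlgHom.mul_apply, map_mul, h]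
    rw [← MvPolynomial.algebraMap_eq, AlgHom.commutes]
    ring

/-- The action of the Klein four-group on `ℂ[x,y,z]` by algebra automorphisms. -/
def kleinAct : Klein →* (PolyXYZ ≃ₐ[ℂ] PolyXYZ) :=
  (AlgEquiv.algHomUnitsEquiv ℂ PolyXYZ).toMonoidHom.comp kleinEnd.toHomUnits

/-- `A = ℂ[x,y,z] #_α (ℤ/2 × ℤ/2)`. -/
abbrev KleinCP (α : TwoCocycle Klein ℂ) : Type := CrossedProduct kleinAct α

/-- The inclusion of `R = ℂ[x,y,z]` in `A`. -/
abbrev incl (α : TwoCocycle Klein ℂ) : PolyXYZ →ₐ[ℂ] KleinCP α := CrossedProduct.incl kleinAct α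

/-- The subspace `P σ̄` of `A`. -/
abbrev sec (α : TwoCocycle Klein ℂ) (σ : Klein) (P : Submodule ℂ PolyXYZ) :
    Submodule ℂ (KleinCP α) :=
  CrossedProduct.sector kleinAct α σ P

/-- `ℂ[s]`: the subalgebra generated by a set `s` of polynomials, as a subspace. -/
def polysIn (s : Set PolyXYZ) : Submodule ℂ PolyXYZ := Subalgebra.toSubmodule (Algebra.adjoin ℂ s)

/-- `p P` for a polynomial `p` and a subspace `P`. -/
def times (p : PolyXYZ) (P : Submodule ℂ PolyXYZ) : Submodule ℂ PolyXYZ := P.map (LinearMap.mulLeft ℂ p)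

/-- `p ℂ[x²,y²,z²] + q ℂ[x²,y²,z²]`. -/
def evenSpan (p q : PolyXYZ) : Submodule ℂ PolyXYZ :=
  times p (polysIn {x ^ 2, y ^ 2, z ^ 2}) ⊔ times q (polysIn {x ^ 2, y ^ 2, z ^ 2})

/-- Column vectors with entries in three given subspaces. -/
def columns {V : Type*} [AddCommGroup V] [Module ℂ V] (S T U : Submodule ℂ V) :
    Submodule ℂ (Fin 3 → V) :=
  Submodule.pi Set.univ ![S, T, U]

/-! ## The Koszul complex `0 → A → A³ → A³ → A → 0` computing `HH^*(R, A)` -/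

/-- The action of `p ⊗ 1 - 1 ⊗ p` on the `R`-bimodule `A`: `u ↦ p u - u p`. -/
def ad (α : TwoCocycle Klein ℂ) (p : PolyXYZ) : KleinCP α →ₗ[ℂ] KleinCP α :=
  LinearMap.mulLeft ℂ (incl α p) - LinearMap.mulRight ℂ (incl α p)

/-- With `f, g, h` the actions of `x ⊗ 1 - 1 ⊗ x`, `y ⊗ 1 - 1 ⊗ y`, `z ⊗ 1 - 1 ⊗ z`:
`u ↦ (f u, g u, h u)`. -/
def koszul1 (α : TwoCocycle Klein ℂ) : KleinCP α →ₗ[ℂ] (Fin 3 → KleinCP α) :=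
  LinearMap.pi ![ad α x, ad α y, ad α z]

/-- `(u, v, w) ↦ (-h u + f w, -h v + g w, -g u + f v)`. -/
def koszul2 (α : TwoCocycle Klein ℂ) : (Fin 3 → KleinCP α) →ₗ[ℂ] (Fin 3 → KleinCP α) :=
  LinearMap.pi
    ![-(ad α z ∘ₗ LinearMap.proj 0) + ad α x ∘ₗ LinearMap.proj 2,
      -(ad α z ∘ₗ LinearMap.proj 1) + ad α y ∘ₗ LinearMap.proj 2,
      -(ad α y ∘ₗ LinearMap.proj 0) + ad α x ∘ₗ LinearMap.proj 1]

/-- `(u, v, w) ↦ -g u + f v + h w`. -/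
def koszul3 (α : TwoCocycle Klein ℂ) : (Fin 3 → KleinCP α) →ₗ[ℂ] KleinCP α :=
  -(ad α y ∘ₗ LinearMap.proj 0) + ad α x ∘ₗ LinearMap.proj 1 + ad α z ∘ₗ LinearMap.proj 2

/-- `W` is a complement of the space `I` of coboundaries in the space `Z` of cocycles, so that
every class in `Z / I` has exactly one representative in `W`. -/
def IsSpaceOfRepresentatives {V : Type*} [AddCommGroup V] [Module ℂ V]
    (Z I W : Submodule ℂ V) : Prop :=
  W ⊔ I = Z ∧ W ⊓ I = ⊥

/-! The maps from Hochschild to Koszul cochains induced by the standard inclusion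
`e_{i_1} ∧ ⋯ ∧ e_{i_n} ↦ ∑_π sgn(π) 1 ⊗ x_{i_π(1)} ⊗ ⋯ ⊗ x_{i_π(n)} ⊗ 1` of the Koszul resolution
of `R` in its bar resolution. In degree 2 the Koszul basis is ordered as
`e_x ∧ e_z, e_y ∧ e_z, e_x ∧ e_y`, in agreement with the differentials above. -/

section Comparison

variable {M : Type*} [Ring M] [Algebra ℂ M]

def kappa0 (f : HCochain ℂ PolyXYZ M 0) : M := f ![]

def kappa1 (f : HCochain ℂ PolyXYZ M 1) : Fin 3 → M := ![f ![x], f ![y], f ![z]]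

def kappa2 (f : HCochain ℂ PolyXYZ M 2) : Fin 3 → M :=
  ![f ![x, z] - f ![z, x], f ![y, z] - f ![z, y], f ![x, y] - f ![y, x]]

def kappa3 (f : HCochain ℂ PolyXYZ M 3) : M :=
  f ![x, y, z] - f ![x, z, y] + f ![y, z, x] - f ![y, x, z] + f ![z, x, y] - f ![z, y, x]

end Comparison

end KleinOrbifold

end

open KleinOrbifold

/-!
# Hochschild cohomology of crossed products of `ℂ[x, y, z]` with the Klein four-group

The theorem rests on a comparison valid for any algebra `B` that is free over a polynomial
subalgebra `k[X_0, X_1, X_2]` and generated over it by units, multiplicative up to scalars and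
indexed by a finite group `Γ`, that rescale the variables (`KoszulData`). For every bimodule `M`,
antisymmetrisation on the variables identifies the Hochschild cohomology of `B` with the part of the
Koszul cohomology of `M` that is invariant under conjugation by these units
(`KoszulData.isComparison`). The ring `ℂ[x, y, z]`, with `Γ` trivial, and the crossed product, with
`Γ` the Klein group, are both of this form.

The comparison is proved without projective resolutions, by dimension shifting along
`0 → M → Hom_k(B, M) → coker → 0`. The coinduced bimodule in the middle has no Hochschild cohomology
in positive degrees, by the contraction that evaluates at `1` (`Bimod.exists_delta_coind_eq`). It has
no Koszul cohomology in positive degrees either, since commutation with each variable has a right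
inverse on `Hom_k(B, M)` that commutes with the commutators of the other variables
(`KoszulData.exists_kd_eq`). In degree zero both sides are the elements of `M` that commute with `B`
(`KoszulData.commutes_iff`). Averaging over `Γ` is exact and projects onto the invariants, so a
complement of the coboundaries in the cocycles that is stable under averaging has an invariant part
representing Hochschild cohomology (`KoszulData.representedBy`).

It remains to compute the Koszul complex of the crossed product with its averaging operators. The
complex splits into the sectors `R σ̄`. There the commutator with a variable is zero if `σ` fixes the
variable, and twice the multiplication by it otherwise. Each nontrivial `σ` negates two variables,
which form a regular sequence, so a nontrivial sector contributes the polynomials in the third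
variable in degrees two and three, and nothing else (`ker_koszul1`, `koszul_representatives_one`,
`koszul_representatives_two`, `koszul_representatives_three`).

Conjugation by `τ̄` acts on the sector of `σ` by `τ` times the commutator `cm α τ σ` of the cocycle, so
the invariants are spanned by the monomials satisfying a sign condition (`avg_eq_iff_inv`). The
commutator is a bicharacter on the Klein group, alternating and with values `±1`, hence given by the
one sign `cm α gb ga`. That sign is `1` exactly when the cocycle is a coboundary, because a cocycle
with trivial commutator can be normalised by square roots (`isTrivial_of_cm`). It decides whether
even or odd exponents survive in the nontrivial sectors (`inf_inv_of_eq_one`,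
`inf_inv_of_eq_neg_one`).
-/

noncomputable section
universe u

namespace KleinOrbifold

/-! ### Bimodules and their Hochschild cochains -/

/-- A `B`-bimodule structure on the `k`-module `M`: `l b m` is `b m` and `r b m` is `m b`. It is
kept as data rather than as instances because `B →ₗ[k] M` carries two different structures below. -/
structure Bimod (k B M : Type*) [CommRing k] [Ring B] [Algebra k B] [AddCommGroup M]
    [Module k M] where
  l : B →ₗ[k] M →ₗ[k] M
  r : B →ₗ[k] M →ₗ[k] M
  l_mul : ∀ a b m, l (a * b) m = l a (l b m)
  r_mul : ∀ a b m, r (a * b) m = r b (r a m)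
  l_r : ∀ a b m, l a (r b m) = r b (l a m)
  l_one : ∀ m, l 1 m = m
  r_one : ∀ m, r 1 m = m

namespace Bimod

variable {k B M N : Type*} [CommRing k] [Ring B] [Algebra k B] [AddCommGroup M] [Module k M]
  [AddCommGroup N] [Module k N]

/-- `T` is a homomorphism of bimodules. -/
structure IsHom (S : Bimod k B M) (S' : Bimod k B N) (T : M →ₗ[k] N) : Prop where
  l : ∀ b m, T (S.l b m) = S'.l b (T m)
  r : ∀ b m, T (S.r b m) = S'.r b (T m)

/-- The algebra `A` as a bimodule over `B` along an algebra homomorphism. -/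
def ofAlgHom {A : Type*} [Ring A] [Algebra k A] (φ : B →ₐ[k] A) : Bimod k B A where
  l := (LinearMap.mul k A).comp φ.toLinearMap
  r := (LinearMap.mul k A).flip.comp φ.toLinearMap
  l_mul a b m := by simp [mul_assoc]
  r_mul a b m := by simp [mul_assoc]
  l_r a b m := by simp [mul_assoc]
  l_one m := by simp
  r_one m := by simp

variable (S : Bimod k B M) (S' : Bimod k B N)

/-- Hochschild cochains with values in a bimodule. -/
abbrev Cochain (k B M : Type*) [CommRing k] [Ring B] [Algebra k B] [AddCommGroup M] [Module k M]
    (n : ℕ) : Type _ :=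
  MultilinearMap k (fun _ : Fin n => B) M

/-- The cochain `(b_0, …, b_n) ↦ f(b_0, …, b_j b_{j+1}, …, b_n)`. -/
def contract {n : ℕ} (j : Fin n) (f : Cochain k B M n) : Cochain k B M (n + 1) :=
  MultilinearMap.mk' (fun b => f (Fin.contractNth j.castSucc (· * ·) b))
    (by
      intro b i v w
      obtain ⟨m, L, h⟩ := contractNth_update (k := k) j b i
      simp only [h, map_add, MultilinearMap.map_update_add])
    (by
      intro b i c v
      obtain ⟨m, L, h⟩ := contractNth_update (k := k) j b i
      simp only [h, map_smul, MultilinearMap.map_update_smul])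

/-- The cochain `(b_0, …, b_n) ↦ b_0 f(b_1, …, b_n)`. -/
def left {n : ℕ} (f : Cochain k B M n) : Cochain k B M (n + 1) :=
  MultilinearMap.mk' (fun b => S.l (b 0) (f (Fin.tail b)))
    (by
      intro b i v w
      refine Fin.cases ?_ (fun i => ?_) i
      · simp
      · simp [(Fin.succ_ne_zero i).symm])
    (by
      intro b i c v
      refine Fin.cases ?_ (fun i => ?_) i
      · simp
      · simp [(Fin.succ_ne_zero i).symm])

/-- The cochain `(b_0, …, b_n) ↦ f(b_0, …, b_{n-1}) b_n`. -/
def right {n : ℕ} (f : Cochain k B M n) : Cochain k B M (n + 1) :=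
  MultilinearMap.mk' (fun b => S.r (b (Fin.last n)) (f (Fin.init b)))
    (by
      intro b i v w
      refine Fin.lastCases ?_ (fun i => ?_) i
      · simp
      · simp [(Fin.castSucc_ne_last i).symm])
    (by
      intro b i c v
      refine Fin.lastCases ?_ (fun i => ?_) i
      · simp
      · simp [(Fin.castSucc_ne_last i).symm])

/-- The Hochschild differential with coefficients in a bimodule. -/
def delta (n : ℕ) : Cochain k B M n →ₗ[k] Cochain k B M (n + 1) where
  toFun f := S.left f + ∑ j : Fin n, (-1 : k) ^ ((j : ℕ) + 1) • contract j f +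
    (-1 : k) ^ (n + 1) • S.right f
  map_add' f g := by
    ext b
    simp [left, right, contract, Finset.sum_add_distrib]
    abel
  map_smul' c f := by
    ext b
    simp [left, right, contract, smul_add, Finset.smul_sum, smul_comm c]

theorem delta_apply {n : ℕ} (f : Cochain k B M n) (b : Fin (n + 1) → B) :
    S.delta n f b = S.l (b 0) (f (Fin.tail b)) +
      ∑ j : Fin n, (-1 : k) ^ ((j : ℕ) + 1) • f (Fin.contractNth j.castSucc (· * ·) b) +
      (-1 : k) ^ (n + 1) • S.r (b (Fin.last n)) (f (Fin.init b)) := by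
  simp [delta, left, right, contract]

variable {S S'}

theorem IsHom.delta {T : M →ₗ[k] N} (hT : IsHom S S' T) (n : ℕ) (f : Cochain k B M n) :
    S'.delta n (T.compMultilinearMap f) = T.compMultilinearMap (S.delta n f) := by
  ext b
  simp [delta_apply, hT.l, hT.r]

variable (S)

/-! ### Dimension shifting -/

/-- The coinduced bimodule `Hom_k(B, M)`, with `(b f)(c) = b f(c)` and `(f b)(c) = f(b c)`. -/
def coind : Bimod k B (B →ₗ[k] M) where
  l := (LinearMap.llcomp k B M M).comp S.l
  r := (LinearMap.llcomp k B B M).flip.comp (LinearMap.mul k B)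
  l_mul a b f := by ext c; simp [S.l_mul]
  r_mul a b f := by ext c; simp [mul_assoc]
  l_r a b f := by ext c; simp
  l_one f := by ext c; simp [S.l_one]
  r_one f := by ext c; simp

@[simp] theorem coind_l (b c : B) (f : B →ₗ[k] M) : S.coind.l b f c = S.l b (f c) := rfl
@[simp] theorem coind_r (b c : B) (f : B →ₗ[k] M) : S.coind.r b f c = f (b * c) := rfl

/-- The embedding `m ↦ (c ↦ m c)` of a bimodule in the coinduced one. -/
def toCoind : M →ₗ[k] (B →ₗ[k] M) := S.r.flip

@[simp] theorem toCoind_apply (m : M) (c : B) : S.toCoind m c = S.r c m := rfl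

theorem toCoind_isHom : IsHom S S.coind S.toCoind where
  l b m := by ext c; simp [S.l_r]
  r b m := by ext c; simp [S.r_mul]

theorem toCoind_injective : Function.Injective S.toCoind := fun m m' h => by
  have := LinearMap.congr_fun h 1
  simpa [S.r_one] using this

/-- The maps `B → M` vanishing at `1`. -/
def vanish (k B M : Type*) [CommRing k] [Ring B] [Algebra k B] [AddCommGroup M] [Module k M] :
    Submodule k (B →ₗ[k] M) := LinearMap.ker (LinearMap.applyₗ (1 : B))

theorem mem_vanish {f : B →ₗ[k] M} : f ∈ vanish k B M ↔ f 1 = 0 := by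
  simp [vanish]

/-- The cokernel of `M → Hom_k(B, M)`. As a left module it is the space of the maps that vanish
at `1`; its right structure is `(g b)(c) = g(b c) - g(b) c`. -/
def coker : Bimod k B (vanish k B M) where
  l := LinearMap.mk₂ k (fun b g => ⟨S.coind.l b g, by rw [mem_vanish]; simp [mem_vanish.1 g.2]⟩)
    (by intros; ext; simp) (by intros; ext; simp) (by intros; ext; simp) (by intros; ext; simp)
  r := LinearMap.mk₂ k (fun b g => ⟨S.coind.r b g - S.toCoind (g.1 b), by
      rw [mem_vanish]; simp [S.r_one]⟩)
    (by intros; ext; simp; abel) (by intros; ext; simp [smul_sub])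
    (by intros; ext; simp; abel) (by intros; ext; simp [smul_sub])
  l_mul a b f := by ext c; simp [S.l_mul]
  r_mul a b f := by ext c; simp [mul_assoc, S.r_mul]
  l_r a b f := by ext c; simp [S.l_r]
  l_one f := by ext c; simp [S.l_one]
  r_one f := by ext c; simp [mem_vanish.1 f.2]

/-- The projection `f ↦ (c ↦ f(c) - f(1) c)`. -/
def toCoker : (B →ₗ[k] M) →ₗ[k] vanish k B M :=
  (LinearMap.id - S.toCoind.comp (LinearMap.applyₗ 1)).codRestrict _ fun f => by
    rw [mem_vanish]; simp [S.r_one]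

theorem toCoker_coe (f : B →ₗ[k] M) : (S.toCoker f : B →ₗ[k] M) = f - S.toCoind (f 1) := rfl

theorem toCoker_isHom : IsHom S.coind S.coker S.toCoker where
  l b f := by ext c; simp [toCoker_coe, coker, S.l_r]
  r b f := by ext c; simp [toCoker_coe, coker, S.r_mul]

theorem toCoker_toCoind (m : M) : S.toCoker (S.toCoind m) = 0 := by
  ext c; simp [toCoker_coe, S.r_one]

theorem toCoker_section (g : vanish k B M) : S.toCoker (g : B →ₗ[k] M) = g := by
  ext c; simp [toCoker_coe, mem_vanish.1 g.2]

theorem exists_of_toCoker_eq_zero {f : B →ₗ[k] M} (h : S.toCoker f = 0) :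
    S.toCoind (f 1) = f := by
  have := congrArg Subtype.val h
  rw [toCoker_coe] at this
  exact (sub_eq_zero.1 this).symm

end Bimod

theorem tail_snoc {B : Type*} {n : ℕ} (b : Fin (n + 1) → B) (c : B) :
    Fin.tail (Fin.snoc b c : Fin (n + 2) → B) = Fin.snoc (Fin.tail b) c := by
  funext i
  refine Fin.lastCases ?_ (fun i => ?_) i
  · simp [Fin.tail, Fin.succ_last]
  · simp only [Fin.tail, Fin.succ_castSucc, Fin.snoc_castSucc]

section

variable {B : Type*} [Ring B]

theorem contractNth_snoc_castSucc {n : ℕ} (b : Fin (n + 1) → B) (c : B) (j : Fin n) :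
    Fin.contractNth j.castSucc.castSucc (· * ·) (Fin.snoc b c : Fin (n + 2) → B) =
      Fin.snoc (Fin.contractNth j.castSucc (· * ·) b) c := by
  funext i
  refine Fin.lastCases ?_ (fun i => ?_) i
  · have h1 : ¬ n < (j : ℕ) := by omega
    have h2 : n ≠ (j : ℕ) := by omega
    simp [Fin.contractNth, h1, h2]
  · rw [Fin.snoc_castSucc]
    simp only [Fin.contractNth, Fin.val_castSucc, Fin.succ_castSucc, Fin.snoc_castSucc]

theorem contractNth_snoc_last {n : ℕ} (b : Fin (n + 1) → B) (c : B) :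
    Fin.contractNth (Fin.last n).castSucc (· * ·) (Fin.snoc b c : Fin (n + 2) → B) =
      Fin.snoc (Fin.init b) (b (Fin.last n) * c) := by
  funext i
  refine Fin.lastCases ?_ (fun i => ?_) i
  · simp only [Fin.contractNth, Fin.val_castSucc, Fin.val_last, lt_irrefl, if_false, if_true,
      Fin.snoc_castSucc, Fin.snoc_last, Fin.succ_last]
  · simp only [Fin.contractNth, Fin.val_castSucc, Fin.val_last, i.2, if_true, Fin.snoc_castSucc,
      Fin.init]

end

namespace Bimod

variable {k B M N : Type*} [CommRing k] [Ring B] [Algebra k B] [AddCommGroup M] [Module k M]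
  [AddCommGroup N] [Module k N] (S : Bimod k B M)

/-- The contraction `(hF)(b_1, …, b_n)(c) = F(b_1, …, b_n, c)(1)` on cochains with values in the
coinduced bimodule. -/
def contraction {n : ℕ} (F : Cochain k B (B →ₗ[k] M) (n + 1)) : Cochain k B (B →ₗ[k] M) n :=
  ((LinearMap.applyₗ (1 : B) : (B →ₗ[k] M) →ₗ[k] M).compMultilinearMap F).curryRight

@[simp] theorem contraction_apply {n : ℕ} (F : Cochain k B (B →ₗ[k] M) (n + 1)) (b : Fin n → B)
    (c : B) : contraction F b c = F (Fin.snoc b c) 1 := rfl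

theorem contraction_delta {n : ℕ} (F : Cochain k B (B →ₗ[k] M) (n + 1)) :
    contraction (S.coind.delta (n + 1) F) =
      S.coind.delta n (contraction F) + (-1 : k) ^ n • F := by
  ext b c
  have h0 : (Fin.snoc b c : Fin (n + 2) → B) 0 = b 0 := by
    rw [← Fin.castSucc_zero, Fin.snoc_castSucc (α := fun _ => B)]
  simp only [contraction_apply, delta_apply, LinearMap.add_apply, LinearMap.sum_apply,
    LinearMap.smul_apply, coind_l, coind_r, Fin.sum_univ_castSucc, contractNth_snoc_castSucc,
    contractNth_snoc_last, tail_snoc, Fin.init_snoc, Fin.snoc_last, mul_one, add_apply,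
    smul_apply, Fin.val_castSucc, Fin.val_last, h0, pow_succ]
  simp
  abel

/-- Coinduced bimodules are acyclic. -/
theorem exists_delta_coind_eq {n : ℕ} (F : Cochain k B (B →ₗ[k] M) (n + 1))
    (hF : S.coind.delta (n + 1) F = 0) : ∃ G, S.coind.delta n G = F := by
  refine ⟨(-1 : k) ^ (n + 1) • contraction F, ?_⟩
  have h := S.contraction_delta F
  have h0 : contraction (0 : Cochain k B (B →ₗ[k] M) (n + 1 + 1)) = 0 := by ext; simp
  rw [hF, h0] at h
  rw [map_smul, ← neg_eq_of_add_eq_zero_left h.symm, smul_neg, smul_smul, pow_succ]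
  have : ((-1 : k) ^ n * -1 * (-1) ^ n) = -1 := by
    rw [mul_neg_one, neg_mul, ← mul_pow]; simp
  rw [this]; simp

/-- `δ² = 0`, by induction on the degree: after embedding the coefficients in the coinduced
bimodule, the contraction moves `δ²` one degree down. -/
theorem delta_delta {k : Type*} {B : Type u} [CommRing k] [Ring B] [Algebra k B] (n : ℕ) :
    ∀ {M : Type u} [AddCommGroup M] [Module k M] (S : Bimod k B M)
    (f : Cochain k B M n), S.delta (n + 1) (S.delta n f) = 0 := by
  induction n with
  | zero =>
    intro M _ _ S f
    ext b
    have h1 : ∀ v : Fin 0 → B, f v = f ![] := fun v => congrArg f (Subsingleton.elim _ _)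
    have h2 : Fin.contractNth (0 : Fin 2) (· * ·) b 0 = b 0 * b 1 := by simp [Fin.contractNth]
    simp [delta_apply, h1, h2, S.l_mul, S.r_mul, S.l_r, Fin.tail, Fin.init]
    abel
  | succ n ih =>
    intro M _ _ S f
    have key : contraction (S.toCoind.compMultilinearMap (S.delta (n + 2) (S.delta (n + 1) f))) =
        0 := by
      rw [← S.toCoind_isHom.delta, ← S.toCoind_isHom.delta, contraction_delta, contraction_delta,
        map_add, map_smul, ih S.coind, pow_succ]
      have h : (-1 : k) ^ n + (-1) ^ n * -1 = 0 := by ring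
      rw [zero_add, ← add_smul, h, zero_smul]
    have hc : ∀ {n : ℕ} (g : Cochain k B M (n + 1)),
        contraction (S.toCoind.compMultilinearMap g) = 0 → g = 0 := by
      intro n g hg
      ext b
      have := congrArg (fun F => F (Fin.init b) (b (Fin.last _))) hg
      simpa [S.r_one] using this
    exact hc _ key

end Bimod

/-! ### Koszul cochains and averaging -/

/-- The algebra `B` is free over a polynomial subalgebra `k[X_0, X_1, X_2]`, and is generated by it
together with units `t σ`, indexed by a finite group and multiplicative up to scalars, such that
conjugation by `t σ` multiplies `X_i` by the sign `w σ i`. The product of the three signs is `1`, so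
that the group acts trivially on the top exterior power of the variables, and the order of the
group is invertible in `k`. -/
structure KoszulData (k B Γ J : Type*) [Field k] [Ring B] [Algebra k B] [Group Γ]
    [Fintype Γ] where
  X : Fin 3 → B
  X_comm : ∀ i j, X i * X j = X j * X i
  basis : Module.Basis (J × (Fin 3 →₀ ℕ)) k B
  X_mul_basis : ∀ i j m, X i * basis (j, m) = basis (j, m + Finsupp.single i 1)
  t : Γ → Bˣ
  t_mul : ∀ σ τ, ∃ c : kˣ, (t σ * t τ : B) = (c : k) • (t (σ * τ) : B)
  w : Γ → Fin 3 → k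
  w_mul : ∀ σ τ i, w (σ * τ) i = w σ i * w τ i
  w_sq : ∀ σ i, w σ i * w σ i = 1
  w_prod : ∀ σ, w σ 0 * w σ 1 * w σ 2 = 1
  t_X : ∀ σ i, (t σ : B) * X i = w σ i • (X i * t σ)
  adjoin_eq_top : Algebra.adjoin k (Set.range X ∪ Set.range fun σ => (t σ : B)) = ⊤
  card_ne_zero : (Fintype.card Γ : k) ≠ 0

/-- The ranks of the terms of the Koszul complex in three variables. -/
abbrev kdim : ℕ → ℕ
  | 0 => 1
  | 1 => 3
  | 2 => 3
  | 3 => 1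
  | _ + 4 => 0

namespace KoszulData

variable {k B Γ J M N : Type*} [Field k] [Ring B] [Algebra k B] [Group Γ] [Fintype Γ]
  [AddCommGroup M] [Module k M] [AddCommGroup N] [Module k N]
  (D : KoszulData k B Γ J) (S : Bimod k B M) (S' : Bimod k B N)

/-- The commutator `m ↦ X_i m - m X_i`. -/
def adj (i : Fin 3) : M →ₗ[k] M := S.l (D.X i) - S.r (D.X i)

theorem adj_apply (i : Fin 3) (m : M) : D.adj S i m = S.l (D.X i) m - S.r (D.X i) m := rfl

theorem adj_comm (i j : Fin 3) (m : M) : D.adj S i (D.adj S j m) = D.adj S j (D.adj S i m) := by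
  simp only [adj_apply, map_sub, S.l_r, ← S.l_mul, ← S.r_mul, D.X_comm i j]
  abel

/-- The Koszul differential `m ↦ ([X_0, m], [X_1, m], [X_2, m])`. -/
def kd0 : (Fin 1 → M) →ₗ[k] (Fin 3 → M) :=
  LinearMap.pi fun i => D.adj S i ∘ₗ LinearMap.proj 0

/-- The Koszul differential in degree one. The components of degree two belong to the pairs
`(0, 2)`, `(1, 2)`, `(0, 1)` of variables, in this order. -/
def kd1 : (Fin 3 → M) →ₗ[k] (Fin 3 → M) :=
  LinearMap.pi
    ![-(D.adj S 2 ∘ₗ LinearMap.proj 0) + D.adj S 0 ∘ₗ LinearMap.proj 2,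
      -(D.adj S 2 ∘ₗ LinearMap.proj 1) + D.adj S 1 ∘ₗ LinearMap.proj 2,
      -(D.adj S 1 ∘ₗ LinearMap.proj 0) + D.adj S 0 ∘ₗ LinearMap.proj 1]

/-- The Koszul differential to the top degree. -/
def kd2 : (Fin 3 → M) →ₗ[k] (Fin 1 → M) :=
  LinearMap.pi fun _ => -(D.adj S 1 ∘ₗ LinearMap.proj 0) + D.adj S 0 ∘ₗ LinearMap.proj 1 +
    D.adj S 2 ∘ₗ LinearMap.proj 2

/-- The differentials of the Koszul complex with coefficients in a bimodule. -/
def kd : (n : ℕ) → (Fin (kdim n) → M) →ₗ[k] (Fin (kdim (n + 1)) → M)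
  | 0 => D.kd0 S
  | 1 => D.kd1 S
  | 2 => D.kd2 S
  | _ + 3 => 0

theorem kd0_apply (v : Fin 1 → M) : D.kd0 S v = fun i => D.adj S i (v 0) := rfl

theorem kd1_apply (v : Fin 3 → M) : D.kd1 S v =
    ![-D.adj S 2 (v 0) + D.adj S 0 (v 2), -D.adj S 2 (v 1) + D.adj S 1 (v 2),
      -D.adj S 1 (v 0) + D.adj S 0 (v 1)] := by
  funext i; fin_cases i <;> rfl

theorem kd2_apply (v : Fin 3 → M) : D.kd2 S v =
    fun _ => -D.adj S 1 (v 0) + D.adj S 0 (v 1) + D.adj S 2 (v 2) := rfl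

theorem kd1_kd0 (v : Fin 1 → M) : D.kd1 S (D.kd0 S v) = 0 := by
  rw [kd1_apply, kd0_apply]
  funext i
  fin_cases i
  · simp [D.adj_comm S 2 0]
  · simp [D.adj_comm S 2 1]
  · simp [D.adj_comm S 1 0]

theorem kd2_kd1 (v : Fin 3 → M) : D.kd2 S (D.kd1 S v) = 0 := by
  rw [kd2_apply, kd1_apply]
  funext i
  simp [D.adj_comm S 2 0, D.adj_comm S 2 1, D.adj_comm S 1 0]
  abel

theorem kd_kd (n : ℕ) (v : Fin (kdim n) → M) : D.kd S (n + 1) (D.kd S n v) = 0 :=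
  match n, v with
  | 0, v => D.kd1_kd0 S v
  | 1, v => D.kd2_kd1 S v
  | _ + 2, _ => rfl

/-- Koszul coboundaries. -/
def kB : (n : ℕ) → Submodule k (Fin (kdim n) → M)
  | 0 => ⊥
  | n + 1 => LinearMap.range (D.kd S n)

/-- Hochschild coboundaries with coefficients in a bimodule. -/
def hB (S : Bimod k B M) : (n : ℕ) → Submodule k (Bimod.Cochain k B M n)
  | 0 => ⊥
  | n + 1 => LinearMap.range (S.delta n)

theorem kd_of_mem_kB {n : ℕ} {v : Fin (kdim n) → M} (hv : v ∈ D.kB S n) : D.kd S n v = 0 :=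
  match n, v, hv with
  | 0, _, hv => by rw [(Submodule.mem_bot k).1 hv, map_zero]
  | _ + 1, _, ⟨_, h⟩ => by rw [← h, kd_kd]

/-- Evaluation of cochains. -/
def ev {n : ℕ} (v : Fin n → B) : Bimod.Cochain k B M n →ₗ[k] M where
  toFun f := f v
  map_add' _ _ := rfl
  map_smul' _ _ := rfl

@[simp] theorem ev_apply {n : ℕ} (v : Fin n → B) (f : Bimod.Cochain k B M n) : ev v f = f v := rfl

/-- The value of a cochain of degree zero. -/
def kap0 : Bimod.Cochain k B M 0 →ₗ[k] (Fin 1 → M) := LinearMap.pi fun _ => ev ![]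

/-- The values of a cochain of degree one on the variables. -/
def kap1 : Bimod.Cochain k B M 1 →ₗ[k] (Fin 3 → M) := LinearMap.pi fun i => ev ![D.X i]

/-- The antisymmetrised values of a cochain of degree two on the pairs `(0, 2)`, `(1, 2)`,
`(0, 1)` of variables. -/
def kap2 : Bimod.Cochain k B M 2 →ₗ[k] (Fin 3 → M) :=
  LinearMap.pi ![ev ![D.X 0, D.X 2] - ev ![D.X 2, D.X 0], ev ![D.X 1, D.X 2] - ev ![D.X 2, D.X 1],
    ev ![D.X 0, D.X 1] - ev ![D.X 1, D.X 0]]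

/-- The antisymmetrised value of a cochain of degree three on the variables. -/
def kap3 : Bimod.Cochain k B M 3 →ₗ[k] (Fin 1 → M) :=
  LinearMap.pi fun _ => ev ![D.X 0, D.X 1, D.X 2] - ev ![D.X 0, D.X 2, D.X 1] +
    ev ![D.X 1, D.X 2, D.X 0] - ev ![D.X 1, D.X 0, D.X 2] + ev ![D.X 2, D.X 0, D.X 1] -
    ev ![D.X 2, D.X 1, D.X 0]

/-- The comparison from Hochschild to Koszul cochains: the antisymmetrised values of a cochain on
the variables. -/
def kap : (n : ℕ) → Bimod.Cochain k B M n →ₗ[k] (Fin (kdim n) → M)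
  | 0 => kap0
  | 1 => D.kap1
  | 2 => D.kap2
  | 3 => D.kap3
  | _ + 4 => 0

theorem kap0_apply (f : Bimod.Cochain k B M 0) : kap0 f = fun _ => f ![] := rfl

theorem kap1_apply (f : Bimod.Cochain k B M 1) : D.kap1 f = fun i => f ![D.X i] := rfl

theorem kap2_apply (f : Bimod.Cochain k B M 2) : D.kap2 f =
    ![f ![D.X 0, D.X 2] - f ![D.X 2, D.X 0], f ![D.X 1, D.X 2] - f ![D.X 2, D.X 1],
      f ![D.X 0, D.X 1] - f ![D.X 1, D.X 0]] := by
  funext i; fin_cases i <;> rfl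

theorem kap3_apply (f : Bimod.Cochain k B M 3) : D.kap3 f =
    fun _ => f ![D.X 0, D.X 1, D.X 2] - f ![D.X 0, D.X 2, D.X 1] +
      f ![D.X 1, D.X 2, D.X 0] - f ![D.X 1, D.X 0, D.X 2] + f ![D.X 2, D.X 0, D.X 1] -
      f ![D.X 2, D.X 1, D.X 0] := rfl

theorem kap1_delta (f : Bimod.Cochain k B M 0) : D.kap1 (S.delta 0 f) = D.kd0 S (kap0 f) := by
  have h1 : ∀ v : Fin 0 → B, f v = f ![] := fun v => congrArg f (Subsingleton.elim _ _)
  funext i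
  simp [kap1_apply, kd0_apply, kap0_apply, Bimod.delta_apply, adj_apply, h1, sub_eq_add_neg]

theorem kap2_delta (f : Bimod.Cochain k B M 1) : D.kap2 (S.delta 1 f) = D.kd1 S (D.kap1 f) := by
  have h : ∀ a b, S.delta 1 f ![a, b] = S.l a (f ![b]) - f ![a * b] + S.r b (f ![a]) := by
    intro a b
    have h1 : Fin.tail ![a, b] = ![b] := by funext i; fin_cases i; rfl
    have h2 : Fin.init ![a, b] = ![a] := by funext i; fin_cases i; rfl
    have h3 : Fin.contractNth 0 (· * ·) ![a, b] = ![a * b] := by funext i; fin_cases i; rfl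
    simp [Bimod.delta_apply, h1, h2, h3, sub_eq_add_neg]
  simp only [kd1_apply, kap2_apply, kap1_apply, h, adj_apply, D.X_comm 2, D.X_comm 1 0]
  funext i
  fin_cases i <;> simp <;> abel

theorem kap3_delta (f : Bimod.Cochain k B M 2) : D.kap3 (S.delta 2 f) = D.kd2 S (D.kap2 f) := by
  have h : ∀ a b c, S.delta 2 f ![a, b, c] =
      S.l a (f ![b, c]) - f ![a * b, c] + f ![a, b * c] - S.r c (f ![a, b]) := by
    intro a b c
    have h1 : Fin.tail ![a, b, c] = ![b, c] := by funext i; fin_cases i <;> rfl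
    have h2 : Fin.init ![a, b, c] = ![a, b] := by funext i; fin_cases i <;> rfl
    have h3 : Fin.contractNth 0 (· * ·) ![a, b, c] = ![a * b, c] := by
      funext i; fin_cases i <;> rfl
    have h4 : Fin.contractNth 1 (· * ·) ![a, b, c] = ![a, b * c] := by
      funext i; fin_cases i <;> rfl
    simp [Bimod.delta_apply, h1, h2, h3, h4, Fin.sum_univ_two, pow_succ]
    abel
  simp only [kd2_apply, kap3_apply, kap2_apply, h, adj_apply, D.X_comm 2, D.X_comm 1 0]
  funext i
  simp
  abel

theorem kap_delta (n : ℕ) (f : Bimod.Cochain k B M n) :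
    D.kap (n + 1) (S.delta n f) = D.kd S n (D.kap n f) :=
  match n, f with
  | 0, f => D.kap1_delta S f
  | 1, f => D.kap2_delta S f
  | 2, f => D.kap3_delta S f
  | _ + 3, _ => funext fun i => i.elim0

/-- Conjugation `m ↦ t_σ m t_σ⁻¹`. -/
def conj (σ : Γ) : M →ₗ[k] M := S.l (D.t σ) ∘ₗ S.r ((D.t σ)⁻¹ : Bˣ)

theorem conj_apply (σ : Γ) (m : M) :
    D.conj S σ m = S.l (D.t σ) (S.r ((D.t σ)⁻¹ : Bˣ) m) := rfl

theorem conj_eq_iff (σ : Γ) (m m' : M) :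
    D.conj S σ m = m' ↔ S.l (D.t σ) m = S.r (D.t σ) m' := by
  rw [conj_apply, S.l_r]
  constructor
  · rintro rfl
    rw [← S.r_mul, Units.inv_mul, S.r_one]
  · intro h
    rw [h, ← S.r_mul, Units.mul_inv, S.r_one]

theorem conj_conj (σ τ : Γ) (m : M) : D.conj S σ (D.conj S τ m) = D.conj S (σ * τ) m := by
  obtain ⟨c, hc⟩ := D.t_mul σ τ
  have h1 := (D.conj_eq_iff S τ m _).1 rfl
  have h2 := (D.conj_eq_iff S σ (D.conj S τ m) _).1 rfl
  symm
  rw [conj_eq_iff]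
  have h3 : S.l (D.t σ * D.t τ : B) m =
      S.r (D.t σ * D.t τ : B) (D.conj S σ (D.conj S τ m)) := by
    rw [S.l_mul, S.r_mul, h1, S.l_r, h2]
  rw [hc] at h3
  simp only [map_smul, LinearMap.smul_apply] at h3
  have h4 := congrArg (fun m' : M => (c⁻¹ : kˣ) • m') h3
  simpa [Units.smul_def, smul_smul] using h4

theorem conj_adj (σ : Γ) (i : Fin 3) (m : M) :
    D.conj S σ (D.adj S i m) = D.w σ i • D.adj S i (D.conj S σ m) := by
  rw [conj_eq_iff]
  have h := (D.conj_eq_iff S σ m _).1 rfl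
  have h' : S.r (D.t σ : B) (S.r (D.X i) (D.conj S σ m)) =
      D.w σ i • S.r (D.X i) (S.r (D.t σ : B) (D.conj S σ m)) := by
    have := congrArg (fun b => D.w σ i • S.r b (D.conj S σ m)) (D.t_X σ i)
    simp only [map_smul, LinearMap.smul_apply, smul_smul, D.w_sq, one_smul, S.r_mul] at this
    exact this.symm
  have h'' : S.l (D.t σ : B) (S.l (D.X i) m) = D.w σ i • S.l (D.X i) (S.l (D.t σ : B) m) := by
    have := congrArg (fun b => S.l b m) (D.t_X σ i)
    simpa only [map_smul, LinearMap.smul_apply, S.l_mul] using this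
  simp only [adj_apply, map_sub, map_smul, h', h'', S.l_r, h, smul_sub, smul_smul, D.w_sq,
    one_smul]

/-- The projection to the part of a bimodule on which conjugation acts through the sign
character `χ`. -/
def avg (χ : Γ → k) : M →ₗ[k] M := (Fintype.card Γ : k)⁻¹ • ∑ σ, χ σ • D.conj S σ

theorem avg_apply (χ : Γ → k) (m : M) :
    D.avg S χ m = (Fintype.card Γ : k)⁻¹ • ∑ σ, χ σ • D.conj S σ m := by
  simp [avg]

theorem avg_adj {χ ψ : Γ → k} {i : Fin 3} (h : ∀ σ, χ σ * D.w σ i = ψ σ) (m : M) :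
    D.avg S χ (D.adj S i m) = D.adj S i (D.avg S ψ m) := by
  simp [avg_apply, conj_adj, smul_smul, h]

theorem conj_avg {χ : Γ → k} (h : ∀ σ τ, χ (σ * τ) = χ σ * χ τ) (h2 : ∀ σ, χ σ * χ σ = 1)
    (σ : Γ) (m : M) : D.conj S σ (D.avg S χ m) = χ σ • D.avg S χ m := by
  simp only [avg_apply, map_smul, map_sum, conj_conj]
  rw [smul_comm (χ σ)]
  congr 1
  rw [Finset.smul_sum]
  refine Fintype.sum_equiv (Equiv.mulLeft σ) (fun τ => χ τ • D.conj S (σ * τ) m)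
    (fun τ => χ σ • χ τ • D.conj S τ m) fun τ => ?_
  simp [h, smul_smul, ← mul_assoc, h2]

theorem avg_eq_of_conj {χ : Γ → k} (h2 : ∀ σ, χ σ * χ σ = 1) {m : M}
    (h : ∀ σ, D.conj S σ m = χ σ • m) : D.avg S χ m = m := by
  simp only [avg_apply, h, smul_smul, h2, one_smul, Finset.sum_const, Finset.card_univ]
  rw [← Nat.cast_smul_eq_nsmul k, smul_smul, inv_mul_cancel₀ D.card_ne_zero, one_smul]

theorem avg_eq_iff {χ : Γ → k} (h : ∀ σ τ, χ (σ * τ) = χ σ * χ τ) (h2 : ∀ σ, χ σ * χ σ = 1)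
    (m : M) : D.avg S χ m = m ↔ ∀ σ, D.conj S σ m = χ σ • m :=
  ⟨fun hm σ => by rw [← hm, D.conj_avg S h h2], D.avg_eq_of_conj S h2⟩

/-- The characters by which the group acts on the basis of the Koszul cochains. In degree two the
pairs `(0, 2)`, `(1, 2)`, `(0, 1)` carry the signs of the complementary variables `1`, `0`, `2`,
as the product of the three signs is `1`. -/
def chi : (n : ℕ) → Fin (kdim n) → Γ → k
  | 0 => fun _ _ => 1
  | 1 => fun (i : Fin 3) σ => D.w σ i
  | 2 => fun (i : Fin 3) σ => D.w σ (![1, 0, 2] i)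
  | 3 => fun _ _ => 1
  | _ + 4 => Fin.elim0

theorem chi_mul (n : ℕ) (i : Fin (kdim n)) (σ τ : Γ) :
    D.chi n i (σ * τ) = D.chi n i σ * D.chi n i τ :=
  match n, i with
  | 0, _ => (one_mul 1).symm
  | 1, _ => D.w_mul _ _ _
  | 2, _ => D.w_mul _ _ _
  | 3, _ => (one_mul 1).symm
  | _ + 4, i => i.elim0

theorem chi_sq (n : ℕ) (i : Fin (kdim n)) (σ : Γ) : D.chi n i σ * D.chi n i σ = 1 :=
  match n, i with
  | 0, _ => one_mul 1
  | 1, _ => D.w_sq _ _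
  | 2, _ => D.w_sq _ _
  | 3, _ => one_mul 1
  | _ + 4, i => i.elim0

/-- The projection to the invariant Koszul cochains. -/
def kpi (n : ℕ) : (Fin (kdim n) → M) →ₗ[k] (Fin (kdim n) → M) :=
  LinearMap.pi fun i => D.avg S (D.chi n i) ∘ₗ LinearMap.proj i

theorem kpi_apply (n : ℕ) (v : Fin (kdim n) → M) (i : Fin (kdim n)) :
    D.kpi S n v i = D.avg S (D.chi n i) (v i) := rfl

theorem kpi_kpi (n : ℕ) (v : Fin (kdim n) → M) : D.kpi S n (D.kpi S n v) = D.kpi S n v := by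
  funext i
  simp only [kpi_apply]
  exact D.avg_eq_of_conj S (D.chi_sq n i) fun σ => D.conj_avg S (D.chi_mul n i) (D.chi_sq n i) σ _

theorem w_mul_w (σ : Γ) :
    D.w σ 0 * D.w σ 1 = D.w σ 2 ∧ D.w σ 1 * D.w σ 2 = D.w σ 0 ∧ D.w σ 0 * D.w σ 2 = D.w σ 1 := by
  have h := D.w_prod σ
  have h0 := D.w_sq σ 0
  have h1 := D.w_sq σ 1
  have h2 := D.w_sq σ 2
  refine ⟨?_, ?_, ?_⟩
  · linear_combination D.w σ 2 * h - D.w σ 0 * D.w σ 1 * h2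
  · linear_combination D.w σ 0 * h - D.w σ 1 * D.w σ 2 * h0
  · linear_combination D.w σ 1 * h - D.w σ 0 * D.w σ 2 * h1

theorem avg_kd1 (v : Fin 3 → M) (i : Fin 3) :
    D.avg S (fun σ => D.w σ (![1, 0, 2] i)) (D.kd1 S v i) =
      D.kd1 S (fun i => D.avg S (fun σ => D.w σ i) (v i)) i := by
  have h0 := fun σ => (D.w_mul_w σ).1
  have h1 := fun σ => (D.w_mul_w σ).2.1
  have h2 := fun σ => (D.w_mul_w σ).2.2
  have k0 := fun σ => (mul_comm _ _).trans (h0 σ)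
  have k1 := fun σ => (mul_comm _ _).trans (h1 σ)
  have k2 := fun σ => (mul_comm _ _).trans (h2 σ)
  rw [kd1_apply, kd1_apply]
  fin_cases i
  · simp [D.avg_adj S h1, D.avg_adj S k0]
  · simp [D.avg_adj S h2, D.avg_adj S h0]
  · simp [D.avg_adj S k1, D.avg_adj S k2]

theorem avg_kd2 (v : Fin 3 → M) (i : Fin 1) :
    D.avg S (fun _ => 1) (D.kd2 S v i) =
      D.kd2 S (fun i => D.avg S (fun σ => D.w σ (![1, 0, 2] i)) (v i)) i := by
  have h := fun i m => D.avg_adj S (χ := fun _ => 1) (i := i) (fun σ => one_mul _) m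
  simp [kd2_apply, h]

theorem kpi_kd (n : ℕ) (v : Fin (kdim n) → M) :
    D.kpi S (n + 1) (D.kd S n v) = D.kd S n (D.kpi S n v) :=
  match n, v with
  | 0, v => funext fun i : Fin 3 => D.avg_adj S (fun σ => D.w_sq σ i) (v (0 : Fin 1))
  | 1, v => funext fun i : Fin 3 => D.avg_kd1 S v i
  | 2, v => funext fun i : Fin 1 => D.avg_kd2 S v i
  | _ + 3, _ => funext fun i => i.elim0

/-! ### Naturality in the coefficients -/

section Naturality

variable {S S'} {T : M →ₗ[k] N} (hT : Bimod.IsHom S S' T)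
include hT

theorem adj_map (i : Fin 3) (m : M) : D.adj S' i (T m) = T (D.adj S i m) := by
  simp [adj_apply, hT.l, hT.r]

theorem kd_map (n : ℕ) (v : Fin (kdim n) → M) :
    D.kd S' n (T.compLeft _ v) = T.compLeft _ (D.kd S n v) := by
  have h := fun i m => D.adj_map hT i m
  have h1 : ∀ v : Fin 3 → M, D.kd1 S' (T.compLeft _ v) = T.compLeft _ (D.kd1 S v) := by
    intro v
    rw [kd1_apply, kd1_apply]
    funext i
    fin_cases i <;> simp [h]
  have h2 : ∀ v : Fin 3 → M, D.kd2 S' (T.compLeft _ v) = T.compLeft _ (D.kd2 S v) := by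
    intro v
    rw [kd2_apply, kd2_apply]
    funext i
    simp [h]
  exact match n, v with
  | 0, v => funext fun i : Fin 3 => h i _
  | 1, v => h1 v
  | 2, v => h2 v
  | _ + 3, _ => funext fun i => i.elim0

theorem kpi_map (n : ℕ) (v : Fin (kdim n) → M) :
    D.kpi S' n (T.compLeft _ v) = T.compLeft _ (D.kpi S n v) := by
  funext i
  simp [kpi_apply, avg_apply, conj_apply, hT.l, hT.r]

end Naturality

theorem kap_map (T : M →ₗ[k] N) (n : ℕ) (f : Bimod.Cochain k B M n) :
    D.kap n (T.compMultilinearMap f) = T.compLeft _ (D.kap n f) := by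
  have h2 : ∀ f : Bimod.Cochain k B M 2,
      D.kap2 (T.compMultilinearMap f) = T.compLeft _ (D.kap2 f) := by
    intro f
    rw [kap2_apply, kap2_apply]
    funext i
    fin_cases i <;> simp
  have h3 : ∀ f : Bimod.Cochain k B M 3,
      D.kap3 (T.compMultilinearMap f) = T.compLeft _ (D.kap3 f) := by
    intro f
    rw [kap3_apply, kap3_apply]
    funext i
    simp
  exact match n, f with
  | 0, _ => rfl
  | 1, _ => rfl
  | 2, f => h2 f
  | 3, f => h3 f
  | _ + 4, _ => funext fun i => i.elim0

end KoszulData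

/-! ### The Koszul complex of a coinduced bimodule -/

namespace KoszulData

section Coinduced

variable {k B Γ J M : Type*} [Field k] [Ring B] [Algebra k B] [Group Γ] [Fintype Γ]
  [AddCommGroup M] [Module k M] (D : KoszulData k B Γ J) (S : Bimod k B M)

/-- A right inverse of `f ↦ X_i f - f X_i` on `Hom_k(B, M)`: since
`(X_i f - f X_i)(c) = X_i f(c) - f(X_i c)`, the values of `f` on the basis vectors are determined
recursively in the exponent of `X_i`, starting from `0`. -/
def rinv (i : Fin 3) (g : B →ₗ[k] M) : B →ₗ[k] M :=
  D.basis.constr k fun q : J × (Fin 3 →₀ ℕ) => -∑ s ∈ Finset.range (q.2 i),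
    ((S.l (D.X i)) ^ s) (g (D.basis (q.1, q.2 - Finsupp.single i (s + 1))))

theorem rinv_basis (i : Fin 3) (g : B →ₗ[k] M) (j : J) (m : Fin 3 →₀ ℕ) :
    D.rinv S i g (D.basis (j, m)) = -∑ s ∈ Finset.range (m i),
      ((S.l (D.X i)) ^ s) (g (D.basis (j, m - Finsupp.single i (s + 1)))) := by
  simp [rinv, Module.Basis.constr_basis]

theorem adj_coind_basis (i : Fin 3) (g : B →ₗ[k] M) (j : J) (m : Fin 3 →₀ ℕ) :
    D.adj S.coind i g (D.basis (j, m)) =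
      S.l (D.X i) (g (D.basis (j, m))) - g (D.basis (j, m + Finsupp.single i 1)) := by
  rw [← D.X_mul_basis]
  rfl

theorem adj_rinv (i : Fin 3) (g : B →ₗ[k] M) : D.adj S.coind i (D.rinv S i g) = g := by
  refine D.basis.ext fun ⟨j, m⟩ => ?_
  rw [adj_coind_basis, rinv_basis, rinv_basis]
  have h : (m + Finsupp.single i 1 : Fin 3 →₀ ℕ) i = m i + 1 := by simp
  rw [h, Finset.sum_range_succ', map_neg, map_sum]
  have h2 : ∀ s, m + Finsupp.single i 1 - Finsupp.single i (s + 1 + 1) =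
      m - Finsupp.single i (s + 1) := by
    intro s
    ext l
    by_cases hl : i = l
    · subst hl; simp
    · simp [hl]
  simp only [h2, pow_succ', Module.End.mul_apply]
  simp

theorem rinv_adj {i l : Fin 3} (h : l ≠ i) (g : B →ₗ[k] M) :
    D.adj S.coind l (D.rinv S i g) = D.rinv S i (D.adj S.coind l g) := by
  refine D.basis.ext fun ⟨j, m⟩ => ?_
  rw [adj_coind_basis, rinv_basis, rinv_basis, rinv_basis]
  have h1 : (m + Finsupp.single l 1 : Fin 3 →₀ ℕ) i = m i := by simp [h]
  have hc : ∀ (s : ℕ) (m : M), S.l (D.X l) (((S.l (D.X i)) ^ s) m) =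
      ((S.l (D.X i)) ^ s) (S.l (D.X l) m) := by
    intro s
    induction s with
    | zero => intro m; rfl
    | succ s ih =>
      intro m
      rw [pow_succ, Module.End.mul_apply, Module.End.mul_apply, ih, ← S.l_mul, ← S.l_mul,
        D.X_comm]
  have h2 : ∀ s ∈ Finset.range (m i), m + Finsupp.single l 1 - Finsupp.single i (s + 1) =
      m - Finsupp.single i (s + 1) + Finsupp.single l 1 := by
    intro s hs
    ext n
    by_cases hn : i = n
    · subst hn; simp [h]
    · simp [Finsupp.single_apply, hn]
  rw [h1, map_neg, map_sum, sub_neg_eq_add, ← Finset.sum_neg_distrib, ← Finset.sum_add_distrib,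
    ← Finset.sum_neg_distrib]
  refine Finset.sum_congr rfl fun s hs => ?_
  rw [h2 s hs, adj_coind_basis, hc, map_sub]
  abel

theorem adj_rinv_eq_zero {i l : Fin 3} (h : l ≠ i) {g : B →ₗ[k] M}
    (hg : D.adj S.coind l g = 0) : D.adj S.coind l (D.rinv S i g) = 0 := by
  rw [D.rinv_adj S h, hg]
  refine D.basis.ext fun ⟨j, m⟩ => ?_
  simp [rinv_basis]

theorem exists_kd0_eq (v : Fin 3 → B →ₗ[k] M) (hv : D.kd1 S.coind v = 0) :
    ∃ u, D.kd0 S.coind u = v := by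
  rw [kd1_apply] at hv
  have e0 : -D.adj S.coind 2 (v 0) + D.adj S.coind 0 (v 2) = 0 := congrFun hv 0
  have e1 : -D.adj S.coind 2 (v 1) + D.adj S.coind 1 (v 2) = 0 := congrFun hv 1
  have e2 : -D.adj S.coind 1 (v 0) + D.adj S.coind 0 (v 1) = 0 := congrFun hv 2
  set a := D.rinv S 0 (v 0) with ha
  have a0 : D.adj S.coind 0 a = v 0 := D.adj_rinv S 0 _
  set b := D.rinv S 1 (v 1 - D.adj S.coind 1 a) with hb
  have b0 : D.adj S.coind 0 b = 0 := D.adj_rinv_eq_zero S (by decide) (by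
    rw [map_sub, D.adj_comm _ 0 1, a0, ← e2]; abel)
  have b1 : D.adj S.coind 1 b = v 1 - D.adj S.coind 1 a := D.adj_rinv S 1 _
  set c := D.rinv S 2 (v 2 - D.adj S.coind 2 a - D.adj S.coind 2 b) with hc
  have c0 : D.adj S.coind 0 c = 0 := D.adj_rinv_eq_zero S (by decide) (by
    rw [map_sub, map_sub, D.adj_comm _ 0 2, a0, D.adj_comm _ 0 2, b0, map_zero, sub_zero, ← e0]
    abel)
  have c1 : D.adj S.coind 1 c = 0 := D.adj_rinv_eq_zero S (by decide) (by
    rw [map_sub, map_sub, D.adj_comm _ 1 2, D.adj_comm _ 1 2 b, b1, map_sub, ← e1]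
    abel)
  have c2 : D.adj S.coind 2 c = v 2 - D.adj S.coind 2 a - D.adj S.coind 2 b := D.adj_rinv S 2 _
  refine ⟨fun _ => a + b + c, ?_⟩
  rw [kd0_apply]
  funext i
  fin_cases i
  · simp [a0, b0, c0]
  · simp [b1, c1]
  · simp [c2]

theorem exists_kd1_eq (v : Fin 3 → B →ₗ[k] M) (hv : D.kd2 S.coind v = 0) :
    ∃ u, D.kd1 S.coind u = v := by
  rw [kd2_apply] at hv
  have e0 : -D.adj S.coind 1 (v 0) + D.adj S.coind 0 (v 1) + D.adj S.coind 2 (v 2) = 0 :=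
    congrFun hv 0
  set r := D.rinv S 0 (v 0) with hr
  have r0 : D.adj S.coind 0 r = v 0 := D.adj_rinv S 0 _
  set q := D.rinv S 0 (v 2) with hq
  have q0 : D.adj S.coind 0 q = v 2 := D.adj_rinv S 0 _
  set p := D.rinv S 1 (v 1 - D.adj S.coind 1 r + D.adj S.coind 2 q) with hp
  have p0 : D.adj S.coind 0 p = 0 := D.adj_rinv_eq_zero S (by decide) (by
    rw [map_add, map_sub, D.adj_comm _ 0 1, r0, D.adj_comm _ 0 2, q0, ← e0]; abel)
  have p1 : D.adj S.coind 1 p = v 1 - D.adj S.coind 1 r + D.adj S.coind 2 q := D.adj_rinv S 1 _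
  refine ⟨![0, q, r + p], ?_⟩
  rw [kd1_apply]
  funext i
  fin_cases i
  · simp [r0, p0]
  · simp [p1]
    abel
  · simp [q0]

theorem exists_kd2_eq (v : Fin 1 → B →ₗ[k] M) : ∃ u, D.kd2 S.coind u = v := by
  refine ⟨![0, D.rinv S 0 (v 0), 0], ?_⟩
  rw [kd2_apply]
  funext i
  obtain rfl : i = 0 := Subsingleton.elim _ _
  simp [adj_rinv]

/-- The Koszul complex of a coinduced bimodule is acyclic in positive degrees. -/
theorem exists_kd_eq (n : ℕ) (v : Fin (kdim (n + 1)) → B →ₗ[k] M)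
    (hv : D.kd S.coind (n + 1) v = 0) : ∃ u, D.kd S.coind n u = v :=
  match n, v, hv with
  | 0, v, hv => D.exists_kd0_eq S v hv
  | 1, v, hv => D.exists_kd1_eq S v hv
  | 2, v, _ => D.exists_kd2_eq S v
  | _ + 3, _, _ => ⟨0, funext fun i => i.elim0⟩

end Coinduced

/-! ### Comparison of Hochschild and invariant Koszul cohomology -/

section Comparison

variable {k Γ J : Type*} {B M : Type u} [Field k] [Ring B] [Algebra k B] [Group Γ] [Fintype Γ]
  [AddCommGroup M] [Module k M] (D : KoszulData k B Γ J) (S : Bimod k B M)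

theorem delta_zero_eq_zero_iff (f : Bimod.Cochain k B M 0) :
    S.delta 0 f = 0 ↔ ∀ b, S.l b (f ![]) = S.r b (f ![]) := by
  have h1 : ∀ v : Fin 0 → B, f v = f ![] := fun v => congrArg f (Subsingleton.elim _ _)
  constructor
  · intro h b
    have := congrArg (fun g => g ![b]) h
    simpa [Bimod.delta_apply, h1, ← sub_eq_add_neg, sub_eq_zero] using this
  · intro h
    ext b
    simp [Bimod.delta_apply, h1, h]

/-- An element commutes with all of `B` exactly when it commutes with the variables and is fixed
by conjugation. -/
theorem commutes_iff (m : M) : (∀ b, S.l b m = S.r b m) ↔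
    (∀ i, D.adj S i m = 0) ∧ D.avg S (fun _ => 1) m = m := by
  rw [D.avg_eq_iff S (fun _ _ => (one_mul 1).symm) (fun _ => one_mul 1)]
  simp only [one_smul, conj_eq_iff, adj_apply, sub_eq_zero]
  constructor
  · intro h
    exact ⟨fun i => h _, fun σ => h _⟩
  · rintro ⟨h1, h2⟩ b
    have hb : b ∈ Algebra.adjoin k (Set.range D.X ∪ Set.range fun σ => (D.t σ : B)) := by
      rw [D.adjoin_eq_top]; trivial
    induction hb using Algebra.adjoin_induction with
    | mem b hb =>
      rcases hb with ⟨i, rfl⟩ | ⟨σ, rfl⟩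
      · exact h1 i
      · exact h2 σ
    | algebraMap c => simp [Algebra.algebraMap_eq_smul_one, S.l_one, S.r_one]
    | add b b' _ _ hb hb' => simp [hb, hb']
    | mul b b' _ _ hb hb' => rw [S.l_mul, S.r_mul, hb', ← hb, S.l_r]

theorem delta_zero_iff (f : Bimod.Cochain k B M 0) :
    S.delta 0 f = 0 ↔ D.kd S 0 (D.kap 0 f) = 0 ∧ D.kpi S 0 (D.kap 0 f) = D.kap 0 f := by
  rw [delta_zero_eq_zero_iff, D.commutes_iff]
  refine and_congr ⟨fun h => funext fun i => h i, fun h i => congrFun h i⟩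
    ⟨fun h => funext fun i => h, fun h => congrFun h (0 : Fin 1)⟩

theorem kap_zero_injective : Function.Injective (D.kap (M := M) 0) := fun f g h => by
  ext v
  rw [Subsingleton.elim v ![]]
  exact congrFun h (0 : Fin 1)

theorem exists_kap_zero_eq (v : Fin (kdim 0) → M) :
    ∃ f : Bimod.Cochain k B M 0, D.kap 0 f = v :=
  ⟨MultilinearMap.constOfIsEmpty k _ (v (0 : Fin 1)), funext fun i => by
    obtain rfl : i = (0 : Fin 1) := Subsingleton.elim (α := Fin 1) _ _
    rfl⟩

/-- In degree `n`, the map from Hochschild cohomology to Koszul cohomology is injective with image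
the invariants. -/
structure IsComparison (n : ℕ) : Prop where
  inj : ∀ f, S.delta n f = 0 → D.kap n f ∈ D.kB S n → f ∈ hB S n
  surj : ∀ v, D.kd S n v = 0 → D.kpi S n v = v →
    ∃ f, S.delta n f = 0 ∧ D.kap n f - v ∈ D.kB S n
  inv : ∀ f, S.delta n f = 0 → D.kpi S n (D.kap n f) - D.kap n f ∈ D.kB S n

theorem isComparison_zero : D.IsComparison S 0 where
  inj f _ h := (Submodule.mem_bot k).2 (D.kap_zero_injective (by
    rw [(Submodule.mem_bot k).1 h, map_zero]))
  surj v h h' := by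
    obtain ⟨f, rfl⟩ := D.exists_kap_zero_eq v
    exact ⟨f, (D.delta_zero_iff S f).2 ⟨h, h'⟩, by rw [sub_self]; exact zero_mem _⟩
  inv f h := by
    rw [((D.delta_zero_iff S f).1 h).2, sub_self]; exact zero_mem _

/-! ### Exactness of `0 → M → Hom_k(B, M) → coker → 0` on cochains -/

theorem toCoind_compLeft_injective (n : ℕ) :
    Function.Injective (S.toCoind.compLeft (Fin n)) := fun _ _ h =>
  funext fun i => S.toCoind_injective (congrFun h i)

theorem toCoind_comp_injective (n : ℕ) {f g : Bimod.Cochain k B M n}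
    (h : S.toCoind.compMultilinearMap f = S.toCoind.compMultilinearMap g) : f = g := by
  ext b
  exact S.toCoind_injective (congrArg (fun F => F b) h)

theorem exists_toCoind_compLeft {n : ℕ} {v : Fin n → B →ₗ[k] M}
    (h : S.toCoker.compLeft _ v = 0) : ∃ u, S.toCoind.compLeft _ u = v :=
  ⟨fun i => v i 1, funext fun i => S.exists_of_toCoker_eq_zero (congrFun h i)⟩

theorem exists_toCoind_comp {n : ℕ} {f : Bimod.Cochain k B (B →ₗ[k] M) n}
    (h : S.toCoker.compMultilinearMap f = 0) : ∃ g, S.toCoind.compMultilinearMap g = f := by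
  refine ⟨(LinearMap.applyₗ (1 : B)).compMultilinearMap f, ?_⟩
  ext1 b
  exact S.exists_of_toCoker_eq_zero (congrArg (fun F => F b) h)

theorem toCoker_compLeft_toCoind {n : ℕ} (v : Fin n → M) :
    S.toCoker.compLeft _ (S.toCoind.compLeft _ v) = 0 :=
  funext fun _ => S.toCoker_toCoind _

theorem toCoker_comp_toCoind {n : ℕ} (f : Bimod.Cochain k B M n) :
    S.toCoker.compMultilinearMap (S.toCoind.compMultilinearMap f) = 0 := by
  ext1 b
  exact S.toCoker_toCoind _

theorem exists_toCoker_comp {n : ℕ} (f : Bimod.Cochain k B (Bimod.vanish k B M) n) :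
    ∃ g, S.toCoker.compMultilinearMap g = f := by
  refine ⟨(Bimod.vanish k B M).subtype.compMultilinearMap f, ?_⟩
  ext1 b
  exact S.toCoker_section _

theorem exists_toCoker_compLeft {n : ℕ} (v : Fin n → Bimod.vanish k B M) :
    ∃ u, S.toCoker.compLeft _ u = v :=
  ⟨fun i => v i, funext fun _ => S.toCoker_section _⟩

theorem exists_mem_kB_toCoker {n : ℕ} {v : Fin (kdim n) → Bimod.vanish k B M}
    (hv : v ∈ D.kB S.coker n) : ∃ u ∈ D.kB S.coind n, S.toCoker.compLeft _ u = v :=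
  match n, v, hv with
  | 0, _, hv => ⟨0, zero_mem _, by rw [(Submodule.mem_bot k).1 hv, map_zero]⟩
  | n + 1, _, ⟨w, h⟩ => by
    obtain ⟨u, rfl⟩ := exists_toCoker_compLeft S w
    exact ⟨D.kd S.coind n u, ⟨u, rfl⟩, by rw [← D.kd_map S.toCoker_isHom, h]⟩

/-- A cocycle becomes a coboundary in the coinduced bimodule. -/
theorem exists_delta_eq_toCoind {n : ℕ} {f : Bimod.Cochain k B M (n + 1)}
    (hf : S.delta (n + 1) f = 0) : ∃ e, S.coind.delta n e = S.toCoind.compMultilinearMap f ∧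
      S.coker.delta n (S.toCoker.compMultilinearMap e) = 0 := by
  obtain ⟨e, he⟩ := S.exists_delta_coind_eq (S.toCoind.compMultilinearMap f) (by
    rw [S.toCoind_isHom.delta, hf]; ext; simp)
  exact ⟨e, he, by rw [S.toCoker_isHom.delta, he, toCoker_comp_toCoind]⟩

/-- A class of degree `n + 1` with values in `M` is the connecting image of an invariant class of
degree `n` with values in the cokernel, to which the induction hypothesis applies. -/
theorem surj_succ {n : ℕ} (ih : D.IsComparison S.coker n) (v : Fin (kdim (n + 1)) → M)
    (h1 : D.kd S (n + 1) v = 0) (h2 : D.kpi S (n + 1) v = v) :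
    ∃ f, S.delta (n + 1) f = 0 ∧ D.kap (n + 1) f - v ∈ D.kB S (n + 1) := by
  obtain ⟨e', he'⟩ := D.exists_kd_eq S n (S.toCoind.compLeft _ v) (by
    rw [D.kd_map S.toCoind_isHom, h1, map_zero])
  -- averaging makes the primitive invariant
  obtain ⟨e, he, hpe⟩ : ∃ e, D.kd S.coind n e = S.toCoind.compLeft _ v ∧
      D.kpi S.coind n e = e :=
    ⟨D.kpi S.coind n e', by rw [← kpi_kd, he', D.kpi_map S.toCoind_isHom, h2], D.kpi_kpi _ _ _⟩
  obtain ⟨f', hf', hk⟩ := ih.surj (S.toCoker.compLeft _ e)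
    (by rw [D.kd_map S.toCoker_isHom, he, toCoker_compLeft_toCoind])
    (by rw [D.kpi_map S.toCoker_isHom, hpe])
  obtain ⟨F, rfl⟩ := exists_toCoker_comp S f'
  obtain ⟨l, hl, hl'⟩ := D.exists_mem_kB_toCoker S hk
  obtain ⟨g, hg⟩ := exists_toCoind_comp S (f := S.coind.delta n F) (by
    rw [← S.toCoker_isHom.delta, hf'])
  obtain ⟨u, hu⟩ := exists_toCoind_compLeft S (v := D.kap n F - e - l) (by
    rw [map_sub, map_sub, hl', kap_map, sub_self])
  refine ⟨g, toCoind_comp_injective S _ ?_, u, toCoind_compLeft_injective S _ ?_⟩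
  · rw [← S.toCoind_isHom.delta, hg, Bimod.delta_delta]; ext; simp
  · rw [← D.kd_map S.toCoind_isHom, hu, map_sub, map_sub, D.kd_of_mem_kB _ hl, sub_zero, he,
      ← kap_delta, ← hg, kap_map, map_sub]

theorem inv_succ {n : ℕ} (ih : D.IsComparison S.coker n) (f : Bimod.Cochain k B M (n + 1))
    (hf : S.delta (n + 1) f = 0) :
    D.kpi S (n + 1) (D.kap (n + 1) f) - D.kap (n + 1) f ∈ D.kB S (n + 1) := by
  obtain ⟨e, he, he'⟩ := exists_delta_eq_toCoind S hf
  obtain ⟨l, hl, hl'⟩ := D.exists_mem_kB_toCoker S (ih.inv _ he')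
  obtain ⟨u, hu⟩ := exists_toCoind_compLeft S
    (v := D.kpi S.coind n (D.kap n e) - D.kap n e - l) (by
      rw [map_sub, map_sub, hl', kap_map, D.kpi_map S.toCoker_isHom, sub_self])
  refine ⟨u, toCoind_compLeft_injective S _ ?_⟩
  rw [← D.kd_map S.toCoind_isHom, hu, map_sub, map_sub, D.kd_of_mem_kB _ hl, sub_zero,
    ← kpi_kd, ← kap_delta, he, kap_map, D.kpi_map S.toCoind_isHom, map_sub]

/-- The step from degree zero differs from `inj_succ`, because the coinduced bimodule has cohomology
in degree zero. -/
theorem inj_one (f : Bimod.Cochain k B M 1) (hf : S.delta 1 f = 0)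
    (hk : D.kap 1 f ∈ D.kB S 1) : f ∈ hB S 1 := by
  obtain ⟨v, hv⟩ := hk
  obtain ⟨e, he, he'⟩ := exists_delta_eq_toCoind S hf
  have h0 : D.kd S.coind 0 (D.kap 0 e - S.toCoind.compLeft _ v) = 0 := by
    rw [map_sub, ← kap_delta, he, kap_map, D.kd_map S.toCoind_isHom, hv, sub_self]
  -- the invariant part of `κe - v` commutes with `B`; the remaining part lies in `M`
  obtain ⟨f0, hf0, hk0⟩ := (D.isComparison_zero S.coind).surj
    (D.kpi S.coind 0 (D.kap 0 e - S.toCoind.compLeft _ v))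
    (by rw [← kpi_kd, h0, map_zero]) (D.kpi_kpi _ _ _)
  have hk0 := sub_eq_zero.1 ((Submodule.mem_bot k).1 hk0)
  obtain ⟨u, hu⟩ := exists_toCoind_compLeft S (v := D.kap 0 e - S.toCoind.compLeft _ v - D.kap 0 f0)
    (by
      rw [hk0, map_sub, map_sub, ← D.kpi_map S.toCoker_isHom, map_sub, toCoker_compLeft_toCoind,
        sub_zero, ← kap_map, ((D.delta_zero_iff _ _).1 he').2, sub_self])
  obtain ⟨g, hg⟩ := D.exists_kap_zero_eq (v + u)
  have hg' : e = f0 + S.toCoind.compMultilinearMap g := D.kap_zero_injective (by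
    rw [map_add, kap_map, hg, map_add, hu]; abel)
  refine ⟨g, toCoind_comp_injective S _ ?_⟩
  rw [← S.toCoind_isHom.delta, ← he, hg', map_add, hf0, zero_add]

theorem inj_succ {n : ℕ} (ih : D.IsComparison S.coker (n + 1))
    (f : Bimod.Cochain k B M (n + 2)) (hf : S.delta (n + 2) f = 0)
    (hk : D.kap (n + 2) f ∈ D.kB S (n + 2)) : f ∈ hB S (n + 2) := by
  obtain ⟨v, hv⟩ := hk
  obtain ⟨e, he, he'⟩ := exists_delta_eq_toCoind S hf
  obtain ⟨l, hl⟩ := D.exists_kd_eq S n (D.kap (n + 1) e - S.toCoind.compLeft _ v) (by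
    rw [map_sub, ← kap_delta, he, kap_map, D.kd_map S.toCoind_isHom, hv, sub_self])
  obtain ⟨q, hq⟩ := ih.inj _ he' ⟨S.toCoker.compLeft _ l, by
    rw [D.kd_map S.toCoker_isHom, hl, map_sub, toCoker_compLeft_toCoind, sub_zero, kap_map]⟩
  obtain ⟨Q, rfl⟩ := exists_toCoker_comp S q
  obtain ⟨g, hg⟩ := exists_toCoind_comp S (f := e - S.coind.delta n Q) (by
    rw [S.toCoker_isHom.delta] at hq
    ext1 b
    have := congrArg (fun F => F b) hq
    simp only [LinearMap.compMultilinearMap_apply] at this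
    simp [this])
  refine ⟨g, toCoind_comp_injective S _ ?_⟩
  rw [← S.toCoind_isHom.delta, hg, map_sub, he, Bimod.delta_delta, sub_zero]

/-- Hochschild cohomology with coefficients in any bimodule is the invariant part of Koszul
cohomology, by dimension shifting. -/
theorem isComparison (n : ℕ) : ∀ {M : Type u} [AddCommGroup M] [Module k M] (S : Bimod k B M),
    D.IsComparison S n := by
  induction n with
  | zero => intro M _ _ S; exact D.isComparison_zero S
  | succ n ih =>
    intro M _ _ S
    refine ⟨?_, D.surj_succ S (ih _), D.inv_succ S (ih _)⟩
    cases n with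
    | zero => exact D.inj_one S
    | succ n => exact D.inj_succ S (ih _)

end Comparison
end KoszulData

/-! ### From Koszul representatives to Hochschild classes -/

/-- If `κ` induces an injection of `HH^n` into `K / I` whose image is that of a subspace `W` meeting
`I` in zero, then `W` represents `HH^n`. -/
theorem representedBy_of {k B A K : Type*} [Field k] [Ring B] [Algebra k B] [Ring A] [Algebra k A]
    [AddCommGroup K] [Module k K] {φ : B →ₐ[k] A} {n : ℕ} (κ : HCochain k B A n →ₗ[k] K)
    {I W : Submodule k K} (hrep : ∀ f ∈ hCocycles φ n, ∃ w ∈ W, κ f - w ∈ I) (hWI : W ⊓ I = ⊥)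
    (hsurj : ∀ w ∈ W, ∃ f ∈ hCocycles φ n, κ f - w ∈ I)
    (hinj : ∀ f ∈ hCocycles φ n, κ f ∈ I → f ∈ hCoboundaries φ n)
    (hbd : ∀ f ∈ hCoboundaries φ n, κ f ∈ I) : RepresentedBy φ n κ I W := by
  let c : HH φ n →ₗ[k] K ⧸ I :=
    Submodule.liftQ _ ((I.mkQ ∘ₗ κ) ∘ₗ (hCocycles φ n).subtype) (by
      intro f hf
      exact (Submodule.Quotient.mk_eq_zero I).2 (hbd f hf))
  have hc : ∀ f : hCocycles φ n, c (HH.mk φ f) = I.mkQ (κ f.1) := fun f => rfl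
  have c_inj : Function.Injective c := by
    rw [← LinearMap.ker_eq_bot, LinearMap.ker_eq_bot']
    intro q hq
    obtain ⟨f, rfl⟩ := Submodule.Quotient.mk_surjective _ q
    rw [Submodule.Quotient.mk_eq_zero]
    exact hinj f.1 f.2 ((Submodule.Quotient.mk_eq_zero I).1 hq)
  let d : W →ₗ[k] K ⧸ I := I.mkQ ∘ₗ W.subtype
  have d_inj : Function.Injective d := by
    rw [← LinearMap.ker_eq_bot, LinearMap.ker_eq_bot']
    intro w hw
    have : (w : K) ∈ W ⊓ I := ⟨w.2, (Submodule.Quotient.mk_eq_zero I).1 hw⟩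
    rw [hWI] at this
    exact Subtype.ext ((Submodule.mem_bot k).1 this)
  have hr : LinearMap.range c = LinearMap.range d := by
    apply le_antisymm
    · rintro _ ⟨q, rfl⟩
      obtain ⟨f, rfl⟩ := Submodule.Quotient.mk_surjective _ q
      obtain ⟨w, hw, h⟩ := hrep f.1 f.2
      exact ⟨⟨w, hw⟩, ((Submodule.Quotient.eq I).2 h).symm⟩
    · rintro _ ⟨w, rfl⟩
      obtain ⟨f, hf, h⟩ := hsurj w.1 w.2
      exact ⟨HH.mk φ ⟨f, hf⟩, (Submodule.Quotient.eq I).2 h⟩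
  refine ⟨(LinearEquiv.ofInjective c c_inj).trans
    ((LinearEquiv.ofEq _ _ hr).trans (LinearEquiv.ofInjective d d_inj).symm), fun f => ?_⟩
  set w := ((LinearEquiv.ofInjective c c_inj).trans
    ((LinearEquiv.ofEq _ _ hr).trans (LinearEquiv.ofInjective d d_inj).symm)) (HH.mk φ f) with hw
  have h : d w = c (HH.mk φ f) := by
    have := congrArg Subtype.val (LinearEquiv.apply_symm_apply (LinearEquiv.ofInjective d d_inj)
      (LinearEquiv.ofEq _ _ hr (LinearEquiv.ofInjective c c_inj (HH.mk φ f))))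
    exact this
  exact (Submodule.Quotient.eq I).1 h.symm

namespace KoszulData

section Represent

variable {k Γ J K : Type*} {B A : Type u} [Field k] [Ring B] [Algebra k B] [Group Γ] [Fintype Γ]
  [Ring A] [Algebra k A] [AddCommGroup K] [Module k K]

theorem hB_ofAlgHom (φ : B →ₐ[k] A) (n : ℕ) : hB (Bimod.ofAlgHom φ) n = hCoboundaries φ n := by
  cases n <;> rfl

/-- Let `W₀` be a complement of the Koszul coboundaries in the Koszul cocycles that is stable
under averaging, and `W` its invariant part. Then `W` represents Hochschild cohomology. -/
theorem representedBy (D : KoszulData k B Γ J) (φ : B →ₐ[k] A) (n : ℕ)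
    (θ : (Fin (kdim n) → A) ≃ₗ[k] K) {Z I W₀ W : Submodule k K} {κ : HCochain k B A n → K}
    (hκ : ∀ f, κ f = θ (D.kap n f))
    (hZ : ∀ v, θ v ∈ Z ↔ D.kd (Bimod.ofAlgHom φ) n v = 0)
    (hI : ∀ v, θ v ∈ I ↔ v ∈ D.kB (Bimod.ofAlgHom φ) n)
    (hW₀ : W₀ ⊔ I = Z ∧ W₀ ⊓ I = ⊥)
    (hstab : ∀ v, θ v ∈ W₀ → θ (D.kpi (Bimod.ofAlgHom φ) n v) ∈ W₀)
    (hW : ∀ v, θ v ∈ W ↔ θ v ∈ W₀ ∧ D.kpi (Bimod.ofAlgHom φ) n v = v) :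
    RepresentedBy φ n κ I W := by
  set S := Bimod.ofAlgHom φ with hS
  have hC := D.isComparison n S
  obtain rfl : κ = (θ.toLinearMap ∘ₗ D.kap n : HCochain k B A n →ₗ[k] K) := funext hκ
  have hWW : W ≤ W₀ := fun w hw => by
    obtain ⟨v, rfl⟩ := θ.surjective w
    exact ((hW v).1 hw).1
  have hdisj : ∀ w ∈ W₀, w ∈ I → w = 0 := fun w h1 h2 => by
    have : w ∈ W₀ ⊓ I := ⟨h1, h2⟩
    rw [hW₀.2] at this
    exact (Submodule.mem_bot k).1 this
  have kpi_kB : ∀ v ∈ D.kB S n, D.kpi S n v ∈ D.kB S n := by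
    intro v hv
    cases n with
    | zero => rw [(Submodule.mem_bot k).1 hv, map_zero]; exact zero_mem _
    | succ n =>
      obtain ⟨u, rfl⟩ := hv
      exact ⟨D.kpi S n u, (D.kpi_kd S n u).symm⟩
  refine representedBy_of (θ.toLinearMap ∘ₗ D.kap n : HCochain k B A n →ₗ[k] K) ?_ ?_ ?_ ?_ ?_
  · intro f hf
    have hf' : S.delta n f = 0 := hf
    have h1 : θ (D.kap n f) ∈ Z := (hZ _).2 (by
      rw [← kap_delta, hf', map_zero])
    rw [← hW₀.1, Submodule.mem_sup] at h1
    obtain ⟨w, hw, i, hi, h⟩ := h1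
    obtain ⟨v, rfl⟩ := θ.surjective w
    obtain ⟨j, rfl⟩ := θ.surjective i
    rw [← map_add] at h
    have h' := θ.injective h
    rw [hI] at hi
    refine ⟨θ v, (hW v).2 ⟨hw, ?_⟩, ?_⟩
    · -- the component in `W₀` of a cocycle that is invariant modulo coboundaries is invariant
      have h2 := hC.inv f hf'
      rw [← h', map_add] at h2
      have h3 : D.kpi S n v - v ∈ D.kB S n := by
        have := add_mem (sub_mem h2 (kpi_kB j hi)) hi
        convert this using 1
        abel
      have h4 := hdisj (θ (D.kpi S n v - v))
        (by rw [map_sub]; exact sub_mem (hstab v hw) hw) ((hI _).2 h3)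
      exact sub_eq_zero.1 (θ.map_eq_zero_iff.1 h4)
    · have : (θ.toLinearMap ∘ₗ D.kap n : HCochain k B A n →ₗ[k] K) f - θ v = θ j := by
        simp [← h']
      rw [this]
      exact (hI _).2 hi
  · exact le_bot_iff.1 ((inf_le_inf_right I hWW).trans hW₀.2.le)
  · intro w hw
    obtain ⟨v, rfl⟩ := θ.surjective w
    have hz : θ v ∈ Z := by rw [← hW₀.1]; exact Submodule.mem_sup_left (hWW hw)
    obtain ⟨f, hf, h⟩ := hC.surj v ((hZ v).1 hz) ((hW v).1 hw).2
    refine ⟨f, hf, ?_⟩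
    have := (hI _).2 h
    rwa [map_sub] at this
  · intro f hf h
    rw [← hB_ofAlgHom]
    exact hC.inj f hf ((hI _).1 h)
  · intro f hf
    rw [← hB_ofAlgHom] at hf
    refine (hI _).2 ?_
    cases n with
    | zero => rw [(Submodule.mem_bot k).1 hf, map_zero]; exact zero_mem _
    | succ n =>
      obtain ⟨g, rfl⟩ := hf
      exact ⟨D.kap n g, (D.kap_delta S n g).symm⟩

theorem subsingleton_HH (D : KoszulData k B Γ J) (φ : B →ₐ[k] A) {n : ℕ} (hn : 3 < n) :
    Subsingleton (HH φ n) := by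
  obtain ⟨n, rfl⟩ : ∃ m, n = m + 4 := ⟨n - 4, by omega⟩
  refine Submodule.Quotient.subsingleton_iff.2 (eq_top_iff.2 ?_)
  rintro f -
  have h := (D.isComparison (n + 4) (Bimod.ofAlgHom φ)).inj f.1 f.2 ⟨0, funext fun i => i.elim0⟩
  rw [hB_ofAlgHom] at h
  exact h

end Represent

end KoszulData

/-! ### The polynomial ring and the crossed product -/

open MvPolynomial in
/-- `ℂ[x, y, z]`, with the trivial group. -/
def polyData : KoszulData ℂ PolyXYZ Unit Unit where
  X := MvPolynomial.X
  X_comm i j := mul_comm _ _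
  basis := (basisMonomials (Fin 3) ℂ).reindex (Equiv.punitProd _).symm
  X_mul_basis i j m := by
    simp [X, monomial_mul, add_comm]
  t _ := 1
  t_mul _ _ := ⟨1, by simp⟩
  w _ _ := 1
  w_mul _ _ _ := by simp
  w_sq _ _ := by simp
  w_prod _ := by simp
  t_X _ _ := by simp
  adjoin_eq_top := by
    rw [eq_top_iff, ← adjoin_range_X]
    exact Algebra.adjoin_mono Set.subset_union_left
  card_ne_zero := by simp

theorem polyData_kpi {M : Type*} [AddCommGroup M] [Module ℂ M] (S : Bimod ℂ PolyXYZ M) (n : ℕ)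
    (v : Fin (kdim n) → M) : polyData.kpi S n v = v := by
  funext i
  refine polyData.avg_eq_of_conj S (polyData.chi_sq n i) fun σ => ?_
  have h : polyData.chi n i σ = 1 := match n, i with
    | 0, _ => rfl
    | 1, _ => rfl
    | 2, _ => rfl
    | 3, _ => rfl
    | _ + 4, i => i.elim0
  rw [h, one_smul, KoszulData.conj_eq_iff]
  simp [polyData, S.l_one, S.r_one]

theorem kleinAct_X (σ : Klein) (i : Fin 3) :
    kleinAct σ (MvPolynomial.X i) = weight σ i • (MvPolynomial.X i : PolyXYZ) := by
  have : kleinAct σ (MvPolynomial.X i) =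
    (MvPolynomial.aeval fun i => MvPolynomial.C (weight σ i) * MvPolynomial.X i :
      PolyXYZ →ₐ[ℂ] PolyXYZ) (MvPolynomial.X i) := rfl
  rw [this, MvPolynomial.aeval_X, MvPolynomial.smul_eq_C_mul]

/-- The scalar by which `σ` acts on the monomial with exponents `m`. -/
def wt (σ : Klein) (m : Fin 3 →₀ ℕ) : ℂ := ∏ i, weight σ i ^ m i

theorem coeff_kleinAct (σ : Klein) (p : PolyXYZ) (m : Fin 3 →₀ ℕ) :
    (kleinAct σ p).coeff m = wt σ m * p.coeff m := by
  have h0 : kleinAct σ p = (MvPolynomial.aeval fun i =>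
      MvPolynomial.C (weight σ i) * MvPolynomial.X i : PolyXYZ →ₐ[ℂ] PolyXYZ) p := rfl
  have h1 : ∀ (n : Fin 3 →₀ ℕ) (c : ℂ), (MvPolynomial.aeval fun i =>
      MvPolynomial.C (weight σ i) * MvPolynomial.X i : PolyXYZ →ₐ[ℂ] PolyXYZ)
      (MvPolynomial.monomial n c) = MvPolynomial.monomial n (wt σ n * c) := by
    intro n c
    rw [MvPolynomial.aeval_monomial, MvPolynomial.algebraMap_eq, MvPolynomial.monomial_eq (s := n),
      Finsupp.prod_fintype _ _ (by simp), Finsupp.prod_fintype _ _ (by simp)]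
    simp only [mul_pow, Finset.prod_mul_distrib, wt, map_mul, map_prod, map_pow]
    ring
  rw [h0]
  induction p using MvPolynomial.induction_on' with
  | monomial n c =>
    rw [h1, MvPolynomial.coeff_monomial, MvPolynomial.coeff_monomial]
    split_ifs with h
    · rw [h]
    · simp
  | add p q hp hq => rw [map_add, MvPolynomial.coeff_add, hp rfl, hq rfl, MvPolynomial.coeff_add,
      mul_add]

section CP

open CrossedProduct

variable {α : TwoCocycle Klein ℂ}

theorem klein_cases : ∀ σ : Klein, σ = 1 ∨ σ = ga ∨ σ = gb ∨ σ = gc := by decide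

theorem klein_sq : ∀ σ : Klein, σ * σ = 1 := by decide

/-- The coefficient of `σ̄`. -/
def co (α : TwoCocycle Klein ℂ) (σ : Klein) : KleinCP α →ₗ[ℂ] PolyXYZ :=
  (Finsupp.lapply σ : (Klein →₀ PolyXYZ) →ₗ[ℂ] PolyXYZ)

theorem co_single (σ τ : Klein) (p : PolyXYZ) :
    co α σ (single kleinAct α τ p) = if τ = σ then p else 0 := Finsupp.single_apply

theorem co_ext {u v : KleinCP α} (h : ∀ σ, co α σ u = co α σ v) : u = v :=
  Finsupp.ext (f := (u : Klein →₀ PolyXYZ)) (g := v) h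

theorem exists_co_eq (p : Klein → PolyXYZ) : ∃ u : KleinCP α, ∀ σ, co α σ u = p σ :=
  ⟨(Finsupp.equivFunOnFinite.symm p : Klein →₀ PolyXYZ), fun _ => rfl⟩

theorem co_single_mul (σ τ : Klein) (p : PolyXYZ) (u : KleinCP α) :
    co α (τ * σ) (single kleinAct α τ p * u) = (α τ σ : ℂ) • (p * kleinAct τ (co α σ u)) := by
  have : (co α (τ * σ)) ∘ₗ LinearMap.mulLeft ℂ (single kleinAct α τ p) =
      ((α τ σ : ℂ) • (LinearMap.mulLeft ℂ p ∘ₗ (kleinAct τ).toLinearMap)) ∘ₗ co α σ := by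
    refine hom_ext fun υ q => ?_
    simp only [LinearMap.comp_apply, LinearMap.mulLeft_apply, single_mul_single, co_single,
      mul_right_inj, LinearMap.smul_apply]
    split_ifs with h
    · rw [h]; rfl
    · simp
  exact LinearMap.congr_fun this u

theorem co_mul_single (σ τ : Klein) (p : PolyXYZ) (u : KleinCP α) :
    co α (τ * σ) (u * single kleinAct α τ p) = (α σ τ : ℂ) • (co α σ u * kleinAct σ p) := by
  have : (co α (τ * σ)) ∘ₗ LinearMap.mulRight ℂ (single kleinAct α τ p) =
      ((α σ τ : ℂ) • LinearMap.mulRight ℂ (kleinAct σ p)) ∘ₗ co α σ := by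
    refine hom_ext fun υ q => ?_
    simp only [LinearMap.comp_apply, LinearMap.mulRight_apply, single_mul_single, co_single,
      mul_comm τ, mul_left_inj, LinearMap.smul_apply]
    split_ifs with h
    · rw [h]
    · simp
  exact LinearMap.congr_fun this u

theorem incl_apply (p : PolyXYZ) :
    incl α p = single kleinAct α 1 (((α 1 1 : ℂˣ) : ℂ)⁻¹ • p) := by
  rw [← Units.val_inv_eq_inv_val]; rfl

theorem co_incl_mul (σ : Klein) (p : PolyXYZ) (u : KleinCP α) :
    co α σ (incl α p * u) = p * co α σ u := by
  have := co_single_mul (α := α) σ 1 (((α 1 1 : ℂˣ) : ℂ)⁻¹ • p) u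
  rw [one_mul, ← incl_apply] at this
  rw [this, cocycle_one_left, map_one, AlgEquiv.one_apply, smul_mul_assoc, smul_smul,
    mul_inv_cancel₀ (Units.ne_zero _), one_smul]

theorem co_mul_incl (σ : Klein) (p : PolyXYZ) (u : KleinCP α) :
    co α σ (u * incl α p) = co α σ u * kleinAct σ p := by
  have := co_mul_single (α := α) σ 1 (((α 1 1 : ℂˣ) : ℂ)⁻¹ • p) u
  rw [one_mul, ← incl_apply] at this
  rw [this, cocycle_one_right, map_smul, mul_smul_comm, smul_smul,
    mul_inv_cancel₀ (Units.ne_zero _), one_smul]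

/-- The unit `σ̄` of the crossed product. -/
def bar (α : TwoCocycle Klein ℂ) (σ : Klein) : (KleinCP α)ˣ where
  val := single kleinAct α σ 1
  inv := ((α σ σ : ℂ) * (α 1 1 : ℂ))⁻¹ • single kleinAct α σ 1
  val_inv := by
    rw [mul_smul_comm, single_mul_single, klein_sq, map_one, mul_one, ← map_smul, smul_smul, one_eq,
      mul_inv, mul_right_comm, inv_mul_cancel₀ (Units.ne_zero _), one_mul,
      Algebra.algebraMap_eq_smul_one, Units.val_inv_eq_inv_val]
  inv_val := by
    rw [smul_mul_assoc, single_mul_single, klein_sq, map_one, mul_one, ← map_smul, smul_smul, one_eq,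
      mul_inv, mul_right_comm, inv_mul_cancel₀ (Units.ne_zero _), one_mul,
      Algebra.algebraMap_eq_smul_one, Units.val_inv_eq_inv_val]

theorem weight_sq (σ : Klein) (i : Fin 3) : weight σ i * weight σ i = 1 := by
  rcases klein_cases σ with rfl | rfl | rfl | rfl <;> fin_cases i <;> simp [weight, sgn]

theorem weight_mul (σ τ : Klein) (i : Fin 3) : weight (σ * τ) i = weight σ i * weight τ i := by
  fin_cases i <;> simp [weight, mul_mul_mul_comm]

/-- The elements `x^m σ̄`, for monomials `x^m`, as a basis of the crossed product. -/
def cpBasis (α : TwoCocycle Klein ℂ) : Module.Basis (Klein × (Fin 3 →₀ ℕ)) ℂ (KleinCP α) :=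
  ((Finsupp.basis fun _ : Klein => MvPolynomial.basisMonomials (Fin 3) ℂ).reindex
    (Equiv.sigmaEquivProd _ _) : Module.Basis _ ℂ (Klein →₀ PolyXYZ))

theorem cpBasis_apply (σ : Klein) (m : Fin 3 →₀ ℕ) :
    cpBasis α (σ, m) = single kleinAct α σ (MvPolynomial.monomial m 1) := by
  change ((Finsupp.basis fun _ : Klein => MvPolynomial.basisMonomials (Fin 3) ℂ).reindex
    (Equiv.sigmaEquivProd _ _) : Module.Basis _ ℂ (Klein →₀ PolyXYZ)) (σ, m) =
      Finsupp.single σ (MvPolynomial.monomial m 1)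
  rw [Module.Basis.reindex_apply, Finsupp.coe_basis]
  simp

/-- The crossed product over `ℂ[x, y, z]`, with the Klein four-group. -/
def cpData (α : TwoCocycle Klein ℂ) : KoszulData ℂ (KleinCP α) Klein Klein where
  X i := incl α (MvPolynomial.X i)
  X_comm i j := by rw [← map_mul, mul_comm, map_mul]
  basis := cpBasis α
  X_mul_basis i j m := by
    rw [cpBasis_apply, cpBasis_apply]
    refine co_ext fun σ => ?_
    rw [co_incl_mul, co_single, co_single]
    split_ifs
    · rw [MvPolynomial.X, MvPolynomial.monomial_mul, add_comm, one_mul]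
    · simp
  t := bar α
  t_mul σ τ := ⟨α σ τ, by
    change single kleinAct α σ 1 * single kleinAct α τ 1 = _ • single kleinAct α (σ * τ) 1
    rw [single_mul_single, map_one, mul_one, map_smul]⟩
  w := weight
  w_mul := weight_mul
  w_sq := weight_sq
  w_prod σ := by
    rcases klein_cases σ with rfl | rfl | rfl | rfl <;> simp [weight, sgn]
  t_X σ i := by
    refine co_ext fun τ => ?_
    have h : τ = σ * (σ * τ) := by rw [← mul_assoc, klein_sq, one_mul]
    change co α τ (single kleinAct α σ 1 * incl α _) =
      co α τ (weight σ i • (incl α _ * single kleinAct α σ 1))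
    rw [co_mul_incl, map_smul, co_incl_mul, co_single]
    split_ifs with h
    · rw [← h, kleinAct_X, one_mul, mul_one]
    · simp
  adjoin_eq_top := by
    rw [eq_top_iff]
    rintro u -
    have h1 : ∀ p, incl α p ∈ Algebra.adjoin ℂ
        (Set.range (fun i => incl α (MvPolynomial.X i)) ∪ Set.range fun σ => (bar α σ : KleinCP α)) := by
      intro p
      induction p using MvPolynomial.induction_on with
      | C c =>
        have h : incl α (MvPolynomial.C c) = algebraMap ℂ (KleinCP α) c := (incl α).commutes c
        rw [h]
        exact Subalgebra.algebraMap_mem _ c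
      | add p q hp hq => rw [map_add]; exact add_mem hp hq
      | mul_X p i hp =>
        rw [map_mul]
        exact mul_mem hp (Algebra.subset_adjoin (Or.inl ⟨i, rfl⟩))
    induction (u : Klein →₀ PolyXYZ) using Finsupp.induction_linear with
    | zero => exact zero_mem _
    | add f g hf hg => exact add_mem hf hg
    | single σ p =>
      have h2 : (Finsupp.single σ p : Klein →₀ PolyXYZ) = incl α p * (bar α σ : KleinCP α) := by
        refine co_ext (α := α) fun τ => ?_
        rw [co_incl_mul]
        change co α τ (single kleinAct α σ p) = p * co α τ (single kleinAct α σ 1)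
        rw [co_single, co_single]
        split_ifs <;> simp
      rw [h2]
      exact mul_mem (h1 p) (Algebra.subset_adjoin (Or.inr ⟨σ, rfl⟩))
  card_ne_zero := by simp

end CP

/-! ### Subspaces spanned by monomials -/

section Supports

open MvPolynomial

theorem mem_restrictSupport {N : Set (Fin 3 →₀ ℕ)} {p : PolyXYZ} :
    p ∈ restrictSupport ℂ N ↔ ∀ m, p.coeff m ≠ 0 → m ∈ N := by
  rw [mem_restrictSupport_iff]
  exact ⟨fun h m hm => h (mem_support_iff.2 hm), fun h m hm => h m (mem_support_iff.1 hm)⟩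

theorem monomial_eq_xyz (m : Fin 3 →₀ ℕ) :
    (monomial m 1 : PolyXYZ) = x ^ m 0 * y ^ m 1 * z ^ m 2 := by
  rw [monomial_eq, Finsupp.prod_fintype _ _ (by simp), Fin.prod_univ_three]
  simp

/-- The algebra generated by `s` is spanned by the monomials with exponents in the submonoid `N`, if
`s` lies in their span and each of them is a polynomial in `s`. -/
theorem polysIn_eq_restrictSupport {s : Set PolyXYZ} {N : Set (Fin 3 →₀ ℕ)} (h0 : 0 ∈ N)
    (hadd : ∀ m ∈ N, ∀ n ∈ N, m + n ∈ N) (hs : ∀ p ∈ s, p ∈ restrictSupport ℂ N)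
    (hN : ∀ m ∈ N, x ^ m 0 * y ^ m 1 * z ^ m 2 ∈ Algebra.adjoin ℂ s) :
    polysIn s = restrictSupport ℂ N := by
  apply le_antisymm
  · intro p hp
    induction hp using Algebra.adjoin_induction with
    | mem p hp => exact hs p hp
    | algebraMap c =>
      rw [algebraMap_eq, C_apply, monomial_mem_restrictSupport]
      exact Or.inl h0
    | add p q _ _ hp hq => exact add_mem hp hq
    | mul p q _ _ hp hq =>
      rw [mem_restrictSupport_iff] at *
      intro m hm
      obtain ⟨a, ha, b, hb, rfl⟩ := Finset.mem_add.1 (support_mul p q hm)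
      exact hadd a (hp ha) b (hq hb)
  · rw [restrictSupport_eq_span, Submodule.span_le]
    rintro _ ⟨m, hm, rfl⟩
    change (monomial m 1 : PolyXYZ) ∈ Algebra.adjoin ℂ s
    rw [monomial_eq_xyz]
    exact hN m hm

theorem times_monomial_restrictSupport (e : Fin 3 →₀ ℕ) (N : Set (Fin 3 →₀ ℕ)) :
    times (monomial e 1) (restrictSupport ℂ N) = restrictSupport ℂ ((e + ·) '' N) := by
  rw [times, restrictSupport_eq_span, Submodule.map_span, restrictSupport_eq_span,
    Set.image_image, Set.image_image]
  simp [monomial_mul]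

theorem restrictSupport_sup (N N' : Set (Fin 3 →₀ ℕ)) :
    restrictSupport ℂ N ⊔ restrictSupport ℂ N' = restrictSupport ℂ (N ∪ N') := by
  simp only [restrictSupport_eq_span, Set.image_union, Submodule.span_union]

theorem restrictSupport_inf (N N' : Set (Fin 3 →₀ ℕ)) :
    restrictSupport ℂ N ⊓ restrictSupport ℂ N' = restrictSupport ℂ (N ∩ N') := by
  ext p
  simp only [Submodule.mem_inf, mem_restrictSupport_iff, Set.subset_inter_iff]

/-- The exponents of the powers of the `k`-th variable. -/
def axis (k : Fin 3) : Set (Fin 3 →₀ ℕ) := {m | ∀ i, i ≠ k → m i = 0}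

theorem axis_monomial {k : Fin 3} {m : Fin 3 →₀ ℕ} (hm : m ∈ axis k) :
    x ^ m 0 * y ^ m 1 * z ^ m 2 = (X k : PolyXYZ) ^ m k := by
  have h := fun i => hm i
  fin_cases k
  · have h1 := h 1 (by decide)
    have h2 := h 2 (by decide)
    simp [h1, h2]
  · have h1 := h 0 (by decide)
    have h2 := h 2 (by decide)
    simp [h1, h2]
  · have h1 := h 0 (by decide)
    have h2 := h 1 (by decide)
    simp [h1, h2]

theorem polysIn_X (k : Fin 3) : polysIn {(X k : PolyXYZ)} = restrictSupport ℂ (axis k) := by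
  refine polysIn_eq_restrictSupport (fun _ _ => rfl) ?_ ?_ ?_
  · intro m hm n hn i hi
    simp [hm i hi, hn i hi]
  · rintro p rfl
    rw [X, monomial_mem_restrictSupport]
    exact Or.inl fun i hi => by simp [hi.symm]
  · intro m hm
    rw [axis_monomial hm]
    exact pow_mem (Algebra.subset_adjoin (Set.mem_singleton _)) _

theorem polysIn_X_sq (k : Fin 3) : polysIn {(X k : PolyXYZ) ^ 2} =
    restrictSupport ℂ (axis k ∩ {m | Even (m k)}) := by
  refine polysIn_eq_restrictSupport ⟨fun _ _ => rfl, Even.zero⟩ ?_ ?_ ?_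
  · intro m hm n hn
    exact ⟨fun i hi => by simp [hm.1 i hi, hn.1 i hi], Even.add hm.2 hn.2⟩
  · rintro p rfl
    rw [X_pow_eq_monomial, monomial_mem_restrictSupport]
    exact Or.inl ⟨fun i hi => by simp [hi.symm], by simp⟩
  · intro m hm
    obtain ⟨a, ha⟩ := hm.2
    rw [axis_monomial hm.1, ha, ← two_mul, pow_mul]
    exact pow_mem (Algebra.subset_adjoin (Set.mem_singleton _)) _

theorem times_X_polysIn_X_sq (k : Fin 3) : times (X k) (polysIn {(X k : PolyXYZ) ^ 2}) =
    restrictSupport ℂ (axis k ∩ {m | Odd (m k)}) := by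
  rw [polysIn_X_sq, X, times_monomial_restrictSupport]
  congr 1
  ext m
  constructor
  · rintro ⟨n, hn, rfl⟩
    refine ⟨fun i hi => ?_, ?_⟩
    · simp [hi.symm, hn.1 i hi]
    · have : Even (n k) := hn.2
      simpa [add_comm] using this.add_one
  · rintro ⟨h1, h2⟩
    obtain ⟨a, ha⟩ := h2
    refine ⟨m - Finsupp.single k 1, ⟨fun i hi => ?_, ?_⟩, ?_⟩
    · simp [h1 i hi]
    · simp [ha]
    · ext i
      by_cases hi : k = i
      · subst hi; simp [ha]
      · simp [hi]

theorem polysIn_sq : polysIn {x ^ 2, y ^ 2, z ^ 2} =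
    restrictSupport ℂ {m | Even (m 0) ∧ Even (m 1) ∧ Even (m 2)} := by
  refine polysIn_eq_restrictSupport (by simp) ?_ ?_ ?_
  · intro m hm n hn
    exact ⟨hm.1.add hn.1, hm.2.1.add hn.2.1, hm.2.2.add hn.2.2⟩
  · rintro p (rfl | rfl | rfl) <;> rw [X_pow_eq_monomial, monomial_mem_restrictSupport] <;>
      simp
  · rintro m ⟨⟨a, ha⟩, ⟨b, hb⟩, ⟨c, hc⟩⟩
    rw [ha, hb, hc, ← two_mul, ← two_mul, ← two_mul, pow_mul, pow_mul, pow_mul]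
    exact mul_mem (mul_mem (pow_mem (Algebra.subset_adjoin (by simp)) _)
      (pow_mem (Algebra.subset_adjoin (by simp)) _)) (pow_mem (Algebra.subset_adjoin (by simp)) _)

theorem polysIn_inv : polysIn {x ^ 2, y ^ 2, z ^ 2, x * y * z} =
    restrictSupport ℂ {m | (Even (m 0) ↔ Even (m 1)) ∧ (Even (m 0) ↔ Even (m 2))} := by
  refine polysIn_eq_restrictSupport (by simp) ?_ ?_ ?_
  · rintro m ⟨h1, h2⟩ n ⟨h3, h4⟩
    simp only [Set.mem_ofPred_eq, Finsupp.add_apply, Nat.even_add]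
    tauto
  · rintro p (rfl | rfl | rfl | rfl)
    · rw [X_pow_eq_monomial, monomial_mem_restrictSupport]; simp
    · rw [X_pow_eq_monomial, monomial_mem_restrictSupport]; simp
    · rw [X_pow_eq_monomial, monomial_mem_restrictSupport]; simp
    · change (X 0 * X 1 * X 2 : PolyXYZ) ∈ _
      rw [X, X, X, monomial_mul, monomial_mul, monomial_mem_restrictSupport]
      left
      simp
  · rintro m ⟨h1, h2⟩
    have hx : x ^ 2 ∈ Algebra.adjoin ℂ {x ^ 2, y ^ 2, z ^ 2, x * y * z} :=
      Algebra.subset_adjoin (by simp)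
    have hy : y ^ 2 ∈ Algebra.adjoin ℂ {x ^ 2, y ^ 2, z ^ 2, x * y * z} :=
      Algebra.subset_adjoin (by simp)
    have hz : z ^ 2 ∈ Algebra.adjoin ℂ {x ^ 2, y ^ 2, z ^ 2, x * y * z} :=
      Algebra.subset_adjoin (by simp)
    have hxyz : x * y * z ∈ Algebra.adjoin ℂ {x ^ 2, y ^ 2, z ^ 2, x * y * z} :=
      Algebra.subset_adjoin (by simp)
    have key : ∀ a b c : ℕ, (x ^ 2) ^ a * (y ^ 2) ^ b * (z ^ 2) ^ c ∈
        Algebra.adjoin ℂ {x ^ 2, y ^ 2, z ^ 2, x * y * z} := fun a b c =>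
      mul_mem (mul_mem (pow_mem hx _) (pow_mem hy _)) (pow_mem hz _)
    rcases Nat.even_or_odd' (m 0) with ⟨a, ha | ha⟩
    · have e0 : Even (m 0) := by simp [ha]
      obtain ⟨b, hb⟩ := (h1.1 e0).two_dvd
      obtain ⟨c, hc⟩ := (h2.1 e0).two_dvd
      rw [ha, hb, hc, pow_mul, pow_mul, pow_mul]
      exact key a b c
    · have e0 : ¬ Even (m 0) := by simp [ha]
      obtain ⟨b, hb⟩ := Nat.not_even_iff_odd.1 (fun h => e0 (h1.2 h))
      obtain ⟨c, hc⟩ := Nat.not_even_iff_odd.1 (fun h => e0 (h2.2 h))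
      rw [ha, hb, hc]
      convert mul_mem (key a b c) hxyz using 1
      ring

/-- For square-free monomials with complementary supports, `evenSpan` is spanned by the monomials
whose exponents have the parities of one or the other. -/
theorem evenSpan_eq {e e' : Fin 3 →₀ ℕ} (h : ∀ i, e i + e' i = 1) :
    evenSpan (monomial e 1) (monomial e' 1) = restrictSupport ℂ
      {m | (∀ i, Even (m i) ↔ Even (e i)) ∨ (∀ i, Even (m i) ↔ Even (e' i))} := by
  have key : ∀ e : Fin 3 →₀ ℕ, (∀ i, e i ≤ 1) →
      times (monomial e 1) (polysIn {x ^ 2, y ^ 2, z ^ 2}) =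
        restrictSupport ℂ {m | ∀ i, Even (m i) ↔ Even (e i)} := by
    intro e he
    rw [polysIn_sq, times_monomial_restrictSupport]
    congr 1
    ext m
    constructor
    · rintro ⟨n, ⟨h0, h1, h2⟩, rfl⟩ i
      have hn : Even (n i) := by fin_cases i <;> assumption
      simp [Nat.even_add, hn]
    · intro hm
      have hle : ∀ i, e i ≤ m i := by
        intro i
        have h1 := he i
        have h2 := hm i
        by_contra hlt
        have h3 : e i = 1 := by omega
        have h4 : m i = 0 := by omega
        rw [h3, h4] at h2
        simp at h2
      have hev : ∀ i, Even ((m - e) i) := fun i => by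
        rw [Finsupp.tsub_apply, Nat.even_sub (hle i)]
        exact hm i
      refine ⟨m - e, ⟨hev 0, hev 1, hev 2⟩, ?_⟩
      ext i
      simpa using Nat.add_sub_cancel' (hle i)
  rw [evenSpan, key e (fun i => by have := h i; omega), key e' (fun i => by have := h i; omega),
    restrictSupport_sup]
  rfl

theorem evenSpan_X {i j l : Fin 3} (hij : i ≠ j) (hil : i ≠ l) (hjl : j ≠ l) :
    evenSpan (X i) (X j * X l) = restrictSupport ℂ
      {m | (Even (m j) ↔ Even (m l)) ∧ (Even (m i) ↔ ¬ Even (m j))} := by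
  have h : ∀ n : Fin 3, n = i ∨ n = j ∨ n = l := by
    revert i j l; decide
  rw [X, X, X, monomial_mul, one_mul, evenSpan_eq]
  · congr 1
    ext m
    have hf : ∀ P : Fin 3 → Prop, (∀ n, P n) ↔ P i ∧ P j ∧ P l := fun P =>
      ⟨fun hP => ⟨hP i, hP j, hP l⟩, fun hP n => by
        rcases h n with rfl | rfl | rfl
        exacts [hP.1, hP.2.1, hP.2.2]⟩
    simp only [Set.mem_ofPred_eq, hf, Finsupp.add_apply, Finsupp.single_apply, hij, hil, hjl,
      hij.symm, hil.symm, hjl.symm, if_true, if_false, Nat.not_even_one, Even.zero, zero_add,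
      add_zero]
    tauto
  · intro n
    rcases h n with rfl | rfl | rfl <;> simp [hij, hil, hjl,
      hij.symm, hil.symm, hjl.symm]

/-! ### Two variables form a regular sequence -/

theorem exists_of_X_mul_eq {i j : Fin 3} (hij : i ≠ j) {a b : PolyXYZ}
    (h : X i * a = X j * b) : ∃ c, a = X j * c ∧ b = X i * c := by
  have hd : (X j : PolyXYZ) ∣ X i * a := ⟨b, h⟩
  have hX : ¬ (X j : PolyXYZ) ∣ X i := by
    rw [X_dvd_X]
    simp [hij.symm]
  obtain ⟨c, rfl⟩ := (X_prime (R := ℂ) (i := j)).dvd_or_dvd hd |>.resolve_left hX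
  refine ⟨c, rfl, ?_⟩
  refine mul_left_cancel₀ (X_ne_zero j : (X j : PolyXYZ) ≠ 0) ?_
  rw [← h]
  ring

theorem exists_eq_add {i j l : Fin 3} (hij : i ≠ j) (hil : i ≠ l) (hjl : j ≠ l) (p : PolyXYZ) :
    ∃ q ∈ polysIn {(X l : PolyXYZ)}, ∃ a b, p = q + X i * a + X j * b := by
  have h : ∀ n : Fin 3, n = i ∨ n = j ∨ n = l := by
    revert i j l; decide
  induction p using MvPolynomial.induction_on with
  | C c => exact ⟨C c, Subalgebra.algebraMap_mem _ c, 0, 0, by ring⟩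
  | add p p' hp hp' =>
    obtain ⟨q, hq, a, b, rfl⟩ := hp
    obtain ⟨q', hq', a', b', rfl⟩ := hp'
    exact ⟨q + q', add_mem hq hq', a + a', b + b', by ring⟩
  | mul_X p n hp =>
    obtain ⟨q, hq, a, b, rfl⟩ := hp
    rcases h n with rfl | rfl | rfl
    · exact ⟨0, zero_mem _, q + X n * a + X j * b, 0, by ring⟩
    · exact ⟨0, zero_mem _, 0, q + X i * a + X n * b, by ring⟩
    · exact ⟨q * X n, mul_mem (S := Subalgebra ℂ PolyXYZ) hq
        (Algebra.subset_adjoin (Set.mem_singleton _)),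
        a * X n, b * X n, by ring⟩

theorem eq_zero_of_eq_add {i j l : Fin 3} (hil : i ≠ l) (hjl : j ≠ l)
    {q a b : PolyXYZ} (hq : q ∈ polysIn {(X l : PolyXYZ)}) (h : q = X i * a + X j * b) :
    q = 0 := by
  rw [polysIn_X, mem_restrictSupport] at hq
  ext m
  rw [coeff_zero]
  by_contra hm
  have hm' := hq m hm
  apply hm
  rw [h, coeff_add, mul_comm, mul_comm (X j), coeff_mul_X', coeff_mul_X', if_neg, if_neg, add_zero]
  · simp [hm' j hjl]
  · simp [hm' i hil]

end Supports

/-! ### Sectors of the crossed product -/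

section Sectors

open CrossedProduct

variable {α : TwoCocycle Klein ℂ}

/-- The elements whose coefficients at `1̄`, `ā`, `b̄`, `c̄` lie in the given subspaces. -/
def quad (α : TwoCocycle Klein ℂ) (P Pa Pb Pc : Submodule ℂ PolyXYZ) :
    Submodule ℂ (KleinCP α) :=
  P.comap (co α 1) ⊓ Pa.comap (co α ga) ⊓ Pb.comap (co α gb) ⊓ Pc.comap (co α gc)

theorem mem_quad {P Pa Pb Pc : Submodule ℂ PolyXYZ} {u : KleinCP α} : u ∈ quad α P Pa Pb Pc ↔
    co α 1 u ∈ P ∧ co α ga u ∈ Pa ∧ co α gb u ∈ Pb ∧ co α gc u ∈ Pc := by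
  simp [quad, and_assoc]

theorem ga_ne_one : ga ≠ 1 := by decide
theorem gb_ne_one : gb ≠ 1 := by decide
theorem gc_ne_one : gc ≠ 1 := by decide
theorem ga_ne_gb : ga ≠ gb := by decide
theorem ga_ne_gc : ga ≠ gc := by decide
theorem gb_ne_gc : gb ≠ gc := by decide

theorem forall_klein {p : Klein → Prop} : (∀ σ, p σ) ↔ p 1 ∧ p ga ∧ p gb ∧ p gc :=
  ⟨fun h => ⟨h _, h _, h _, h _⟩, fun h σ => by
    rcases klein_cases σ with rfl | rfl | rfl | rfl
    exacts [h.1, h.2.1, h.2.2.1, h.2.2.2]⟩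

theorem sec_sup_eq_quad (P Pa Pb Pc : Submodule ℂ PolyXYZ) :
    sec α 1 P ⊔ sec α ga Pa ⊔ sec α gb Pb ⊔ sec α gc Pc = quad α P Pa Pb Pc := by
  have hne := And.intro ga_ne_one (And.intro gb_ne_one (And.intro gc_ne_one
    (And.intro ga_ne_gb (And.intro ga_ne_gc gb_ne_gc))))
  apply le_antisymm
  · refine sup_le (sup_le (sup_le ?_ ?_) ?_) ?_ <;> rintro _ ⟨p, hp, rfl⟩ <;> rw [mem_quad] <;>
      simp only [co_single, hne, hne.1.symm, hne.2.1.symm, hne.2.2.1.symm, hne.2.2.2.1.symm,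
        hne.2.2.2.2.1.symm, hne.2.2.2.2.2.symm, if_true, if_false, zero_mem, true_and,
        and_true] <;> exact hp
  · intro u hu
    rw [mem_quad] at hu
    have h : u = single kleinAct α 1 (co α 1 u) + single kleinAct α ga (co α ga u) +
        single kleinAct α gb (co α gb u) + single kleinAct α gc (co α gc u) := by
      refine co_ext fun σ => ?_
      simp only [map_add, co_single]
      rcases klein_cases σ with rfl | rfl | rfl | rfl <;>
      simp only [hne, hne.1.symm, hne.2.1.symm, hne.2.2.1.symm, hne.2.2.2.1.symm,
        hne.2.2.2.2.1.symm, hne.2.2.2.2.2.symm, if_true, if_false, add_zero, zero_add]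
    rw [h]
    exact Submodule.add_mem_sup (Submodule.add_mem_sup (Submodule.add_mem_sup
      ⟨_, hu.1, rfl⟩ ⟨_, hu.2.1, rfl⟩) ⟨_, hu.2.2.1, rfl⟩) ⟨_, hu.2.2.2, rfl⟩

theorem sec_bot (σ : Klein) : sec α σ ⊥ = ⊥ := Submodule.map_bot _

theorem sec_one_eq_quad (P : Submodule ℂ PolyXYZ) : sec α 1 P = quad α P ⊥ ⊥ ⊥ := by
  simp [← sec_sup_eq_quad, sec_bot]

theorem sec_ga_eq_quad (P Pa : Submodule ℂ PolyXYZ) :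
    sec α 1 P ⊔ sec α ga Pa = quad α P Pa ⊥ ⊥ := by
  simp [← sec_sup_eq_quad, sec_bot]

theorem sec_gb_eq_quad (P Pb : Submodule ℂ PolyXYZ) :
    sec α 1 P ⊔ sec α gb Pb = quad α P ⊥ Pb ⊥ := by
  simp [← sec_sup_eq_quad, sec_bot]

theorem sec_gc_eq_quad (P Pc : Submodule ℂ PolyXYZ) :
    sec α 1 P ⊔ sec α gc Pc = quad α P ⊥ ⊥ Pc := by
  simp [← sec_sup_eq_quad, sec_bot]

theorem mem_columns {V : Type*} [AddCommGroup V] [Module ℂ V] {S T U : Submodule ℂ V}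
    {v : Fin 3 → V} : v ∈ columns S T U ↔ v 0 ∈ S ∧ v 1 ∈ T ∧ v 2 ∈ U := by
  simp [columns, Submodule.mem_pi, Fin.forall_fin_succ]

/-! ### Koszul cohomology of the crossed product -/

/-- On `R σ̄`, commutation with the `i`-th variable is multiplication by `dw σ i` times it. -/
def dw (σ : Klein) (i : Fin 3) : PolyXYZ := MvPolynomial.C (1 - weight σ i)

theorem co_ad (σ : Klein) (i : Fin 3) (u : KleinCP α) :
    co α σ (ad α (MvPolynomial.X i) u) = dw σ i * (MvPolynomial.X i * co α σ u) := by
  have : ad α (MvPolynomial.X i) u = incl α (MvPolynomial.X i) * u -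
    u * incl α (MvPolynomial.X i) := rfl
  rw [this, map_sub, co_incl_mul, co_mul_incl, kleinAct_X, dw, MvPolynomial.smul_eq_C_mul,
    map_sub, map_one]
  ring

theorem dw_one (i : Fin 3) : dw 1 i = 0 := by
  fin_cases i <;> simp [dw, weight]

theorem two_eq_C : MvPolynomial.C (1 - -1) = (2 : PolyXYZ) := by
  have h : (1 - -1 : ℂ) = 2 := by norm_num
  rw [h]
  exact map_ofNat _ 2

theorem dw_ga : dw ga 0 = 2 ∧ dw ga 1 = 0 ∧ dw ga 2 = 2 := by
  refine ⟨?_, ?_, ?_⟩ <;> simp [dw, weight, sgn, ← two_eq_C]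

theorem dw_gb : dw gb 0 = 2 ∧ dw gb 1 = 2 ∧ dw gb 2 = 0 := by
  refine ⟨?_, ?_, ?_⟩ <;> simp [dw, weight, sgn, ← two_eq_C]

theorem dw_gc : dw gc 0 = 0 ∧ dw gc 1 = 2 ∧ dw gc 2 = 2 := by
  refine ⟨?_, ?_, ?_⟩ <;> simp [dw, weight, sgn, ← two_eq_C]

theorem exists_two_mul : ∃ h : PolyXYZ, 2 * h = 1 :=
  ⟨MvPolynomial.C (1 / 2), by
    rw [← two_eq_C, ← map_mul]; norm_num⟩

theorem koszul1_apply (u : KleinCP α) :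
    koszul1 α u = fun i => ad α (MvPolynomial.X i) u := by
  funext i; fin_cases i <;> rfl

theorem koszul2_apply (v : Fin 3 → KleinCP α) : koszul2 α v =
    ![-ad α z (v 0) + ad α x (v 2), -ad α z (v 1) + ad α y (v 2),
      -ad α y (v 0) + ad α x (v 1)] := by
  funext i; fin_cases i <;> rfl

theorem koszul3_apply (v : Fin 3 → KleinCP α) :
    koszul3 α v = -ad α y (v 0) + ad α x (v 1) + ad α z (v 2) := rfl

theorem mem_ker_koszul1 (u : KleinCP α) : koszul1 α u = 0 ↔
    ∀ σ, ∀ i, dw σ i * (MvPolynomial.X i * co α σ u) = 0 := by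
  rw [koszul1_apply, funext_iff, forall_comm]
  refine forall_congr' fun i => ?_
  simp only [← co_ad]
  exact ⟨fun h σ => by rw [h]; exact map_zero _, fun h => co_ext fun σ => by
    rw [h]; exact (map_zero _).symm⟩

theorem mem_ker_koszul2 (v : Fin 3 → KleinCP α) : koszul2 α v = 0 ↔
    ∀ σ, -(dw σ 2 * (z * co α σ (v 0))) + dw σ 0 * (x * co α σ (v 2)) = 0 ∧
      -(dw σ 2 * (z * co α σ (v 1))) + dw σ 1 * (y * co α σ (v 2)) = 0 ∧
      -(dw σ 1 * (y * co α σ (v 0))) + dw σ 0 * (x * co α σ (v 1)) = 0 := by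
  rw [koszul2_apply]
  simp only [← co_ad, ← map_add, ← map_neg, forall_and]
  have h : ∀ u : KleinCP α, (∀ σ, co α σ u = 0) ↔ u = 0 := fun u =>
    ⟨fun h => co_ext fun σ => by rw [h]; exact (map_zero _).symm, fun h σ => by
      rw [h]; exact map_zero _⟩
  rw [h, h, h]
  exact ⟨fun h => ⟨congrFun h 0, congrFun h 1, congrFun h 2⟩, fun h => by
    funext i; fin_cases i; exacts [h.1, h.2.1, h.2.2]⟩

theorem mem_ker_koszul3 (v : Fin 3 → KleinCP α) : koszul3 α v = 0 ↔
    ∀ σ, -(dw σ 1 * (y * co α σ (v 0))) + dw σ 0 * (x * co α σ (v 1)) +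
      dw σ 2 * (z * co α σ (v 2)) = 0 := by
  rw [koszul3_apply]
  simp only [← co_ad, ← map_add, ← map_neg]
  exact ⟨fun h σ => by rw [h]; exact map_zero _, fun h => co_ext fun σ => by
    rw [h]; exact (map_zero _).symm⟩

theorem two_mul_X_mul_eq_zero {i : Fin 3} {p : PolyXYZ}
    (h : 2 * (MvPolynomial.X i * p) = 0) : p = 0 := by
  simpa [MvPolynomial.X_ne_zero] using h

theorem ker_koszul1 : LinearMap.ker (koszul1 α) = sec α 1 ⊤ := by
  ext u
  rw [LinearMap.mem_ker, mem_ker_koszul1, sec_one_eq_quad, mem_quad, forall_klein]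
  simp only [dw_one, zero_mul, implies_true, true_and, Submodule.mem_top, Submodule.mem_bot]
  constructor
  · rintro ⟨ha, hb, hc⟩
    refine ⟨two_mul_X_mul_eq_zero (i := 0) ?_, two_mul_X_mul_eq_zero (i := 0) ?_,
      two_mul_X_mul_eq_zero (i := 1) ?_⟩
    · rw [← dw_ga.1]; exact ha 0
    · rw [← dw_gb.1]; exact hb 0
    · rw [← dw_gc.2.1]; exact hc 1
  · rintro ⟨ha, hb, hc⟩
    simp [-Prod.mk_mul_mk, ha, hb, hc]

theorem koszul2_koszul1 (u : KleinCP α) : koszul2 α (koszul1 α u) = 0 := by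
  rw [mem_ker_koszul2]
  intro σ
  simp only [koszul1_apply, co_ad]
  refine ⟨?_, ?_, ?_⟩ <;> ring

theorem koszul3_koszul2 (v : Fin 3 → KleinCP α) : koszul3 α (koszul2 α v) = 0 := by
  rw [mem_ker_koszul3]
  intro σ
  simp only [koszul2_apply, Matrix.cons_val_zero, Matrix.cons_val_one, Matrix.cons_val, map_add,
    map_neg, co_ad]
  ring

theorem koszul_representatives_one :
    IsSpaceOfRepresentatives (LinearMap.ker (koszul2 α)) (LinearMap.range (koszul1 α))
      (columns (sec α 1 ⊤) (sec α 1 ⊤) (sec α 1 ⊤)) := by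
  have hW : ∀ v : Fin 3 → KleinCP α, v ∈ columns (sec α 1 ⊤) (sec α 1 ⊤) (sec α 1 ⊤) ↔
      ∀ i, co α ga (v i) = 0 ∧ co α gb (v i) = 0 ∧ co α gc (v i) = 0 := by
    intro v
    simp [-Prod.mk_mul_mk, mem_columns, sec_one_eq_quad, mem_quad, Fin.forall_fin_succ]
  refine ⟨le_antisymm (sup_le ?_ ?_) ?_, ?_⟩
  · intro v hv
    rw [hW] at hv
    rw [LinearMap.mem_ker, mem_ker_koszul2, forall_klein]
    simp [-Prod.mk_mul_mk, hv, dw_one]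
  · rintro _ ⟨u, rfl⟩
    exact koszul2_koszul1 u
  · intro v hv
    rw [LinearMap.mem_ker, mem_ker_koszul2] at hv
    obtain ⟨h, hh⟩ := exists_two_mul
    obtain ⟨a0, a1, a2⟩ := hv ga
    obtain ⟨b0, b1, b2⟩ := hv gb
    obtain ⟨c0, c1, c2⟩ := hv gc
    simp only [dw_ga, dw_gb, dw_gc, zero_mul, add_zero, neg_zero, zero_add, neg_eq_zero]
      at a0 a1 a2 b0 b1 b2 c0 c1 c2
    -- in each nontrivial sector one component vanishes, and the other two are multiples of one
    -- polynomial because two variables form a regular sequence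
    obtain ⟨pa, ha0, ha2⟩ := exists_of_X_mul_eq (i := 2) (j := 0) (by decide)
      (a := co α ga (v 0)) (b := co α ga (v 2)) (by
        linear_combination -h * a0 - (z * co α ga (v 0) - x * co α ga (v 2)) * hh)
    obtain ⟨pb, hb0, hb1⟩ := exists_of_X_mul_eq (i := 1) (j := 0) (by decide)
      (a := co α gb (v 0)) (b := co α gb (v 1)) (by
        linear_combination -h * b2 - (y * co α gb (v 0) - x * co α gb (v 1)) * hh)
    obtain ⟨pc, hc1, hc2⟩ := exists_of_X_mul_eq (i := 2) (j := 1) (by decide)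
      (a := co α gc (v 1)) (b := co α gc (v 2)) (by
        linear_combination -h * c1 - (z * co α gc (v 1) - y * co α gc (v 2)) * hh)
    have ha1 := two_mul_X_mul_eq_zero (i := 2) a1
    have hb2 := two_mul_X_mul_eq_zero (i := 0) b0
    have hc0 := two_mul_X_mul_eq_zero (i := 2) c0
    obtain ⟨u, hu⟩ := exists_co_eq (α := α) fun σ =>
      if σ = ga then h * pa else if σ = gb then h * pb else h * pc
    have hua : co α ga u = h * pa := by rw [hu, if_pos rfl]
    have hub : co α gb u = h * pb := by rw [hu, if_neg ga_ne_gb.symm, if_pos rfl]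
    have huc : co α gc u = h * pc := by rw [hu, if_neg ga_ne_gc.symm, if_neg gb_ne_gc.symm]
    refine Submodule.mem_sup.2 ⟨v - koszul1 α u, ?_, koszul1 α u, ⟨u, rfl⟩, sub_add_cancel _ _⟩
    rw [hW, koszul1_apply, Fin.forall_fin_succ, Fin.forall_fin_succ, Fin.forall_fin_one]
    simp only [Pi.sub_apply, map_sub, co_ad, Fin.succ_zero_eq_one, Fin.succ_one_eq_two,
      dw_ga, dw_gb, dw_gc, hua, hub, huc, ha0, ha1, ha2, hb0, hb1, hb2, hc0, hc1, hc2, zero_mul,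
      sub_zero, true_and, and_true]
    refine ⟨⟨?_, ?_⟩, ⟨?_, ?_⟩, ?_, ?_⟩
    · linear_combination -(x * pa) * hh
    · linear_combination -(x * pb) * hh
    · linear_combination -(y * pb) * hh
    · linear_combination -(y * pc) * hh
    · linear_combination -(z * pa) * hh
    · linear_combination -(z * pc) * hh
  · rw [eq_bot_iff]
    rintro v ⟨hv, u, rfl⟩
    rw [SetLike.mem_coe, hW] at hv
    rw [Submodule.mem_bot]
    funext i
    refine co_ext fun σ => ?_
    rcases klein_cases σ with rfl | rfl | rfl | rfl
    · simp [-Prod.mk_mul_mk, koszul1_apply, co_ad, dw_one]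
    · simpa using (hv i).1
    · simpa using (hv i).2.1
    · simpa using (hv i).2.2

theorem koszul_representatives_two :
    IsSpaceOfRepresentatives (LinearMap.ker (koszul3 α)) (LinearMap.range (koszul2 α))
      (columns (sec α 1 ⊤ ⊔ sec α ga (polysIn {y})) (sec α 1 ⊤ ⊔ sec α gc (polysIn {x}))
        (sec α 1 ⊤ ⊔ sec α gb (polysIn {z}))) := by
  have hW : ∀ v : Fin 3 → KleinCP α, v ∈ columns (sec α 1 ⊤ ⊔ sec α ga (polysIn {y}))
      (sec α 1 ⊤ ⊔ sec α gc (polysIn {x})) (sec α 1 ⊤ ⊔ sec α gb (polysIn {z})) ↔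
      (co α ga (v 0) ∈ polysIn {y} ∧ co α gb (v 0) = 0 ∧ co α gc (v 0) = 0) ∧
      (co α ga (v 1) = 0 ∧ co α gb (v 1) = 0 ∧ co α gc (v 1) ∈ polysIn {x}) ∧
      (co α ga (v 2) = 0 ∧ co α gb (v 2) ∈ polysIn {z} ∧ co α gc (v 2) = 0) := by
    intro v
    simp [-Prod.mk_mul_mk, mem_columns, sec_ga_eq_quad, sec_gb_eq_quad, sec_gc_eq_quad, mem_quad]
  refine ⟨le_antisymm (sup_le ?_ ?_) ?_, ?_⟩
  · intro v hv
    rw [hW] at hv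
    rw [LinearMap.mem_ker, mem_ker_koszul3, forall_klein]
    simp [-Prod.mk_mul_mk, hv, dw_one, dw_ga, dw_gb, dw_gc]
  · rintro _ ⟨u, rfl⟩
    exact koszul3_koszul2 u
  · intro v hv
    rw [LinearMap.mem_ker, mem_ker_koszul3] at hv
    obtain ⟨h, hh⟩ := exists_two_mul
    -- in the sector of a nontrivial `σ` only the two variables negated by `σ` have nonzero
    -- commutators: the cocycle condition relates two components through a common multiple, and the
    -- third is reduced modulo these variables
    have a := hv ga
    have b := hv gb
    have c := hv gc
    simp only [dw_ga, dw_gb, dw_gc, zero_mul, add_zero, neg_zero, zero_add] at a b c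
    obtain ⟨pa, ha1, ha2⟩ := exists_of_X_mul_eq (i := 0) (j := 2) (by decide)
      (a := co α ga (v 1)) (b := -co α ga (v 2)) (by
        linear_combination h * a - (x * co α ga (v 1) + z * co α ga (v 2)) * hh)
    obtain ⟨pb, hb0, hb1⟩ := exists_of_X_mul_eq (i := 1) (j := 0) (by decide)
      (a := co α gb (v 0)) (b := co α gb (v 1)) (by
        linear_combination -h * b - (y * co α gb (v 0) - x * co α gb (v 1)) * hh)
    obtain ⟨pc, hc0, hc2⟩ := exists_of_X_mul_eq (i := 1) (j := 2) (by decide)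
      (a := co α gc (v 0)) (b := co α gc (v 2)) (by
        linear_combination -h * c - (y * co α gc (v 0) - z * co α gc (v 2)) * hh)
    replace ha2 := neg_eq_iff_eq_neg.1 ha2
    obtain ⟨qa, hqa, ra, sa, ha0⟩ := exists_eq_add (i := 0) (j := 2) (l := 1) (by decide)
      (by decide) (by decide) (co α ga (v 0))
    obtain ⟨qb, hqb, rb, sb, hb2⟩ := exists_eq_add (i := 0) (j := 1) (l := 2) (by decide)
      (by decide) (by decide) (co α gb (v 2))
    obtain ⟨qc, hqc, rc, sc, hc1⟩ := exists_eq_add (i := 1) (j := 2) (l := 0) (by decide)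
      (by decide) (by decide) (co α gc (v 1))
    choose u hu using fun i : Fin 3 => exists_co_eq (α := α) fun σ =>
      if σ = ga then h * ![-sa, -pa, ra] i else
        if σ = gb then h * ![-sb, rb, pb] i else h * ![-pc, -sc, rc] i
    have hua : ∀ i, co α ga (u i) = h * ![-sa, -pa, ra] i := fun i => by rw [hu, if_pos rfl]
    have hub : ∀ i, co α gb (u i) = h * ![-sb, rb, pb] i := fun i => by
      rw [hu, if_neg ga_ne_gb.symm, if_pos rfl]
    have huc : ∀ i, co α gc (u i) = h * ![-pc, -sc, rc] i := fun i => by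
      rw [hu, if_neg ga_ne_gc.symm, if_neg gb_ne_gc.symm]
    refine Submodule.mem_sup.2 ⟨v - koszul2 α u, ?_, koszul2 α u, ⟨u, rfl⟩, sub_add_cancel _ _⟩
    rw [hW, koszul2_apply]
    simp only [Pi.sub_apply, map_sub, map_add, map_neg, co_ad, Matrix.cons_val_zero,
      Matrix.cons_val_one, Matrix.cons_val, dw_ga, dw_gb, dw_gc, hua, hub, huc, ha0, ha1, ha2,
      hb0, hb1, hb2, hc0, hc1, hc2, zero_mul, neg_zero, zero_add, add_zero]
    refine ⟨⟨?_, ?_, ?_⟩, ⟨?_, ?_, ?_⟩, ⟨?_, ?_, ?_⟩⟩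
    · convert hqa using 1
      linear_combination -(z * sa + x * ra) * hh
    · linear_combination -(x * pb) * hh
    · linear_combination -(z * pc) * hh
    · linear_combination -(z * pa) * hh
    · linear_combination -(y * pb) * hh
    · convert hqc using 1
      linear_combination -(z * sc + y * rc) * hh
    · linear_combination (x * pa) * hh
    · convert hqb using 1
      linear_combination -(y * sb + x * rb) * hh
    · linear_combination -(y * pc) * hh
  · rw [eq_bot_iff]
    rintro v ⟨hv, u, rfl⟩
    rw [SetLike.mem_coe, hW] at hv
    obtain ⟨⟨a0, b0, c0⟩, ⟨a1, b1, c1⟩, a2, b2, c2⟩ := hv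
    have a0' : co α ga (koszul2 α u 0) = 0 :=
      eq_zero_of_eq_add (i := 0) (j := 2) (l := 1) (by decide) (by decide) a0
        (a := 2 * co α ga (u 2)) (b := -2 * co α ga (u 0)) (by
          simp [-Prod.mk_mul_mk, koszul2_apply, co_ad, dw_ga]; ring)
    have b2' : co α gb (koszul2 α u 2) = 0 :=
      eq_zero_of_eq_add (i := 0) (j := 1) (l := 2) (by decide) (by decide) b2
        (a := 2 * co α gb (u 1)) (b := -2 * co α gb (u 0)) (by
          simp [-Prod.mk_mul_mk, koszul2_apply, co_ad, dw_gb]; ring)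
    have c1' : co α gc (koszul2 α u 1) = 0 :=
      eq_zero_of_eq_add (i := 1) (j := 2) (l := 0) (by decide) (by decide) c1
        (a := 2 * co α gc (u 2)) (b := -2 * co α gc (u 1)) (by
          simp [-Prod.mk_mul_mk, koszul2_apply, co_ad, dw_gc]; ring)
    rw [Submodule.mem_bot]
    funext i
    refine co_ext fun σ => ?_
    rw [Pi.zero_apply, map_zero]
    rcases klein_cases σ with rfl | rfl | rfl | rfl
    · fin_cases i <;> simp [-Prod.mk_mul_mk, koszul2_apply, co_ad, dw_one]
    · fin_cases i
      exacts [a0', a1, a2]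
    · fin_cases i
      exacts [b0, b1, b2']
    · fin_cases i
      exacts [c0, c1', c2]

theorem koszul_representatives_three :
    IsSpaceOfRepresentatives ⊤ (LinearMap.range (koszul3 α))
      (sec α 1 ⊤ ⊔ sec α ga (polysIn {y}) ⊔ sec α gb (polysIn {z}) ⊔
        sec α gc (polysIn {x})) := by
  rw [sec_sup_eq_quad]
  refine ⟨eq_top_iff.2 ?_, ?_⟩
  · intro v _
    obtain ⟨h, hh⟩ := exists_two_mul
    obtain ⟨qa, hqa, ra, sa, ha⟩ := exists_eq_add (i := 0) (j := 2) (l := 1) (by decide)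
      (by decide) (by decide) (co α ga v)
    obtain ⟨qb, hqb, rb, sb, hb⟩ := exists_eq_add (i := 0) (j := 1) (l := 2) (by decide)
      (by decide) (by decide) (co α gb v)
    obtain ⟨qc, hqc, rc, sc, hc⟩ := exists_eq_add (i := 1) (j := 2) (l := 0) (by decide)
      (by decide) (by decide) (co α gc v)
    choose u hu using fun i : Fin 3 => exists_co_eq (α := α) fun σ =>
      if σ = ga then h * ![0, ra, sa] i else
        if σ = gb then h * ![-sb, rb, 0] i else h * ![-rc, 0, sc] i
    have hua : ∀ i, co α ga (u i) = h * ![0, ra, sa] i := fun i => by rw [hu, if_pos rfl]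
    have hub : ∀ i, co α gb (u i) = h * ![-sb, rb, 0] i := fun i => by
      rw [hu, if_neg ga_ne_gb.symm, if_pos rfl]
    have huc : ∀ i, co α gc (u i) = h * ![-rc, 0, sc] i := fun i => by
      rw [hu, if_neg ga_ne_gc.symm, if_neg gb_ne_gc.symm]
    refine Submodule.mem_sup.2 ⟨v - koszul3 α u, ?_, koszul3 α u, ⟨u, rfl⟩, sub_add_cancel _ _⟩
    rw [mem_quad, koszul3_apply]
    simp only [map_sub, map_add, map_neg, co_ad, Matrix.cons_val_zero, Matrix.cons_val_one,
      Matrix.cons_val, dw_ga, dw_gb, dw_gc, hua, hub, huc, ha, hb, hc, zero_mul, neg_zero,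
      zero_add, add_zero]
    refine ⟨Submodule.mem_top, ?_, ?_, ?_⟩
    · convert hqa using 1
      linear_combination -(x * ra + z * sa) * hh
    · convert hqb using 1
      linear_combination -(x * rb + y * sb) * hh
    · convert hqc using 1
      linear_combination -(y * rc + z * sc) * hh
  · rw [eq_bot_iff]
    rintro v ⟨hv, u, rfl⟩
    rw [SetLike.mem_coe, mem_quad] at hv
    obtain ⟨-, a, b, c⟩ := hv
    have a' : co α ga (koszul3 α u) = 0 :=
      eq_zero_of_eq_add (i := 0) (j := 2) (l := 1) (by decide) (by decide) a
        (a := 2 * co α ga (u 1)) (b := 2 * co α ga (u 2)) (by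
          simp [-Prod.mk_mul_mk, koszul3_apply, co_ad, dw_ga]; ring)
    have b' : co α gb (koszul3 α u) = 0 :=
      eq_zero_of_eq_add (i := 0) (j := 1) (l := 2) (by decide) (by decide) b
        (a := 2 * co α gb (u 1)) (b := -2 * co α gb (u 0)) (by
          simp [-Prod.mk_mul_mk, koszul3_apply, co_ad, dw_gb]; ring)
    have c' : co α gc (koszul3 α u) = 0 :=
      eq_zero_of_eq_add (i := 1) (j := 2) (l := 0) (by decide) (by decide) c
        (a := -2 * co α gc (u 0)) (b := 2 * co α gc (u 2)) (by
          simp [-Prod.mk_mul_mk, koszul3_apply, co_ad, dw_gc]; ring)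
    rw [Submodule.mem_bot]
    refine co_ext fun σ => ?_
    rw [map_zero]
    rcases klein_cases σ with rfl | rfl | rfl | rfl
    · simp [-Prod.mk_mul_mk, koszul3_apply, co_ad, dw_one]
    · exact a'
    · exact b'
    · exact c'

end Sectors

/-! ### The commutator of a two-cocycle -/

section Commutator

open CrossedProduct

variable (α : TwoCocycle Klein ℂ)

/-- The scalar with `σ̄ τ̄ = cm σ τ · τ̄ σ̄`. -/
def cm (σ τ : Klein) : ℂ := (α σ τ : ℂ) / (α τ σ : ℂ)

theorem cm_mul_left (ρ σ τ : Klein) : cm α (ρ * σ) τ = cm α ρ τ * cm α σ τ := by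
  have h1 := congrArg Units.val (α.cocycle ρ σ τ)
  have h2 := congrArg Units.val (α.cocycle τ ρ σ)
  have h3 := congrArg Units.val (α.cocycle ρ τ σ)
  rw [mul_comm τ σ] at h3
  rw [mul_comm τ ρ] at h2
  push_cast at h1 h2 h3
  rw [cm, cm, cm, div_mul_div_comm, div_eq_div_iff (Units.ne_zero _)
    (mul_ne_zero (Units.ne_zero _) (Units.ne_zero _))]
  refine mul_left_cancel₀ (Units.ne_zero (α ρ σ)) ?_
  linear_combination -((α τ ρ : ℂ) * α τ σ) * h1 + (α σ τ : ℂ) * α τ ρ * h3 -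
    (α ρ τ : ℂ) * α σ τ * h2

theorem cm_self (σ : Klein) : cm α σ σ = 1 := div_self (Units.ne_zero _)

theorem cm_inv (σ τ : Klein) : (cm α σ τ)⁻¹ = cm α τ σ := inv_div _ _

theorem cm_one_left (τ : Klein) : cm α 1 τ = 1 := by
  rw [cm, cocycle_one_left α τ, cocycle_one_right α τ]
  exact div_self (α 1 1).ne_zero

theorem cm_one_right (τ : Klein) : cm α τ 1 = 1 := by
  rw [← cm_inv, cm_one_left, inv_one]

theorem cm_sq (σ τ : Klein) : cm α σ τ * cm α σ τ = 1 := by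
  rw [← cm_mul_left, klein_sq, cm_one_left]

theorem cm_comm (σ τ : Klein) : cm α σ τ = cm α τ σ := by
  rw [← cm_inv α σ τ]
  exact eq_inv_of_mul_eq_one_left (cm_sq α σ τ)

theorem cm_gc : cm α ga gc = cm α gb ga ∧ cm α gb gc = cm α gb ga := by
  rw [cm_comm α ga gc, cm_comm α gb gc, cm_mul_left, cm_mul_left, cm_self, cm_self, one_mul,
    mul_one, cm_comm α ga gb]
  exact ⟨rfl, rfl⟩

theorem cm_of_isTrivial (h : α.IsTrivial) : cm α gb ga = 1 := by
  obtain ⟨β, hβ⟩ := h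
  rw [cm, hβ gb ga, hβ ga gb, mul_comm (β ga), mul_comm ga gb]
  exact div_self (Units.ne_zero _)

variable {α}

/-- The cocycle relations determine a cocycle by the values normalised here. -/
theorem eq_one_of_normalized {α : TwoCocycle Klein ℂ} (h1 : α 1 1 = 1) (haa : α ga ga = 1)
    (hbb : α gb gb = 1) (hab : α ga gb = 1) (hba : α gb ga = 1) (σ τ : Klein) : α σ τ = 1 := by
  have l : ∀ τ, α 1 τ = 1 := fun τ => (cocycle_one_left α τ).trans h1
  have r : ∀ τ, α τ 1 = 1 := fun τ => (cocycle_one_right α τ).trans h1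
  have hac : α ga gc = 1 := by simpa only [klein_sq, haa, hab, l, one_mul] using α.cocycle ga ga gb
  have hcb : α gc gb = 1 := by
    simpa only [klein_sq, hbb, hab, r, one_mul] using (α.cocycle ga gb gb).symm
  have hca : α gc ga = 1 := by
    have := (α.cocycle gb ga ga).symm
    rw [mul_comm gb ga] at this
    simpa only [klein_sq, haa, hba, r, one_mul] using this
  have hbc : α gb gc = 1 := by
    have := α.cocycle gb gb ga
    rw [mul_comm gb ga] at this
    simpa only [klein_sq, hbb, hba, l, one_mul] using this
  have hcc : α gc gc = 1 := by
    have := (α.cocycle ga gb gc).symm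
    have e : gb * gc = ga := by decide
    rw [e] at this
    simpa only [hab, hbc, haa, one_mul] using this
  rcases klein_cases σ with rfl | rfl | rfl | rfl
  · exact l τ
  all_goals
    rcases klein_cases τ with rfl | rfl | rfl | rfl
    · exact r _
    all_goals assumption

/-- A cocycle whose commutator is trivial is a coboundary: square roots in `ℂ` normalise it. -/
theorem isTrivial_of_cm (h : cm α gb ga = 1) : α.IsTrivial := by
  have hsqrt : ∀ c : ℂˣ, ∃ d : ℂˣ, d * d = c := by
    intro c
    obtain ⟨d, hd⟩ := IsAlgClosed.exists_pow_nat_eq (c : ℂ) (n := 2) (by norm_num)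
    have hd0 : d ≠ 0 := by
      rintro rfl
      exact c.ne_zero (by rw [← hd]; norm_num)
    exact ⟨Units.mk0 d hd0, Units.ext (by simpa [sq] using hd)⟩
  have hba : α gb ga = α ga gb := Units.ext ((div_eq_one_iff_eq (Units.ne_zero _)).1 h)
  obtain ⟨βa, ha⟩ := hsqrt (α ga ga * α 1 1)
  obtain ⟨βb, hb⟩ := hsqrt (α gb gb * α 1 1)
  let β : Klein → ℂˣ := fun σ => if σ = 1 then α 1 1 else if σ = ga then βa else
    if σ = gb then βb else βa * βb * (α ga gb)⁻¹
  have b1 : β 1 = α 1 1 := if_pos rfl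
  have b2 : β ga = βa := by simp only [β, ga_ne_one, if_true, if_false]
  have b3 : β gb = βb := by simp only [β, gb_ne_one, ga_ne_gb.symm, if_true, if_false]
  have b4 : β gc = βa * βb * (α ga gb)⁻¹ := by
    simp only [β, gc_ne_one, ga_ne_gc.symm, gb_ne_gc.symm, if_false]
  let α' : TwoCocycle Klein ℂ :=
    { toFun := fun σ τ => α σ τ * (β σ * β τ * (β (σ * τ))⁻¹)⁻¹
      cocycle := fun ρ σ τ => by
        have h := α.cocycle ρ σ τ
        have h' := congrArg Units.val h
        rw [mul_assoc ρ σ τ]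
        refine Units.ext ?_
        push_cast at h' ⊢
        field_simp
        exact h' }
  have key : ∀ σ τ, α' σ τ = 1 := by
    refine eq_one_of_normalized ?_ ?_ ?_ ?_ ?_
    · change α 1 1 * (β 1 * β 1 * (β (1 * 1))⁻¹)⁻¹ = 1
      rw [mul_one, b1]; simp
    · change α ga ga * (β ga * β ga * (β (ga * ga))⁻¹)⁻¹ = 1
      rw [klein_sq, b1, b2, ha]; simp
    · change α gb gb * (β gb * β gb * (β (gb * gb))⁻¹)⁻¹ = 1
      rw [klein_sq, b1, b3, hb]; simp
    · change α ga gb * (β ga * β gb * (β gc)⁻¹)⁻¹ = 1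
      rw [b2, b3, b4]
      refine Units.ext ?_
      push_cast
      field_simp
    · change α gb ga * (β gb * β ga * (β (gb * ga))⁻¹)⁻¹ = 1
      rw [mul_comm gb ga, b2, b3, b4, hba, mul_comm βb]
      refine Units.ext ?_
      push_cast
      field_simp
  exact ⟨β, fun σ τ => mul_inv_eq_one.1 (key σ τ)⟩

theorem cm_of_not_isTrivial (h : ¬ α.IsTrivial) : cm α gb ga = -1 := by
  have h1 := cm_sq α gb ga
  rcases mul_self_eq_one_iff.1 h1 with h2 | h2
  · exact absurd (isTrivial_of_cm h2) h
  · exact h2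

end Commutator

/-! ### Invariants in the crossed product -/

section Invariants

open CrossedProduct MvPolynomial

variable {α : TwoCocycle Klein ℂ}

/-- The crossed product as a bimodule over itself. -/
abbrev selfBimod (α : TwoCocycle Klein ℂ) : Bimod ℂ (KleinCP α) (KleinCP α) :=
  Bimod.ofAlgHom (AlgHom.id ℂ (KleinCP α))

theorem co_conj (σ τ : Klein) (u : KleinCP α) :
    co α σ ((cpData α).conj (selfBimod α) τ u) = cm α τ σ • kleinAct τ (co α σ u) := by
  have h := ((cpData α).conj_eq_iff (selfBimod α) τ u _).1 rfl
  have h' : single kleinAct α τ 1 * u =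
      (cpData α).conj (selfBimod α) τ u * single kleinAct α τ 1 := h
  have h2 := congrArg (co α (τ * σ)) h'
  rw [co_single_mul, co_mul_single, one_mul, map_one, mul_one] at h2
  rw [cm, div_eq_inv_mul, ← smul_smul, h2, smul_smul, inv_mul_cancel₀ (Units.ne_zero _), one_smul]

theorem wt_mul (σ τ : Klein) (m : Fin 3 →₀ ℕ) : wt (σ * τ) m = wt σ m * wt τ m := by
  simp only [wt, weight_mul, mul_pow, Finset.prod_mul_distrib]

theorem wt_one (m : Fin 3 →₀ ℕ) : wt 1 m = 1 := by
  have h : ∀ i, weight 1 i = 1 := fun i => by fin_cases i <;> simp [weight]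
  simp [wt, h]

theorem weight_ga : weight ga 0 = -1 ∧ weight ga 1 = 1 ∧ weight ga 2 = -1 := by
  simp [weight, sgn]

theorem weight_gb : weight gb 0 = -1 ∧ weight gb 1 = -1 ∧ weight gb 2 = 1 := by
  simp [weight, sgn]

theorem wt_ga (m : Fin 3 →₀ ℕ) : wt ga m = 1 ↔ (Even (m 0) ↔ Even (m 2)) := by
  rw [wt, Fin.prod_univ_three, weight_ga.1, weight_ga.2.1, weight_ga.2.2]
  rcases Nat.even_or_odd (m 0) with h0 | h0 <;> rcases Nat.even_or_odd (m 2) with h2 | h2 <;>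
    norm_num [h0.neg_one_pow, h2.neg_one_pow, h0, h2, Nat.not_even_iff_odd.2]

theorem wt_gb (m : Fin 3 →₀ ℕ) : wt gb m = 1 ↔ (Even (m 0) ↔ Even (m 1)) := by
  rw [wt, Fin.prod_univ_three, weight_gb.1, weight_gb.2.1, weight_gb.2.2]
  rcases Nat.even_or_odd (m 0) with h0 | h0 <;> rcases Nat.even_or_odd (m 1) with h2 | h2 <;>
    norm_num [h0.neg_one_pow, h2.neg_one_pow, h0, h2, Nat.not_even_iff_odd.2]

theorem wt_sq (σ : Klein) (m : Fin 3 →₀ ℕ) : wt σ m * wt σ m = 1 := by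
  rw [← wt_mul, klein_sq, wt_one]

theorem wt_eq_neg_one (σ : Klein) (m : Fin 3 →₀ ℕ) : wt σ m = -1 ↔ ¬ wt σ m = 1 := by
  rcases mul_self_eq_one_iff.1 (wt_sq σ m) with h | h <;> rw [h] <;> norm_num

/-- The exponents of the monomials in the sector of `σ` on which conjugation acts through `χ`; it
suffices to test the two generators. -/
def inv (α : TwoCocycle Klein ℂ) (χ : Klein → ℂ) (σ : Klein) : Set (Fin 3 →₀ ℕ) :=
  {m | cm α ga σ * wt ga m = χ ga ∧ cm α gb σ * wt gb m = χ gb}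

theorem avg_eq_iff_inv {χ : Klein → ℂ} (hχ : ∀ σ τ, χ (σ * τ) = χ σ * χ τ)
    (h2 : ∀ σ, χ σ * χ σ = 1) (u : KleinCP α) :
    (cpData α).avg (selfBimod α) χ u = u ↔ ∀ σ, co α σ u ∈ restrictSupport ℂ (inv α χ σ) := by
  rw [(cpData α).avg_eq_iff (selfBimod α) hχ h2]
  have h : ∀ τ, (cpData α).conj (selfBimod α) τ u = χ τ • u ↔
      ∀ σ m, (co α σ u).coeff m ≠ 0 → cm α τ σ * wt τ m = χ τ := by
    intro τ
    have h3 : (cpData α).conj (selfBimod α) τ u = χ τ • u ↔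
        ∀ σ, co α σ ((cpData α).conj (selfBimod α) τ u) = co α σ (χ τ • u) :=
      ⟨fun h σ => by rw [h], co_ext⟩
    rw [h3]
    refine forall_congr' fun σ => ?_
    rw [co_conj, map_smul, MvPolynomial.ext_iff]
    refine forall_congr' fun m => ?_
    rw [coeff_smul, coeff_smul, coeff_kleinAct, smul_eq_mul, smul_eq_mul, ← mul_assoc,
      mul_eq_mul_right_iff]
    tauto
  have h1 : χ 1 = 1 := by
    have := h2 1
    rwa [← hχ, mul_one] at this
  simp only [h, mem_restrictSupport]
  constructor
  · intro h σ m hm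
    exact ⟨h ga σ m hm, h gb σ m hm⟩
  · intro h τ σ m hm
    obtain ⟨ha, hb⟩ := h σ m hm
    rcases klein_cases τ with rfl | rfl | rfl | rfl
    · rw [cm_one_left, wt_one, h1, one_mul]
    · exact ha
    · exact hb
    · rw [cm_mul_left, wt_mul, hχ, ← ha, ← hb]; ring

theorem mem_quad_inv {χ : Klein → ℂ} (hχ : ∀ σ τ, χ (σ * τ) = χ σ * χ τ)
    (h2 : ∀ σ, χ σ * χ σ = 1) {P Pa Pb Pc P' Pa' Pb' Pc' : Submodule ℂ PolyXYZ}
    (h : P' = P ⊓ restrictSupport ℂ (inv α χ 1)) (ha : Pa' = Pa ⊓ restrictSupport ℂ (inv α χ ga))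
    (hb : Pb' = Pb ⊓ restrictSupport ℂ (inv α χ gb))
    (hc : Pc' = Pc ⊓ restrictSupport ℂ (inv α χ gc)) (u : KleinCP α) :
    u ∈ quad α P' Pa' Pb' Pc' ↔
      u ∈ quad α P Pa Pb Pc ∧ (cpData α).avg (selfBimod α) χ u = u := by
  rw [avg_eq_iff_inv hχ h2, forall_klein, mem_quad, mem_quad, h, ha, hb, hc]
  simp only [Submodule.mem_inf]
  tauto

/-- The subspace is mapped to itself by the group. -/
def IsStable (P : Submodule ℂ PolyXYZ) : Prop := ∀ τ, ∀ p ∈ P, kleinAct τ p ∈ P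

theorem isStable_restrictSupport (N : Set (Fin 3 →₀ ℕ)) : IsStable (restrictSupport ℂ N) := by
  intro τ p hp
  rw [mem_restrictSupport] at *
  intro m hm
  rw [coeff_kleinAct] at hm
  exact hp m (right_ne_zero_of_mul hm)

theorem isStable_bot : IsStable ⊥ := by
  rintro τ p hp
  rw [(Submodule.mem_bot ℂ).1 hp, map_zero]
  exact zero_mem _

theorem isStable_top : IsStable ⊤ := fun _ _ _ => trivial

theorem isStable_polysIn_X (i : Fin 3) : IsStable (polysIn {(X i : PolyXYZ)}) := by
  rw [polysIn_X]
  exact isStable_restrictSupport _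

theorem avg_mem_quad {P Pa Pb Pc : Submodule ℂ PolyXYZ} (h : IsStable P) (ha : IsStable Pa)
    (hb : IsStable Pb) (hc : IsStable Pc) (χ : Klein → ℂ) {u : KleinCP α}
    (hu : u ∈ quad α P Pa Pb Pc) :
    (cpData α).avg (selfBimod α) χ u ∈ quad α P Pa Pb Pc := by
  rw [KoszulData.avg_apply]
  refine Submodule.smul_mem _ _ (Submodule.sum_mem _ fun τ _ => Submodule.smul_mem _ _ ?_)
  rw [mem_quad] at *
  simp only [co_conj]
  exact ⟨Submodule.smul_mem _ _ (h _ _ hu.1), Submodule.smul_mem _ _ (ha _ _ hu.2.1),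
    Submodule.smul_mem _ _ (hb _ _ hu.2.2.1), Submodule.smul_mem _ _ (hc _ _ hu.2.2.2)⟩

/-! ### Invariants in the sector of the identity -/

theorem inv_one (χ : Klein → ℂ) : inv α χ 1 = {m | wt ga m = χ ga ∧ wt gb m = χ gb} := by
  simp only [inv, cm_one_right, one_mul]

theorem polysIn_eq_inf : polysIn {x ^ 2, y ^ 2, z ^ 2, x * y * z} =
    ⊤ ⊓ restrictSupport ℂ (inv α (fun _ => 1) 1) := by
  rw [polysIn_inv, top_inf_eq, inv_one]
  congr 1
  ext m
  simp only [Set.mem_ofPred_eq, wt_ga, wt_gb]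
  tauto

theorem evenSpan_eq_inf_zero :
    evenSpan x (y * z) = ⊤ ⊓ restrictSupport ℂ (inv α (fun σ => weight σ 0) 1) := by
  rw [evenSpan_X (by decide) (by decide) (by decide), top_inf_eq, inv_one]
  congr 1
  ext m
  simp only [Set.mem_ofPred_eq, weight_ga, weight_gb, wt_eq_neg_one, wt_ga, wt_gb]
  tauto

theorem evenSpan_eq_inf_one :
    evenSpan y (x * z) = ⊤ ⊓ restrictSupport ℂ (inv α (fun σ => weight σ 1) 1) := by
  rw [evenSpan_X (by decide) (by decide) (by decide), top_inf_eq, inv_one]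
  congr 1
  ext m
  simp only [Set.mem_ofPred_eq, weight_ga, weight_gb, wt_eq_neg_one, wt_ga, wt_gb]
  tauto

theorem evenSpan_eq_inf_two :
    evenSpan z (x * y) = ⊤ ⊓ restrictSupport ℂ (inv α (fun σ => weight σ 2) 1) := by
  rw [evenSpan_X (by decide) (by decide) (by decide), top_inf_eq, inv_one]
  congr 1
  ext m
  simp only [Set.mem_ofPred_eq, weight_ga, weight_gb, wt_eq_neg_one, wt_ga, wt_gb]
  tauto

/-! ### Invariants in the other sectors -/

/-- In the sector of a nontrivial `σ` only powers of one variable are left, so the invariants are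
those powers whose exponent satisfies a condition `P`. -/
theorem axis_inf_eq {k : Fin 3} {χ : Klein → ℂ} {σ : Klein} {P : ℕ → Prop}
    (h : ∀ m ∈ axis k, m ∈ inv α χ σ ↔ P (m k)) :
    polysIn {(X k : PolyXYZ)} ⊓ restrictSupport ℂ (inv α χ σ) =
      restrictSupport ℂ (axis k ∩ {m | P (m k)}) := by
  rw [polysIn_X, restrictSupport_inf]
  congr 1
  ext m
  simp only [Set.mem_inter_iff, Set.mem_ofPred_eq]
  exact and_congr_right fun hm => h m hm

theorem mem_inv_ga {m : Fin 3 →₀ ℕ} (hm : m ∈ axis 1) (χ : Klein → ℂ) : m ∈ inv α χ ga ↔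
    1 = χ ga ∧ cm α gb ga * (if Even (m 1) then 1 else -1) = χ gb := by
  have h0 : m 0 = 0 := hm 0 (by decide)
  have h2 : m 2 = 0 := hm 2 (by decide)
  have ha : wt ga m = 1 := by rw [wt_ga, h0, h2]
  have hb : wt gb m = if Even (m 1) then 1 else -1 := by
    split_ifs with h
    · rw [wt_gb]; simp [h0, h]
    · rw [wt_eq_neg_one, wt_gb]; simp [h0, h]
  change cm α ga ga * wt ga m = χ ga ∧ cm α gb ga * wt gb m = χ gb ↔ _
  rw [ha, hb, cm_self, one_mul]

theorem mem_inv_gb {m : Fin 3 →₀ ℕ} (hm : m ∈ axis 2) (χ : Klein → ℂ) : m ∈ inv α χ gb ↔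
    cm α gb ga * (if Even (m 2) then 1 else -1) = χ ga ∧ 1 = χ gb := by
  have h0 : m 0 = 0 := hm 0 (by decide)
  have h1 : m 1 = 0 := hm 1 (by decide)
  have hb : wt gb m = 1 := by rw [wt_gb, h0, h1]
  have ha : wt ga m = if Even (m 2) then 1 else -1 := by
    split_ifs with h
    · rw [wt_ga]; simp [h0, h]
    · rw [wt_eq_neg_one, wt_ga]; simp [h0, h]
  change cm α ga gb * wt ga m = χ ga ∧ cm α gb gb * wt gb m = χ gb ↔ _
  rw [ha, hb, cm_self, one_mul, cm_comm α ga gb]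

theorem mem_inv_gc {m : Fin 3 →₀ ℕ} (hm : m ∈ axis 0) (χ : Klein → ℂ) : m ∈ inv α χ gc ↔
    cm α gb ga * (if Even (m 0) then 1 else -1) = χ ga ∧
      cm α gb ga * (if Even (m 0) then 1 else -1) = χ gb := by
  have h1 : m 1 = 0 := hm 1 (by decide)
  have h2 : m 2 = 0 := hm 2 (by decide)
  have ha : wt ga m = if Even (m 0) then 1 else -1 := by
    split_ifs with h
    · rw [wt_ga]; simp [h2, h]
    · rw [wt_eq_neg_one, wt_ga]; simp [h2, h]
  have hb : wt gb m = if Even (m 0) then 1 else -1 := by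
    split_ifs with h
    · rw [wt_gb]; simp [h1, h]
    · rw [wt_eq_neg_one, wt_gb]; simp [h1, h]
  change cm α ga gc * wt ga m = χ ga ∧ cm α gb gc * wt gb m = χ gb ↔ _
  rw [ha, hb, (cm_gc α).1, (cm_gc α).2]

theorem sign_eq_one_iff (p : Prop) [Decidable p] : (if p then (1 : ℂ) else -1) = 1 ↔ p := by
  split_ifs <;> norm_num <;> assumption

theorem sign_eq_neg_one_iff (p : Prop) [Decidable p] : (if p then (1 : ℂ) else -1) = -1 ↔ ¬ p := by
  split_ifs <;> norm_num <;> assumption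

/-- With trivial commutator, the characters of the top degree select even exponents, and those
of degree two odd ones. -/
theorem inf_inv_of_eq_one (h : cm α gb ga = 1) :
    (polysIn {y ^ 2} = polysIn {y} ⊓ restrictSupport ℂ (inv α (fun _ => 1) ga) ∧
      polysIn {z ^ 2} = polysIn {z} ⊓ restrictSupport ℂ (inv α (fun _ => 1) gb) ∧
      polysIn {x ^ 2} = polysIn {x} ⊓ restrictSupport ℂ (inv α (fun _ => 1) gc)) ∧
    times y (polysIn {y ^ 2}) =
      polysIn {y} ⊓ restrictSupport ℂ (inv α (fun σ => weight σ 1) ga) ∧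
    times z (polysIn {z ^ 2}) =
      polysIn {z} ⊓ restrictSupport ℂ (inv α (fun σ => weight σ 2) gb) ∧
    times x (polysIn {x ^ 2}) =
      polysIn {x} ⊓ restrictSupport ℂ (inv α (fun σ => weight σ 0) gc) := by
  refine ⟨⟨?_, ?_, ?_⟩, ?_, ?_, ?_⟩
  · rw [polysIn_X_sq, axis_inf_eq]
    intro m hm
    rw [mem_inv_ga hm, h, one_mul, sign_eq_one_iff]
    simp
  · rw [polysIn_X_sq, axis_inf_eq]
    intro m hm
    rw [mem_inv_gb hm, h, one_mul, sign_eq_one_iff]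
    simp
  · rw [polysIn_X_sq, axis_inf_eq]
    intro m hm
    rw [mem_inv_gc hm, h, one_mul, sign_eq_one_iff]
    simp
  · rw [times_X_polysIn_X_sq, axis_inf_eq]
    intro m hm
    rw [mem_inv_ga hm, h, ← Nat.not_even_iff_odd, weight_ga.2.1, weight_gb.2.1, one_mul,
      sign_eq_neg_one_iff]
    simp
  · rw [times_X_polysIn_X_sq, axis_inf_eq]
    intro m hm
    rw [mem_inv_gb hm, h, ← Nat.not_even_iff_odd, weight_ga.2.2, weight_gb.2.2, one_mul,
      sign_eq_neg_one_iff]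
    simp
  · rw [times_X_polysIn_X_sq, axis_inf_eq]
    intro m hm
    rw [mem_inv_gc hm, h, ← Nat.not_even_iff_odd, weight_ga.1, weight_gb.1, one_mul,
      sign_eq_neg_one_iff]
    simp

/-- With commutator `-1`, the parities are exchanged. -/
theorem inf_inv_of_eq_neg_one (h : cm α gb ga = -1) :
    (times y (polysIn {y ^ 2}) = polysIn {y} ⊓ restrictSupport ℂ (inv α (fun _ => 1) ga) ∧
      times z (polysIn {z ^ 2}) = polysIn {z} ⊓ restrictSupport ℂ (inv α (fun _ => 1) gb) ∧
      times x (polysIn {x ^ 2}) = polysIn {x} ⊓ restrictSupport ℂ (inv α (fun _ => 1) gc)) ∧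
    polysIn {y ^ 2} = polysIn {y} ⊓ restrictSupport ℂ (inv α (fun σ => weight σ 1) ga) ∧
    polysIn {z ^ 2} = polysIn {z} ⊓ restrictSupport ℂ (inv α (fun σ => weight σ 2) gb) ∧
    polysIn {x ^ 2} = polysIn {x} ⊓ restrictSupport ℂ (inv α (fun σ => weight σ 0) gc) := by
  have hs : ∀ c : ℂ, -1 * c = 1 ↔ c = -1 := fun c => by rw [neg_one_mul, neg_eq_iff_eq_neg]
  have hs' : ∀ c : ℂ, -1 * c = -1 ↔ c = 1 := fun c => by rw [neg_one_mul, neg_inj]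
  refine ⟨⟨?_, ?_, ?_⟩, ?_, ?_, ?_⟩
  · rw [times_X_polysIn_X_sq, axis_inf_eq]
    intro m hm
    rw [mem_inv_ga hm, h, hs, sign_eq_neg_one_iff, Nat.not_even_iff_odd]
    simp
  · rw [times_X_polysIn_X_sq, axis_inf_eq]
    intro m hm
    rw [mem_inv_gb hm, h, hs, sign_eq_neg_one_iff, Nat.not_even_iff_odd]
    simp
  · rw [times_X_polysIn_X_sq, axis_inf_eq]
    intro m hm
    rw [mem_inv_gc hm, h, hs, sign_eq_neg_one_iff, Nat.not_even_iff_odd]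
    simp
  · rw [polysIn_X_sq, axis_inf_eq]
    intro m hm
    rw [mem_inv_ga hm, h, weight_ga.2.1, weight_gb.2.1, hs', sign_eq_one_iff]
    simp
  · rw [polysIn_X_sq, axis_inf_eq]
    intro m hm
    rw [mem_inv_gb hm, h, weight_ga.2.2, weight_gb.2.2, hs', sign_eq_one_iff]
    simp
  · rw [polysIn_X_sq, axis_inf_eq]
    intro m hm
    rw [mem_inv_gc hm, h, weight_ga.1, weight_gb.1, hs', sign_eq_one_iff]
    simp

end Invariants

/-! ### Representatives of the Hochschild classes -/

section Final

open CrossedProduct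

variable {α : TwoCocycle Klein ℂ}

section Generic

variable {B Γ J : Type} [Ring B] [Algebra ℂ B] [Group Γ] [Fintype Γ] {D : KoszulData ℂ B Γ J}
  {φ : B →ₐ[ℂ] KleinCP α}
  (hD : ∀ i u, D.adj (Bimod.ofAlgHom φ) i u = ad α (MvPolynomial.X i) u)
include hD

theorem kd0_eq (v : Fin 1 → KleinCP α) : D.kd0 (Bimod.ofAlgHom φ) v = koszul1 α (v 0) := by
  rw [KoszulData.kd0_apply, koszul1_apply]
  simp only [hD]

theorem kd1_eq (v : Fin 3 → KleinCP α) : D.kd1 (Bimod.ofAlgHom φ) v = koszul2 α v := by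
  rw [KoszulData.kd1_apply, koszul2_apply]
  simp only [hD]

theorem kd2_eq (v : Fin 3 → KleinCP α) (i : Fin 1) :
    D.kd2 (Bimod.ofAlgHom φ) v i = koszul3 α v := by
  rw [KoszulData.kd2_apply, koszul3_apply]
  simp only [hD]

theorem representedBy_zero {κ : HCochain ℂ B (KleinCP α) 0 → KleinCP α}
    {W : Submodule ℂ (KleinCP α)} (hκ : ∀ f, κ f = f ![])
    (hstab : ∀ u ∈ sec α 1 ⊤, D.avg (Bimod.ofAlgHom φ) (fun _ => 1) u ∈ sec α 1 ⊤)
    (hW : ∀ u, u ∈ W ↔ u ∈ sec α 1 ⊤ ∧ D.avg (Bimod.ofAlgHom φ) (fun _ => 1) u = u) :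
    RepresentedBy φ 0 κ ⊥ W := by
  refine D.representedBy φ 0 (LinearEquiv.funUnique (Fin 1) ℂ (KleinCP α))
    (Z := LinearMap.ker (koszul1 α)) (W₀ := sec α 1 ⊤) hκ ?_ ?_ ?_ ?_ ?_
  · intro v
    exact Eq.congr_left (kd0_eq hD v).symm
  · intro v
    exact LinearEquiv.map_eq_zero_iff (LinearEquiv.funUnique (Fin 1) ℂ (KleinCP α))
  · rw [ker_koszul1]
    exact ⟨sup_bot_eq _, inf_bot_eq _⟩
  · intro v hv
    exact hstab _ hv
  · intro v
    refine (hW _).trans (and_congr_right fun _ => ⟨fun h => funext fun i => ?_, fun h =>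
      congrFun h (0 : Fin 1)⟩)
    obtain rfl : i = (0 : Fin 1) := Subsingleton.elim (α := Fin 1) _ _
    exact h

theorem representedBy_one {κ : HCochain ℂ B (KleinCP α) 1 → Fin 3 → KleinCP α}
    {W : Submodule ℂ (Fin 3 → KleinCP α)} (hκ : ∀ f i, κ f i = f ![D.X i])
    (hstab : ∀ i, ∀ u ∈ sec α 1 ⊤, D.avg (Bimod.ofAlgHom φ) (D.chi 1 i) u ∈ sec α 1 ⊤)
    (hW : ∀ v, v ∈ W ↔ v ∈ columns (sec α 1 ⊤) (sec α 1 ⊤) (sec α 1 ⊤) ∧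
      ∀ i, D.avg (Bimod.ofAlgHom φ) (D.chi 1 i) (v i) = v i) :
    RepresentedBy φ 1 κ (LinearMap.range (koszul1 α)) W := by
  refine D.representedBy φ 1 (LinearEquiv.refl ℂ (Fin 3 → KleinCP α))
    (Z := LinearMap.ker (koszul2 α)) (W₀ := columns (sec α 1 ⊤) (sec α 1 ⊤) (sec α 1 ⊤))
    (fun f => funext fun i => hκ f i) ?_ ?_ koszul_representatives_one ?_ ?_
  · intro v
    exact Eq.congr_left (kd1_eq hD v).symm
  · intro v
    constructor
    · rintro ⟨u, hu⟩
      exact ⟨fun _ => u, (kd0_eq hD _).trans hu⟩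
    · rintro ⟨u, hu⟩
      exact ⟨u (0 : Fin 1), (kd0_eq hD u).symm.trans hu⟩
  · intro v hv
    rw [mem_columns] at hv
    exact mem_columns.2 ⟨hstab 0 _ hv.1, hstab 1 _ hv.2.1, hstab 2 _ hv.2.2⟩
  · intro v
    exact (hW v).trans (and_congr_right fun _ => funext_iff.symm)

theorem representedBy_two {κ : HCochain ℂ B (KleinCP α) 2 → Fin 3 → KleinCP α}
    {W : Submodule ℂ (Fin 3 → KleinCP α)} (hκ : ∀ f, κ f = D.kap2 f)
    (hstab : ∀ v ∈ columns (sec α 1 ⊤ ⊔ sec α ga (polysIn {y}))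
      (sec α 1 ⊤ ⊔ sec α gc (polysIn {x})) (sec α 1 ⊤ ⊔ sec α gb (polysIn {z})),
      (fun i => D.avg (Bimod.ofAlgHom φ) (D.chi 2 i) (v i)) ∈
        columns (sec α 1 ⊤ ⊔ sec α ga (polysIn {y}))
          (sec α 1 ⊤ ⊔ sec α gc (polysIn {x})) (sec α 1 ⊤ ⊔ sec α gb (polysIn {z})))
    (hW : ∀ v, v ∈ W ↔ v ∈ columns (sec α 1 ⊤ ⊔ sec α ga (polysIn {y}))
      (sec α 1 ⊤ ⊔ sec α gc (polysIn {x})) (sec α 1 ⊤ ⊔ sec α gb (polysIn {z})) ∧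
      ∀ i, D.avg (Bimod.ofAlgHom φ) (D.chi 2 i) (v i) = v i) :
    RepresentedBy φ 2 κ (LinearMap.range (koszul2 α)) W := by
  refine D.representedBy φ 2 (LinearEquiv.refl ℂ (Fin 3 → KleinCP α))
    (Z := LinearMap.ker (koszul3 α)) hκ ?_ ?_ koszul_representatives_two ?_ ?_
  · intro v
    refine Iff.trans ?_ (funext_iff (f := D.kd2 (Bimod.ofAlgHom φ) v) (g := 0)).symm
    simp only [kd2_eq hD v, Pi.zero_apply, forall_const]
    exact Iff.rfl
  · intro v
    constructor
    · rintro ⟨u, hu⟩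
      exact ⟨u, (kd1_eq hD _).trans hu⟩
    · rintro ⟨u, hu⟩
      exact ⟨u, (kd1_eq hD u).symm.trans hu⟩
  · exact hstab
  · intro v
    exact (hW v).trans (and_congr_right fun _ => funext_iff.symm)

theorem representedBy_three {κ : HCochain ℂ B (KleinCP α) 3 → KleinCP α}
    {W : Submodule ℂ (KleinCP α)} (hκ : ∀ f, κ f = D.kap3 f 0)
    (hstab : ∀ u ∈ quad α ⊤ (polysIn {y}) (polysIn {z}) (polysIn {x}),
      D.avg (Bimod.ofAlgHom φ) (fun _ => 1) u ∈ quad α ⊤ (polysIn {y}) (polysIn {z}) (polysIn {x}))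
    (hW : ∀ u, u ∈ W ↔ u ∈ quad α ⊤ (polysIn {y}) (polysIn {z}) (polysIn {x}) ∧
      D.avg (Bimod.ofAlgHom φ) (fun _ => 1) u = u) :
    RepresentedBy φ 3 κ (LinearMap.range (koszul3 α)) W := by
  refine D.representedBy φ 3 (LinearEquiv.funUnique (Fin 1) ℂ (KleinCP α))
    (Z := ⊤) (W₀ := quad α ⊤ (polysIn {y}) (polysIn {z}) (polysIn {x})) hκ ?_ ?_ ?_ ?_ ?_
  · intro v
    exact iff_of_true trivial (Subsingleton.elim (α := Fin 0 → KleinCP α) _ _)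
  · intro v
    constructor
    · rintro ⟨u, hu⟩
      refine ⟨u, funext fun i => (kd2_eq hD u i).trans (hu.trans ?_)⟩
      obtain rfl : i = (0 : Fin 1) := Subsingleton.elim (α := Fin 1) _ _
      rfl
    · rintro ⟨u, hu⟩
      exact ⟨u, (kd2_eq hD u 0).symm.trans (congrFun hu (0 : Fin 1))⟩
  · rw [← sec_sup_eq_quad]
    exact koszul_representatives_three
  · intro v hv
    exact hstab _ hv
  · intro v
    refine (hW _).trans (and_congr_right fun _ => ⟨fun h => funext fun i => ?_, fun h =>
      congrFun h (0 : Fin 1)⟩)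
    obtain rfl : i = (0 : Fin 1) := Subsingleton.elim (α := Fin 1) _ _
    exact h

end Generic

theorem polyData_adj (i : Fin 3) (u : KleinCP α) :
    polyData.adj (Bimod.ofAlgHom (incl α)) i u = ad α (MvPolynomial.X i) u := rfl

theorem cpData_adj (i : Fin 3) (u : KleinCP α) :
    (cpData α).adj (selfBimod α) i u = ad α (MvPolynomial.X i) u := rfl

theorem polyData_avg {M : Type*} [AddCommGroup M] [Module ℂ M] (S : Bimod ℂ PolyXYZ M) (n : ℕ)
    (i : Fin (kdim n)) (m : M) : polyData.avg S (polyData.chi n i) m = m :=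
  congrFun (polyData_kpi S n fun _ => m) i

theorem res_apply {n : ℕ} (f : HCochain ℂ (KleinCP α) (KleinCP α) n) (v : Fin n → PolyXYZ) :
    f.res (incl α) v = f fun i => incl α (v i) := rfl

theorem kappa0_res (f : HCochain ℂ (KleinCP α) (KleinCP α) 0) :
    kappa0 (f.res (incl α)) = f ![] :=
  congrArg f (Subsingleton.elim _ _)

theorem kappa1_res (f : HCochain ℂ (KleinCP α) (KleinCP α) 1) (i : Fin 3) :
    kappa1 (f.res (incl α)) i = f ![(cpData α).X i] := by
  have h : ∀ a, (fun i => incl α (![a] i)) = ![incl α a] := fun a => by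
    funext i; fin_cases i; rfl
  fin_cases i <;> exact congrArg f (h _)

theorem kappa2_res (f : HCochain ℂ (KleinCP α) (KleinCP α) 2) :
    kappa2 (f.res (incl α)) = (cpData α).kap2 f := by
  have h : ∀ a b, (fun i => incl α (![a, b] i)) = ![incl α a, incl α b] := fun a b => by
    funext i; fin_cases i <;> rfl
  rw [KoszulData.kap2_apply, kappa2]
  simp only [res_apply, h]
  rfl

theorem kappa3_res (f : HCochain ℂ (KleinCP α) (KleinCP α) 3) :
    kappa3 (f.res (incl α)) = (cpData α).kap3 f 0 := by
  have h : ∀ a b c, (fun i => incl α (![a, b, c] i)) = ![incl α a, incl α b, incl α c] :=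
    fun a b c => by funext i; fin_cases i <;> rfl
  rw [KoszulData.kap3_apply, kappa3]
  simp only [res_apply, h]
  rfl

/-! ### Hochschild cohomology over the polynomial ring -/

theorem representedBy_incl_zero : RepresentedBy (incl α) 0 kappa0 ⊥ (sec α 1 ⊤) := by
  have h := fun u => polyData_avg (Bimod.ofAlgHom (incl α)) 0 (0 : Fin 1) u
  refine representedBy_zero polyData_adj (fun f => rfl) (fun u hu => ?_) (fun u => ?_)
  · exact (h u).symm ▸ hu
  · exact (and_iff_left (h u)).symm

theorem representedBy_incl_one : RepresentedBy (incl α) 1 kappa1 (LinearMap.range (koszul1 α))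
    (columns (sec α 1 ⊤) (sec α 1 ⊤) (sec α 1 ⊤)) := by
  refine representedBy_one polyData_adj (fun f i => ?_) (fun i u hu => ?_) (fun u => ?_)
  · fin_cases i <;> rfl
  · rw [polyData_avg]; exact hu
  · exact (and_iff_left fun i => polyData_avg _ 1 i _).symm

theorem representedBy_incl_two : RepresentedBy (incl α) 2 kappa2 (LinearMap.range (koszul2 α))
    (columns (sec α 1 ⊤ ⊔ sec α ga (polysIn {y})) (sec α 1 ⊤ ⊔ sec α gc (polysIn {x}))
      (sec α 1 ⊤ ⊔ sec α gb (polysIn {z}))) := by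
  refine representedBy_two polyData_adj (fun f => ?_) (fun u hu => ?_) (fun u => ?_)
  · rw [KoszulData.kap2_apply]; rfl
  · have h : (fun i => polyData.avg (Bimod.ofAlgHom (incl α)) (polyData.chi 2 i) (u i)) = u :=
      funext fun i => polyData_avg _ 2 i _
    rw [h]; exact hu
  · exact (and_iff_left fun i => polyData_avg _ 2 i _).symm

theorem representedBy_incl_three : RepresentedBy (incl α) 3 kappa3 (LinearMap.range (koszul3 α))
    (sec α 1 ⊤ ⊔ sec α ga (polysIn {y}) ⊔ sec α gb (polysIn {z}) ⊔ sec α gc (polysIn {x})) := by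
  have h := fun u => polyData_avg (Bimod.ofAlgHom (incl α)) 3 (0 : Fin 1) u
  rw [sec_sup_eq_quad]
  refine representedBy_three polyData_adj (fun f => rfl) (fun u hu => ?_) (fun u => ?_)
  · exact (h u).symm ▸ hu
  · exact (and_iff_left (h u)).symm

theorem polyData_adj_self (i : Fin 3) (p : PolyXYZ) :
    polyData.adj (Bimod.ofAlgHom (AlgHom.id ℂ PolyXYZ)) i p = 0 :=
  sub_eq_zero.2 (mul_comm (MvPolynomial.X i) p)

theorem representedBy_poly_zero :
    RepresentedBy (AlgHom.id ℂ PolyXYZ) 0 kappa0 ⊥ ⊤ := by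
  refine polyData.representedBy (AlgHom.id ℂ PolyXYZ) 0 (LinearEquiv.funUnique (Fin 1) ℂ PolyXYZ)
    (Z := ⊤) (W₀ := ⊤) (fun f => rfl) ?_ ?_ ?_ ?_ ?_
  · intro v
    exact iff_of_true trivial (funext fun i => polyData_adj_self i _)
  · intro v
    exact LinearEquiv.map_eq_zero_iff (LinearEquiv.funUnique (Fin 1) ℂ PolyXYZ)
  · exact ⟨sup_bot_eq _, inf_bot_eq _⟩
  · intro v _
    trivial
  · intro v
    exact (and_iff_left (polyData_kpi _ 0 v)).symm

theorem representedBy_poly_one :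
    RepresentedBy (AlgHom.id ℂ PolyXYZ) 1 kappa1 ⊥ ⊤ := by
  refine polyData.representedBy (AlgHom.id ℂ PolyXYZ) 1 (LinearEquiv.refl ℂ (Fin 3 → PolyXYZ))
    (Z := ⊤) (W₀ := ⊤) (fun f => funext fun i => ?_) ?_ ?_ ?_ ?_ ?_
  · change Fin 3 at i
    fin_cases i <;> rfl
  · intro v
    have h : polyData.kd1 (Bimod.ofAlgHom (AlgHom.id ℂ PolyXYZ)) v = 0 := by
      rw [KoszulData.kd1_apply]
      simp only [polyData_adj_self]
      funext i
      fin_cases i <;> simp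
    exact iff_of_true trivial h
  · intro v
    have h : ∀ u : Fin 1 → PolyXYZ,
        polyData.kd0 (Bimod.ofAlgHom (AlgHom.id ℂ PolyXYZ)) u = 0 :=
      fun u => funext fun i => polyData_adj_self i _
    constructor
    · intro hv
      exact ⟨0, (h 0).trans ((Submodule.mem_bot ℂ).1 hv).symm⟩
    · rintro ⟨u, hu⟩
      exact (Submodule.mem_bot ℂ).2 (hu.symm.trans (h u))
  · exact ⟨sup_bot_eq _, inf_bot_eq _⟩
  · intro v _
    trivial
  · intro v
    exact (and_iff_left (polyData_kpi _ 1 v)).symm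

/-! ### Hochschild cohomology of the crossed product -/

theorem bot_eq_inf (Q : Submodule ℂ PolyXYZ) : (⊥ : Submodule ℂ PolyXYZ) = ⊥ ⊓ Q :=
  (bot_inf_eq Q).symm

theorem mem_sec_inv_iff (u : KleinCP α) :
    u ∈ sec α 1 (polysIn {x ^ 2, y ^ 2, z ^ 2, x * y * z}) ↔
      u ∈ sec α 1 ⊤ ∧ (cpData α).avg (selfBimod α) (fun _ => 1) u = u := by
  rw [sec_one_eq_quad, sec_one_eq_quad]
  exact mem_quad_inv (fun _ _ => (one_mul 1).symm) (fun _ => one_mul 1) polysIn_eq_inf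
    (bot_eq_inf _) (bot_eq_inf _) (bot_eq_inf _) u

theorem representedBy_self_zero : RepresentedBy (AlgHom.id ℂ (KleinCP α)) 0
    (fun f => kappa0 (f.res (incl α))) ⊥
    (sec α 1 (polysIn {x ^ 2, y ^ 2, z ^ 2, x * y * z})) := by
  refine representedBy_zero cpData_adj kappa0_res ?_ mem_sec_inv_iff
  intro u hu
  rw [sec_one_eq_quad] at *
  exact avg_mem_quad isStable_top isStable_bot isStable_bot isStable_bot _ hu

theorem representedBy_self_one : RepresentedBy (AlgHom.id ℂ (KleinCP α)) 1
    (fun f => kappa1 (f.res (incl α))) (LinearMap.range (koszul1 α))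
    (columns (sec α 1 (evenSpan x (y * z))) (sec α 1 (evenSpan y (x * z)))
      (sec α 1 (evenSpan z (x * y)))) := by
  refine representedBy_one cpData_adj kappa1_res ?_ ?_
  · intro i u hu
    rw [sec_one_eq_quad] at *
    exact avg_mem_quad isStable_top isStable_bot isStable_bot isStable_bot _ hu
  · intro v
    have h := fun (i : Fin 3) (P : Submodule ℂ PolyXYZ)
        (hP : P = ⊤ ⊓ MvPolynomial.restrictSupport ℂ (inv α (fun σ => weight σ i) 1)) =>
      mem_quad_inv (α := α) (χ := fun σ => weight σ i) (fun σ τ => weight_mul σ τ i)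
        (fun σ => weight_sq σ i) hP (bot_eq_inf _) (bot_eq_inf _) (bot_eq_inf _) (v i)
    have h0 := h 0 _ evenSpan_eq_inf_zero
    have h1 := h 1 _ evenSpan_eq_inf_one
    have h2 := h 2 _ evenSpan_eq_inf_two
    simp only [mem_columns, sec_one_eq_quad]
    rw [h0, h1, h2]
    have hf : (∀ i : Fin 3, (cpData α).avg (selfBimod α) ((cpData α).chi 1 i) (v i) = v i) ↔
        (cpData α).avg (selfBimod α) (fun σ => weight σ 0) (v 0) = v 0 ∧
        (cpData α).avg (selfBimod α) (fun σ => weight σ 1) (v 1) = v 1 ∧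
        (cpData α).avg (selfBimod α) (fun σ => weight σ 2) (v 2) = v 2 :=
      ⟨fun h => ⟨h 0, h 1, h 2⟩, fun h i => by
        fin_cases i
        exacts [h.1, h.2.1, h.2.2]⟩
    refine Iff.trans ?_ (and_congr_right fun _ => hf).symm
    exact ⟨fun ⟨⟨a, b⟩, ⟨c, d⟩, e, f⟩ => ⟨⟨a, c, e⟩, b, d, f⟩,
      fun ⟨⟨a, c, e⟩, b, d, f⟩ => ⟨⟨a, b⟩, ⟨c, d⟩, e, f⟩⟩

theorem representedBy_self_two {Qa Qb Qc : Submodule ℂ PolyXYZ}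
    (ha : Qa = polysIn {y} ⊓
      MvPolynomial.restrictSupport ℂ (inv α (fun σ => weight σ 1) ga))
    (hb : Qb = polysIn {z} ⊓
      MvPolynomial.restrictSupport ℂ (inv α (fun σ => weight σ 2) gb))
    (hc : Qc = polysIn {x} ⊓
      MvPolynomial.restrictSupport ℂ (inv α (fun σ => weight σ 0) gc)) :
    RepresentedBy (AlgHom.id ℂ (KleinCP α)) 2 (fun f => kappa2 (f.res (incl α)))
      (LinearMap.range (koszul2 α))
      (columns (sec α 1 (evenSpan y (x * z)) ⊔ sec α ga Qa)
        (sec α 1 (evenSpan x (y * z)) ⊔ sec α gc Qc)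
        (sec α 1 (evenSpan z (x * y)) ⊔ sec α gb Qb)) := by
  refine representedBy_two cpData_adj kappa2_res ?_ ?_
  · intro v hv
    simp only [mem_columns, sec_ga_eq_quad, sec_gb_eq_quad, sec_gc_eq_quad] at *
    exact ⟨avg_mem_quad isStable_top (isStable_polysIn_X 1) isStable_bot isStable_bot _ hv.1,
      avg_mem_quad isStable_top isStable_bot isStable_bot (isStable_polysIn_X 0) _ hv.2.1,
      avg_mem_quad isStable_top isStable_bot (isStable_polysIn_X 2) isStable_bot _ hv.2.2⟩
  · intro v
    have h0 := mem_quad_inv (α := α) (χ := fun σ => weight σ 1) (fun σ τ => weight_mul σ τ 1)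
      (fun σ => weight_sq σ 1) evenSpan_eq_inf_one ha (bot_eq_inf _) (bot_eq_inf _) (v 0)
    have h1 := mem_quad_inv (α := α) (χ := fun σ => weight σ 0) (fun σ τ => weight_mul σ τ 0)
      (fun σ => weight_sq σ 0) evenSpan_eq_inf_zero (bot_eq_inf _) (bot_eq_inf _) hc (v 1)
    have h2 := mem_quad_inv (α := α) (χ := fun σ => weight σ 2) (fun σ τ => weight_mul σ τ 2)
      (fun σ => weight_sq σ 2) evenSpan_eq_inf_two (bot_eq_inf _) hb (bot_eq_inf _) (v 2)
    simp only [mem_columns, sec_ga_eq_quad, sec_gb_eq_quad, sec_gc_eq_quad]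
    rw [h0, h1, h2]
    have hf : (∀ i : Fin 3, (cpData α).avg (selfBimod α) ((cpData α).chi 2 i) (v i) = v i) ↔
        (cpData α).avg (selfBimod α) (fun σ => weight σ 1) (v 0) = v 0 ∧
        (cpData α).avg (selfBimod α) (fun σ => weight σ 0) (v 1) = v 1 ∧
        (cpData α).avg (selfBimod α) (fun σ => weight σ 2) (v 2) = v 2 :=
      ⟨fun h => ⟨h 0, h 1, h 2⟩, fun h i => by
        fin_cases i
        exacts [h.1, h.2.1, h.2.2]⟩
    refine Iff.trans ?_ (and_congr_right fun _ => hf).symm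
    exact ⟨fun ⟨⟨a, b⟩, ⟨c, d⟩, e, f⟩ => ⟨⟨a, c, e⟩, b, d, f⟩,
      fun ⟨⟨a, c, e⟩, b, d, f⟩ => ⟨⟨a, b⟩, ⟨c, d⟩, e, f⟩⟩

theorem representedBy_self_three {Qa Qb Qc : Submodule ℂ PolyXYZ}
    (ha : Qa = polysIn {y} ⊓ MvPolynomial.restrictSupport ℂ (inv α (fun _ => 1) ga))
    (hb : Qb = polysIn {z} ⊓ MvPolynomial.restrictSupport ℂ (inv α (fun _ => 1) gb))
    (hc : Qc = polysIn {x} ⊓ MvPolynomial.restrictSupport ℂ (inv α (fun _ => 1) gc)) :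
    RepresentedBy (AlgHom.id ℂ (KleinCP α)) 3 (fun f => kappa3 (f.res (incl α)))
      (LinearMap.range (koszul3 α))
      (sec α 1 (polysIn {x ^ 2, y ^ 2, z ^ 2, x * y * z}) ⊔ sec α ga Qa ⊔ sec α gb Qb ⊔
        sec α gc Qc) := by
  rw [sec_sup_eq_quad]
  refine representedBy_three cpData_adj kappa3_res ?_ ?_
  · intro u hu
    exact avg_mem_quad isStable_top (isStable_polysIn_X 1) (isStable_polysIn_X 2)
      (isStable_polysIn_X 0) _ hu
  · exact mem_quad_inv (fun _ _ => (one_mul 1).symm) (fun _ => one_mul 1) polysIn_eq_inf ha hb hc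

/-! ### The centralizer of the polynomial ring and the center -/

theorem mem_map_incl (P : Subalgebra ℂ PolyXYZ) (u : KleinCP α) :
    u ∈ P.map (incl α) ↔ u ∈ sec α 1 (Subalgebra.toSubmodule P) := by
  constructor
  · rintro ⟨p, hp, rfl⟩
    exact ⟨((α 1 1 : ℂˣ) : ℂ)⁻¹ • p, P.smul_mem hp _, (incl_apply p).symm⟩
  · rintro ⟨p, hp, rfl⟩
    refine ⟨((α 1 1 : ℂˣ) : ℂ) • p, P.smul_mem hp _, ?_⟩
    refine (incl_apply _).trans ?_
    rw [smul_smul, inv_mul_cancel₀ (Units.ne_zero _), one_smul]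

theorem mem_range_incl (u : KleinCP α) : u ∈ (incl α).range ↔ u ∈ sec α 1 ⊤ := by
  rw [← Algebra.map_top, mem_map_incl, Algebra.top_toSubmodule]

theorem centralizer_range_incl :
    Subalgebra.centralizer ℂ ((incl α).range : Set (KleinCP α)) = (incl α).range := by
  ext u
  rw [Subalgebra.mem_centralizer_iff]
  constructor
  · intro h
    rw [mem_range_incl, ← ker_koszul1, LinearMap.mem_ker, koszul1_apply]
    funext i
    exact sub_eq_zero.2 (h _ ⟨MvPolynomial.X i, rfl⟩)
  · rintro ⟨p, rfl⟩ _ ⟨q, rfl⟩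
    change incl α q * incl α p = incl α p * incl α q
    rw [← map_mul, mul_comm, map_mul]

theorem center_eq : Subalgebra.center ℂ (KleinCP α) =
    (Algebra.adjoin ℂ {x ^ 2, y ^ 2, z ^ 2, x * y * z}).map (incl α) := by
  ext u
  rw [mem_map_incl, Subalgebra.mem_center_iff]
  refine Iff.trans ((cpData α).commutes_iff (selfBimod α) u) ?_
  refine Iff.trans ?_ (mem_sec_inv_iff u).symm
  refine and_congr_left fun _ => ?_
  rw [← ker_koszul1, LinearMap.mem_ker, koszul1_apply, funext_iff]
  rfl

end Final

end KleinOrbifold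

end

theorem mainTheorem3 (α : TwoCocycle Klein ℂ) :
    -- `HH^0(R, A) = A^R = R = HH^0(R)`
    (Subalgebra.centralizer ℂ ((incl α).range : Set (KleinCP α)) = (incl α).range ∧
      RepresentedBy (incl α) 0 kappa0 ⊥ (sec α 1 ⊤) ∧
      IsSpaceOfRepresentatives (LinearMap.ker (koszul1 α)) ⊥ (sec α 1 ⊤) ∧
      RepresentedBy (AlgHom.id ℂ PolyXYZ) 0 kappa0 ⊥ ⊤) ∧
    -- `HH^1(R, A) = R³ = HH^1(R)`
    (RepresentedBy (incl α) 1 kappa1 (LinearMap.range (koszul1 α))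
        (columns (sec α 1 ⊤) (sec α 1 ⊤) (sec α 1 ⊤)) ∧
      IsSpaceOfRepresentatives (LinearMap.ker (koszul2 α)) (LinearMap.range (koszul1 α))
        (columns (sec α 1 ⊤) (sec α 1 ⊤) (sec α 1 ⊤)) ∧
      RepresentedBy (AlgHom.id ℂ PolyXYZ) 1 kappa1 ⊥ ⊤) ∧
    -- `HH^2(R, A)`
    (RepresentedBy (incl α) 2 kappa2 (LinearMap.range (koszul2 α))
        (columns (sec α 1 ⊤ ⊔ sec α ga (polysIn {y})) (sec α 1 ⊤ ⊔ sec α gc (polysIn {x}))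
          (sec α 1 ⊤ ⊔ sec α gb (polysIn {z}))) ∧
      IsSpaceOfRepresentatives (LinearMap.ker (koszul3 α)) (LinearMap.range (koszul2 α))
        (columns (sec α 1 ⊤ ⊔ sec α ga (polysIn {y})) (sec α 1 ⊤ ⊔ sec α gc (polysIn {x}))
          (sec α 1 ⊤ ⊔ sec α gb (polysIn {z})))) ∧
    -- `HH^3(R, A)`
    (RepresentedBy (incl α) 3 kappa3 (LinearMap.range (koszul3 α))
        (sec α 1 ⊤ ⊔ sec α ga (polysIn {y}) ⊔ sec α gb (polysIn {z}) ⊔ sec α gc (polysIn {x})) ∧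
      IsSpaceOfRepresentatives ⊤ (LinearMap.range (koszul3 α))
        (sec α 1 ⊤ ⊔ sec α ga (polysIn {y}) ⊔ sec α gb (polysIn {z}) ⊔ sec α gc (polysIn {x}))) ∧
    -- `HH^n(R, A) = 0 = HH^n(A)` for `n > 3`
    (∀ n, 3 < n → Subsingleton (HH (incl α) n) ∧
      Subsingleton (HH (AlgHom.id ℂ (KleinCP α)) n)) ∧
    -- `HH^0(A) = ℂ[x²,y²,z²,xyz] = Z(A)`
    (Subalgebra.center ℂ (KleinCP α) =
        (Algebra.adjoin ℂ {x ^ 2, y ^ 2, z ^ 2, x * y * z}).map (incl α) ∧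
      RepresentedBy (AlgHom.id ℂ (KleinCP α)) 0 (fun f => kappa0 (f.res (incl α))) ⊥
        (sec α 1 (polysIn {x ^ 2, y ^ 2, z ^ 2, x * y * z}))) ∧
    -- `HH^1(A)`
    RepresentedBy (AlgHom.id ℂ (KleinCP α)) 1 (fun f => kappa1 (f.res (incl α)))
      (LinearMap.range (koszul1 α))
      (columns (sec α 1 (evenSpan x (y * z))) (sec α 1 (evenSpan y (x * z)))
        (sec α 1 (evenSpan z (x * y)))) ∧
    -- `HH^2(A)` and `HH^3(A)` for trivial `α`
    (α.IsTrivial →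
      RepresentedBy (AlgHom.id ℂ (KleinCP α)) 2 (fun f => kappa2 (f.res (incl α)))
        (LinearMap.range (koszul2 α))
        (columns (sec α 1 (evenSpan y (x * z)) ⊔ sec α ga (times y (polysIn {y ^ 2})))
          (sec α 1 (evenSpan x (y * z)) ⊔ sec α gc (times x (polysIn {x ^ 2})))
          (sec α 1 (evenSpan z (x * y)) ⊔ sec α gb (times z (polysIn {z ^ 2})))) ∧
      RepresentedBy (AlgHom.id ℂ (KleinCP α)) 3 (fun f => kappa3 (f.res (incl α)))
        (LinearMap.range (koszul3 α))
        (sec α 1 (polysIn {x ^ 2, y ^ 2, z ^ 2, x * y * z}) ⊔ sec α ga (polysIn {y ^ 2}) ⊔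
          sec α gb (polysIn {z ^ 2}) ⊔ sec α gc (polysIn {x ^ 2}))) ∧
    -- `HH^2(A)` and `HH^3(A)` for nontrivial `α`
    (¬ α.IsTrivial →
      RepresentedBy (AlgHom.id ℂ (KleinCP α)) 2 (fun f => kappa2 (f.res (incl α)))
        (LinearMap.range (koszul2 α))
        (columns (sec α 1 (evenSpan y (x * z)) ⊔ sec α ga (polysIn {y ^ 2}))
          (sec α 1 (evenSpan x (y * z)) ⊔ sec α gc (polysIn {x ^ 2}))
          (sec α 1 (evenSpan z (x * y)) ⊔ sec α gb (polysIn {z ^ 2}))) ∧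
      RepresentedBy (AlgHom.id ℂ (KleinCP α)) 3 (fun f => kappa3 (f.res (incl α)))
        (LinearMap.range (koszul3 α))
        (sec α 1 (polysIn {x ^ 2, y ^ 2, z ^ 2, x * y * z}) ⊔
          sec α ga (times y (polysIn {y ^ 2})) ⊔ sec α gb (times z (polysIn {z ^ 2})) ⊔
          sec α gc (times x (polysIn {x ^ 2})))) := by
  refine ⟨⟨centralizer_range_incl, representedBy_incl_zero, ?_, representedBy_poly_zero⟩,
    ⟨representedBy_incl_one, koszul_representatives_one, representedBy_poly_one⟩,
    ⟨representedBy_incl_two, koszul_representatives_two⟩,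
    ⟨representedBy_incl_three, koszul_representatives_three⟩,
    fun n hn => ⟨polyData.subsingleton_HH _ hn, (cpData α).subsingleton_HH _ hn⟩,
    ⟨center_eq, representedBy_self_zero⟩, representedBy_self_one, fun h => ?_, fun h => ?_⟩
  · rw [ker_koszul1]
    exact ⟨sup_bot_eq _, inf_bot_eq _⟩
  · obtain ⟨⟨h1, h2, h3⟩, h4, h5, h6⟩ := inf_inv_of_eq_one (cm_of_isTrivial α h)
    exact ⟨representedBy_self_two h4 h5 h6, representedBy_self_three h1 h2 h3⟩
  · obtain ⟨⟨h1, h2, h3⟩, h4, h5, h6⟩ := inf_inv_of_eq_neg_one (cm_of_not_isTrivial h)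
    exact ⟨representedBy_self_two h4 h5 h6, representedBy_self_three h1 h2 h3⟩
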